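/- Let $f,g:\mathbb{R}\to\mathbb{R}$ be smooth. Let $(t,x)\mapsto \underline{u}(x-\sigma t)$ be a traveling wave of $$\partial_t u+\partial_x(f(u))=g(u),\qquad (1)$$ with smooth profile $\underline{u}$, speed $\sigma\in\mathbb{R}$ and endstates $u_\pm=\lim_{x\to\pm\infty}\underline{u}(x)\in\mathbb{R}$, so that $-\sigma\underline{u}'+(f(\underline{u}))'=g(\underline{u})$ on $\mathbb{R}$. Suppose that the wave is non-characteristic, that is, $f'(\underline{u}(x))\neq\sigma$ for every $x\in\mathbb{R}$ and $f'(u_\pm)\neq\sigma$, and that $g'(u_-)<0<g'(u_+)$. Let $BUC^0(\mathbb{R})$ be the space of bounded uniformly continuous functions, and $BUC^1(\mathbb{R})$ the space of $C^1$ functions that belong to $BUC^0(\mathbb{R})$ together with their first derivative. For $\kappa>0$ set $\Omega_\kappa^+(x)=\exp(-\kappa\max(x,0))$ and $$\|v\|_{W^{1,\infty}_{\kappa,+}}=\big\|(\Omega_\kappa^+)^{-1}\,(v,\partial_x v)\big\|_{L^\infty(\mathbb{R})}.$$ Let $\kappa\ge\kappa^+$, where $\kappa^+=g'(u_+)/|f'(u_+)-\sigma|$,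 and set $$\omega_\kappa=\min\big(|g'(u_-)|,\ (\kappa-\kappa^+)\,|f'(u_+)-\sigma|\big).$$ Then there exist $C>0$ and $\delta_0>0$ such that the following holds. If $u_0\in BUC^1(\mathbb{R})$ satisfies $(u_0-\underline{u})/\Omega_\kappa^+\in BUC^0(\mathbb{R})$, $\partial_x(u_0-\underline{u})/\Omega_\kappa^+\in BUC^0(\mathbb{R})$ and $$E_{0,\kappa}:=\|u_0-\underline{u}\|_{W^{1,\infty}_{\kappa,+}}\le\delta_0,$$ then (1) has a global entropy solution $u$ with $u(0,\cdot)=u_0$ that is bounded on $[0,T]\times\mathbb{R}$ for every $T>0$; it is of class $C^1$ on $[0,\infty)\times\mathbb{R}$; for every $T>0$, every bounded entropy solution of (1) on $(0,T)\times\mathbb{R}$ with initial datum $u_0$ coincides with $u$ almost everywhere; and for every $t\ge0$ $$\|u(t,\cdot+\sigma t)-\underline{u}\|_{W^{1,\infty}_{\kappa,+}}\le C\,E_{0,\kappa}\,e^{-\omega_\kappa t}.$$ In particular, for $\kappa=\kappa^+$ one has $\omega_\kappa=0$ and the estimate is a bound without decay. -/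

import Mathlib

open MeasureTheory Set Filter Topology
open scoped ENNReal ContDiff

/-- `BUC⁰(ℝ)`: bounded and uniformly continuous functions. -/
def IsBUC (h : ℝ → ℝ) : Prop :=
  UniformContinuous h ∧ ∃ M : ℝ, ∀ x, |h x| ≤ M

/-- `BUC¹(ℝ)`: functions of class `C¹` that are bounded and uniformly continuous together with
their first derivative. -/
def IsBUC1 (h : ℝ → ℝ) : Prop :=
  ContDiff ℝ 1 h ∧ IsBUC h ∧ IsBUC (deriv h)

/-- The weight `Ω_κ⁺(x) = exp (-κ x₊)`, where `x₊ = max x 0`. -/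
noncomputable def expWeight (κ x : ℝ) : ℝ := Real.exp (-κ * max x 0)

/-- The weighted norm `‖(Ω_κ⁺)⁻¹ (v, ∂ₓ v)‖_{L^∞(ℝ)}` of a `C¹` function `v`, as an extended
nonnegative real (`ℝ × ℝ` carries the maximum norm). -/
noncomputable def weightedNorm (κ : ℝ) (v : ℝ → ℝ) : ℝ≥0∞ :=
  eLpNorm (fun x : ℝ => (expWeight κ x)⁻¹ • (v x, deriv v x)) ⊤ volume

/-- `(t, x) ↦ U (x - σ t)` is a smooth non-characteristic traveling wave of
`∂ₜ u + ∂ₓ (f u) = g u`, with limits `um` at `-∞` and `up` at `+∞`: the profile solves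
`-σ U' + (f ∘ U)' = g ∘ U`, and `f' - σ` vanishes neither at a value of `U` nor at an endstate. -/
structure IsSmoothNoncharacteristicFront (f g U : ℝ → ℝ) (σ um up : ℝ) : Prop where
  smooth : ContDiff ℝ ∞ U
  profile_eq : ∀ x, -σ * deriv U x + deriv (fun y => f (U y)) x = g (U x)
  tendsto_left : Tendsto U atBot (𝓝 um)
  tendsto_right : Tendsto U atTop (𝓝 up)
  noncharacteristic : ∀ x, deriv f (U x) ≠ σ
  noncharacteristic_left : deriv f um ≠ σ
  noncharacteristic_right : deriv f up ≠ σ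

/-- The critical exponent `κ⁺ = g'(u₊) / |f'(u₊) - σ|`. -/
noncomputable def criticalExponent (f g : ℝ → ℝ) (σ up : ℝ) : ℝ :=
  deriv g up / |deriv f up - σ|

/-- The rate `ω_κ = min (|g'(u₋)|, (κ - κ⁺) |f'(u₊) - σ|)`. -/
noncomputable def decayRate (f g : ℝ → ℝ) (σ um up κ : ℝ) : ℝ :=
  min |deriv g um| ((κ - criticalExponent f g σ up) * |deriv f up - σ|)

/-- `u` is a bounded entropy solution of `∂ₜ u + ∂ₓ (f u) = g u` on `(0, T) × ℝ` with initial
datum `u₀`: for every entropy pair `(η, q)`, that is, `η` convex of class `C²` and `q' = η' f'`,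
the inequality `∂ₜ (η u) + ∂ₓ (q u) ≤ η'(u) g(u)` holds in the weak sense, the datum `u₀` being
encoded by test functions that need not vanish at `t = 0`. -/
structure IsEntropySolution (f g u₀ : ℝ → ℝ) (T : ℝ) (u : ℝ → ℝ → ℝ) : Prop where
  aestronglyMeasurable : AEStronglyMeasurable (fun p : ℝ × ℝ => u p.1 p.2)
    (volume.restrict (Ioo 0 T ×ˢ univ))
  bounded : ∃ M : ℝ, ∀ᵐ p : ℝ × ℝ ∂(volume.restrict (Ioo 0 T ×ˢ univ)), |u p.1 p.2| ≤ M
  entropy_ineq : ∀ η q : ℝ → ℝ, ContDiff ℝ 2 η → ConvexOn ℝ univ η →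
    (∀ v, HasDerivAt q (deriv η v * deriv f v) v) →
    ∀ φ : ℝ × ℝ → ℝ, ContDiff ℝ 1 φ → HasCompactSupport φ → tsupport φ ⊆ Iio T ×ˢ univ →
      (∀ p, 0 ≤ φ p) →
      0 ≤ (∫ p in Ioo 0 T ×ˢ univ,
            (η (u p.1 p.2) * fderiv ℝ φ p (1, 0) + q (u p.1 p.2) * fderiv ℝ φ p (0, 1)
              + deriv η (u p.1 p.2) * g (u p.1 p.2) * φ p))
          + ∫ x, η (u₀ x) * φ (0, x)

/-! In the frame moving with speed `σ` the equation reads `∂ₜ u + a(u) ∂ₓ u = g(u)` with `a = f' -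
σ`, and the profile solves `U' = F(U)` with `F = g / a`. The slope `U'` solves a linear equation, so
it keeps a strict sign `s`. Since it tends to `0` at `+∞`, where `g'(u₊) > 0`, necessarily `a(u₊) <
0`, hence `a < 0` along the whole profile: every characteristic crosses the front from right to
left. Outside a neighborhood of the range of `U` the coefficients may be changed to make them
globally bounded (`exists_isFrontSystem`); solutions that stay close to `U` do not see the change.

The solution is built by characteristics: `X' = a(u)`, `u' = g(u)`, started at `y`. The decisive
point is that `W = s U'`, evaluated along a characteristic, is integrable in time: `s U(X)`
decreases at rate `-a(u) W(X)`, so `∫ W dt` is at most a constant times the variation of the front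
on the left of `y` (`abs_sub_le_mass`). All nonlinear errors are dominated by `η W`, where `η` is
the size of the initial perturbation relative to `W(y)`. They therefore stay small as soon as `η`
times that variation is small, without any exponential Grönwall factor. Comparing quantities with
their exact values on the front gives, uniformly in time, that `u - U(X)` is `O(η W(X))`
(`abs_perturbation_le`), that the Jacobian of the characteristics is bounded below, so that no shock
forms (`le_charJac`), and that `∂ₓ u - U'(X)` is `O(η W(X))` (`abs_slope_sub_le`).

The weight enters with `η = E Ω(y) / W(y)`. For `κ ≥ κ⁺` the weight decays at `+∞` at least as fast
as `W`, and at `-∞` the variation of `U` is itself `O(W)`. Hence `η` times the variation is `O(E)`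
for all `y` at once (`exists_mass_mul_weight_le`). The bound `η W(X)` becomes `E exp(-ω t) Ω(X)`
because `log W` and the travel time along the front are both piecewise linear up to bounded errors
(`exists_slope_mul_weight_le`).

Uniqueness among entropy solutions is the relative entropy argument with the quadratic entropy: the
classical solution is Lipschitz in space on time strips, and a test function dissipated by transport
at bounded speed localizes the estimate and absorbs the lower order terms
(`ae_eq_of_isEntropySolution`). -/

/-! ### Calculus preliminaries -/

/-- Differentiation under the integral sign over a compact interval. -/
theorem hasDerivAt_intervalIntegral_of_continuous {H H' : ℝ → ℝ → ℝ}
    (hH : ∀ y, Continuous (H y)) (hH' : Continuous (Function.uncurry H'))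
    (hd : ∀ y s, HasDerivAt (fun y => H y s) (H' y s) y) (a b y : ℝ) :
    HasDerivAt (fun y => ∫ s in a..b, H y s) (∫ s in a..b, H' y s) y := by
  obtain ⟨C, hC⟩ := ((isCompact_Icc (a := y - 1) (b := y + 1)).prod
    (isCompact_uIcc (a := a) (b := b))).exists_bound_of_continuousOn hH'.continuousOn
  refine (intervalIntegral.hasDerivAt_integral_of_dominated_loc_of_deriv_le (bound := fun _ => C)
    (s := Icc (y - 1) (y + 1)) (Icc_mem_nhds (by linarith) (by linarith)) ?_ ?_ ?_ ?_ ?_ ?_).2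
  · exact Eventually.of_forall fun x => (hH x).aestronglyMeasurable
  · exact (hH y).intervalIntegrable _ _
  · exact (hH'.uncurry_left y).aestronglyMeasurable
  · exact Eventually.of_forall fun t ht x hx => hC (x, t) ⟨hx, uIoc_subset_uIcc ht⟩
  · exact intervalIntegrable_const
  · exact Eventually.of_forall fun t _ x _ => hd x t

/-- A function of two real variables with continuous partial derivatives is of class `C¹`. -/
theorem contDiff_one_of_partial {h h₁ h₂ : ℝ → ℝ → ℝ}
    (d₁ : ∀ t y, HasDerivAt (fun t => h t y) (h₁ t y) t)
    (d₂ : ∀ t y, HasDerivAt (fun y => h t y) (h₂ t y) y)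
    (c₁ : Continuous (Function.uncurry h₁)) (c₂ : Continuous (Function.uncurry h₂)) :
    ContDiff ℝ 1 (fun p : ℝ × ℝ => h p.1 p.2) ∧
    ∀ p : ℝ × ℝ, HasFDerivAt (fun p : ℝ × ℝ => h p.1 p.2)
      ((ContinuousLinearMap.toSpanSingleton ℝ (h₁ p.1 p.2)).coprod
        (ContinuousLinearMap.toSpanSingleton ℝ (h₂ p.1 p.2))) p := by
  have cs : Continuous fun x : ℝ => ContinuousLinearMap.toSpanSingleton ℝ x :=
    (ContinuousLinearMap.toSpanSingletonCLE (𝕜 := ℝ) (E := ℝ)).continuous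
  have key : ∀ p : ℝ × ℝ, HasFDerivAt (fun p : ℝ × ℝ => h p.1 p.2)
      ((ContinuousLinearMap.toSpanSingleton ℝ (h₁ p.1 p.2)).coprod
        (ContinuousLinearMap.toSpanSingleton ℝ (h₂ p.1 p.2))) p := fun p =>
    (hasStrictFDerivAt_uncurry_coprod (𝕜 := ℝ) (u := p) (f := h)
      (f₁ := fun t y => ContinuousLinearMap.toSpanSingleton ℝ (h₁ t y))
      (f₂ := fun t y => ContinuousLinearMap.toSpanSingleton ℝ (h₂ t y))
      (Eventually.of_forall fun v => (d₁ v.1 v.2).hasFDerivAt)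
      (Eventually.of_forall fun v => (d₂ v.1 v.2).hasFDerivAt)
      (cs.comp c₁).continuousAt (cs.comp c₂).continuousAt).hasFDerivAt
  refine ⟨contDiff_one_iff_hasFDerivAt.2 ⟨_, ?_, key⟩, key⟩
  have h1 : Continuous fun p : ℝ × ℝ => h₁ p.1 p.2 := c₁
  have h2 : Continuous fun p : ℝ × ℝ => h₂ p.1 p.2 := c₂
  have e : (fun p : ℝ × ℝ => (ContinuousLinearMap.toSpanSingleton ℝ (h₁ p.1 p.2)).coprod
        (ContinuousLinearMap.toSpanSingleton ℝ (h₂ p.1 p.2))) =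
      fun p => (h₁ p.1 p.2) • ContinuousLinearMap.fst ℝ ℝ ℝ +
        (h₂ p.1 p.2) • ContinuousLinearMap.snd ℝ ℝ ℝ := by
    funext p; ext <;> simp
  rw [e]
  fun_prop

/-- The divided difference of `g`, in integral form. -/
noncomputable def dividedDiff (g : ℝ → ℝ) (a b : ℝ) : ℝ :=
  ∫ θ in (0 : ℝ)..1, deriv g (a + θ * (b - a))

/-- Makes the difference of two solutions of `u' = g(u)` a solution of a scalar linear equation with
continuous coefficient, for which `eq_mul_exp_integral` is an exact formula. -/
theorem sub_eq_mul_dividedDiff {g : ℝ → ℝ} (hg : ContDiff ℝ 1 g) (a b : ℝ) :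
    g b - g a = (b - a) * dividedDiff g a b := by
  have hc : Continuous (deriv g) := hg.continuous_deriv le_rfl
  have hd : ∀ x, HasDerivAt (fun θ : ℝ => g (a + θ * (b - a)))
      ((b - a) * deriv g (a + x * (b - a))) x := fun x => by
    have h1 := (hg.differentiable one_ne_zero (a + x * (b - a))).hasDerivAt
    have h2 : HasDerivAt (fun θ : ℝ => a + θ * (b - a)) (b - a) x := by
      simpa using ((hasDerivAt_id x).mul_const (b - a)).const_add a
    simpa [mul_comm, Function.comp_def] using h1.comp x h2
  have := intervalIntegral.integral_eq_sub_of_hasDerivAt (a := 0) (b := 1)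
    (fun x _ => hd x) (Continuous.intervalIntegrable (by fun_prop) _ _)
  rw [intervalIntegral.integral_const_mul] at this
  rw [dividedDiff, this]; simp

theorem continuous_dividedDiff {g : ℝ → ℝ} (hg : ContDiff ℝ 1 g) :
    Continuous (fun p : ℝ × ℝ => dividedDiff g p.1 p.2) := by
  have hc : Continuous (deriv g) := hg.continuous_deriv le_rfl
  exact intervalIntegral.continuous_parametric_intervalIntegral_of_continuous'
    (f := fun (p : ℝ × ℝ) θ => deriv g (p.1 + θ * (p.2 - p.1)))
    (by simp only [Function.uncurry_def]; fun_prop) 0 1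

@[simp] theorem dividedDiff_self (g : ℝ → ℝ) (a : ℝ) : dividedDiff g a a = deriv g a := by
  simp [dividedDiff]

theorem abs_dividedDiff_le {g : ℝ → ℝ} {K : ℝ} (hK : ∀ x, |deriv g x| ≤ K) (a b : ℝ) :
    |dividedDiff g a b| ≤ K := by
  simpa [dividedDiff] using intervalIntegral.norm_integral_le_of_norm_le_const (a := 0) (b := 1)
    (f := fun θ => deriv g (a + θ * (b - a))) (C := K) (fun x _ => hK _)

/-- Solutions of the scalar linear equation `x' = k x`. -/
theorem eq_mul_exp_integral {x k : ℝ → ℝ} (hk : Continuous k)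
    (hx : ∀ t, HasDerivAt x (k t * x t) t) (t₀ t : ℝ) :
    x t = x t₀ * Real.exp (∫ s in t₀..t, k s) := by
  have hI : ∀ t, HasDerivAt (fun t => ∫ s in t₀..t, k s) (k t) t := fun t =>
    intervalIntegral.integral_hasDerivAt_right (hk.intervalIntegrable _ _)
      hk.stronglyMeasurable.stronglyMeasurableAtFilter hk.continuousAt
  have hd : ∀ t, HasDerivAt (fun t => x t * Real.exp (-∫ s in t₀..t, k s)) 0 t := fun t => by
    have := (hx t).mul (hI t).neg.exp
    convert! this using 1
    ring
  have hcst := is_const_of_deriv_eq_zero (fun t => (hd t).differentiableAt)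
    (fun t => (hd t).deriv) t t₀
  simp only [intervalIntegral.integral_same, neg_zero, Real.exp_zero, mul_one] at hcst
  rw [← hcst, mul_assoc, ← Real.exp_add]
  simp

/-! ### The flow of a scalar vector field -/

/-- `Φ` is the global flow of the scalar vector field `g`. -/
structure IsScalarFlow (g : ℝ → ℝ) (Φ : ℝ → ℝ → ℝ) : Prop where
  zero : ∀ v, Φ 0 v = v
  hasDerivAt : ∀ v t, HasDerivAt (fun s => Φ s v) (g (Φ t v)) t

/-- Picard–Lindelöf on each interval `(-(n + 1), n + 1)`; the pieces agree on overlaps by uniqueness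
and are glued by selecting `n = ⌈|t|⌉₊` at time `t`. -/
theorem exists_globalSolution {g : ℝ → ℝ} {K : NNReal} (hK : LipschitzWith K g) {M : ℝ}
    (hM : ∀ x, |g x| ≤ M) (v : ℝ) :
    ∃ γ : ℝ → ℝ, γ 0 = v ∧ ∀ t, HasDerivAt γ (g (γ t)) t := by
  have hM0 : 0 ≤ M := (abs_nonneg _).trans (hM 0)
  have ex : ∀ n : ℕ, ∃ γ : ℝ → ℝ, γ 0 = v ∧ ∀ t ∈ Ioo (-(n + 1 : ℝ)) (n + 1),
      HasDerivAt γ (g (γ t)) t := fun n => by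
    have hn : (0 : ℝ) ≤ n + 1 := by positivity
    -- The radius `M (n + 1)` is the largest distance a solution of speed at most `M` can cover in
    -- this time, so the existence time is not shortened.
    have hp : IsPicardLindelof (fun _ => g) (tmin := -(n + 1 : ℝ)) (tmax := n + 1)
        ⟨0, by constructor <;> linarith⟩ v (M.toNNReal * (n + 1)) 0 M.toNNReal K :=
      .of_time_independent (fun x _ => by simpa [hM0] using hM x) hK.lipschitzOnWith (by simp)
    obtain ⟨γ, h0, h1⟩ := hp.exists_eq_forall_mem_Icc_hasDerivWithinAt₀
    exact ⟨γ, h0, fun t ht => (h1 t (Ioo_subset_Icc_self ht)).hasDerivAt (Icc_mem_nhds ht.1 ht.2)⟩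
  choose γ h0 h1 using ex
  have uniq : ∀ m n : ℕ, m ≤ n → EqOn (γ m) (γ n) (Ioo (-(m + 1 : ℝ)) (m + 1)) := fun m n hmn => by
    have hmn' : (m : ℝ) ≤ n := by exact_mod_cast hmn
    refine ODE_solution_unique_of_mem_Ioo (v := fun _ => g) (s := fun _ => univ) (K := K) (t₀ := 0)
      (fun t _ => hK.lipschitzOnWith) ⟨by linarith [m.cast_nonneg (α := ℝ)], by positivity⟩
      (fun t ht => ⟨h1 m t ht, trivial⟩)
      (fun t ht => ⟨h1 n t ⟨by linarith [ht.1], by linarith [ht.2]⟩, trivial⟩) ?_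
    rw [h0, h0]
  have hmem : ∀ t : ℝ, t ∈ Ioo (-((⌈|t|⌉₊ : ℝ) + 1)) ((⌈|t|⌉₊ : ℝ) + 1) := fun t => by
    have := Nat.le_ceil |t|
    rw [mem_Ioo, ← abs_lt]; linarith
  have heq : ∀ n : ℕ, ∀ t ∈ Ioo (-(n + 1 : ℝ)) (n + 1), γ ⌈|t|⌉₊ t = γ n t := fun n t ht => by
    rcases le_total ⌈|t|⌉₊ n with h | h
    · exact uniq _ _ h (hmem t)
    · exact (uniq _ _ h ht).symm
  refine ⟨fun t => γ ⌈|t|⌉₊ t, h0 _, fun t => ?_⟩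
  refine (h1 _ t (hmem t)).congr_of_eventuallyEq ?_
  filter_upwards [isOpen_Ioo.mem_nhds (hmem t)] with s hs
  exact heq _ s hs

theorem exists_isScalarFlow {g : ℝ → ℝ} {K : NNReal} (hK : LipschitzWith K g) {M : ℝ}
    (hM : ∀ x, |g x| ≤ M) : ∃ Φ, IsScalarFlow g Φ := by
  choose γ h0 h1 using fun v => exists_globalSolution hK hM v
  exact ⟨fun t v => γ v t, h0, h1⟩

namespace IsScalarFlow

variable {g : ℝ → ℝ} {Φ : ℝ → ℝ → ℝ}

theorem continuous_time (h : IsScalarFlow g Φ) (v : ℝ) : Continuous fun t => Φ t v :=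
  continuous_iff_continuousAt.2 fun t => (h.hasDerivAt v t).continuousAt

theorem sub_eq (h : IsScalarFlow g Φ) (hg : ContDiff ℝ 1 g) (t v w : ℝ) :
    Φ t w - Φ t v = (w - v) * Real.exp (∫ s in (0 : ℝ)..t, dividedDiff g (Φ s v) (Φ s w)) := by
  have := eq_mul_exp_integral (x := fun t => Φ t w - Φ t v)
    (k := fun s => dividedDiff g (Φ s v) (Φ s w))
    ((continuous_dividedDiff hg).comp₂ (h.continuous_time v) (h.continuous_time w))
    (fun t => by
      convert! (h.hasDerivAt w t).sub (h.hasDerivAt v t) using 1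
      rw [sub_eq_mul_dividedDiff hg, mul_comm]) 0 t
  simpa [h.zero] using this

theorem abs_sub_le (h : IsScalarFlow g Φ) (hg : ContDiff ℝ 1 g) {K : ℝ}
    (hK : ∀ x, |deriv g x| ≤ K) (t v w : ℝ) :
    |Φ t w - Φ t v| ≤ |w - v| * Real.exp (K * |t|) := by
  rw [h.sub_eq hg, abs_mul, Real.abs_exp]
  gcongr
  refine (le_abs_self _).trans ?_
  simpa using intervalIntegral.norm_integral_le_of_norm_le_const (a := 0) (b := t)
    (f := fun s => dividedDiff g (Φ s v) (Φ s w)) (C := K) (fun x _ => abs_dividedDiff_le hK _ _)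

theorem continuous (h : IsScalarFlow g Φ) (hg : ContDiff ℝ 1 g) {K : ℝ}
    (hK : ∀ x, |deriv g x| ≤ K) : Continuous (fun p : ℝ × ℝ => Φ p.1 p.2) := by
  refine continuous_iff_continuousAt.2 fun p => ?_
  have h1 : Tendsto (fun q : ℝ × ℝ => Φ q.1 p.2) (𝓝 p) (𝓝 (Φ p.1 p.2)) :=
    ((h.continuous_time p.2).comp continuous_fst).continuousAt
  have h2 : Tendsto (fun q : ℝ × ℝ => Φ q.1 q.2 - Φ q.1 p.2) (𝓝 p) (𝓝 0) := by
    refine squeeze_zero_norm (fun q => h.abs_sub_le hg hK q.1 p.2 q.2) ?_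
    have : Continuous fun q : ℝ × ℝ => |q.2 - p.2| * Real.exp (K * |q.1|) := by fun_prop
    simpa using this.tendsto p
  simpa [ContinuousAt] using h2.add h1

/-- The derivative of the flow with respect to the initial value. -/
theorem hasDerivAt_init (h : IsScalarFlow g Φ) (hg : ContDiff ℝ 1 g) {K : ℝ}
    (hK : ∀ x, |deriv g x| ≤ K) (t v : ℝ) :
    HasDerivAt (fun v => Φ t v) (Real.exp (∫ s in (0 : ℝ)..t, deriv g (Φ s v))) v := by
  have hΦ := h.continuous hg hK
  -- By `sub_eq` this exponential is the difference quotient between `v` and `w`; its continuity at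
  -- `w = v` gives the derivative.
  have hc : Continuous fun w => Real.exp (∫ s in (0 : ℝ)..t, dividedDiff g (Φ s v) (Φ s w)) := by
    refine Real.continuous_exp.comp
      (intervalIntegral.continuous_parametric_intervalIntegral_of_continuous'
        (f := fun w s => dividedDiff g (Φ s v) (Φ s w)) ?_ 0 t)
    refine (continuous_dividedDiff hg).comp₂ ?_ ?_
    · exact hΦ.comp₂ continuous_snd continuous_const
    · exact hΦ.comp₂ continuous_snd continuous_fst
  rw [hasDerivAt_iff_tendsto_slope]
  have := hc.tendsto v
  simp only [dividedDiff_self] at this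
  refine (this.mono_left nhdsWithin_le_nhds).congr' ?_
  filter_upwards [self_mem_nhdsWithin] with w hw
  have hw' : w - v ≠ 0 := sub_ne_zero.2 hw
  rw [slope_def_field, h.sub_eq hg]
  field_simp

end IsScalarFlow

/-! ### Characteristics of a scalar balance law -/

/-- The derivative of the flow of `g` in the initial value. -/
noncomputable def flowJac (g : ℝ → ℝ) (Φ : ℝ → ℝ → ℝ) (t v : ℝ) : ℝ :=
  Real.exp (∫ s in (0 : ℝ)..t, deriv g (Φ s v))

/-- The characteristic of `∂ₜ u + a(u) ∂ₓ u = g(u)` issued from `y`, for the datum `u₀`. -/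
noncomputable def charPos (a : ℝ → ℝ) (Φ : ℝ → ℝ → ℝ) (u₀ : ℝ → ℝ) (t y : ℝ) : ℝ :=
  y + ∫ s in (0 : ℝ)..t, a (Φ s (u₀ y))

/-- The derivative of `charPos` with respect to the foot of the characteristic. -/
noncomputable def charJac (a g : ℝ → ℝ) (Φ : ℝ → ℝ → ℝ) (u₀ : ℝ → ℝ) (t y : ℝ) : ℝ :=
  1 + ∫ s in (0 : ℝ)..t, deriv a (Φ s (u₀ y)) * (flowJac g Φ s (u₀ y) * deriv u₀ y)

theorem hasDerivAt_integral_zero {k : ℝ → ℝ} (hk : Continuous k) (t : ℝ) :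
    HasDerivAt (fun t => ∫ s in (0 : ℝ)..t, k s) (k t) t :=
  intervalIntegral.integral_hasDerivAt_right (hk.intervalIntegrable _ _)
    hk.stronglyMeasurable.stronglyMeasurableAtFilter hk.continuousAt

/-- The data of a scalar balance law `∂ₜ u + a(u) ∂ₓ u = g(u)` with globally bounded coefficients,
the flow of its source and an initial datum of class `C¹`. -/
structure IsCharSystem (a g : ℝ → ℝ) (Φ : ℝ → ℝ → ℝ) (u₀ : ℝ → ℝ) : Prop where
  contDiff_a : ContDiff ℝ 1 a
  contDiff_g : ContDiff ℝ 1 g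
  bound_a : ∃ A, ∀ x, |a x| ≤ A
  bound_a' : ∃ A, ∀ x, |deriv a x| ≤ A
  bound_g' : ∃ K, ∀ x, |deriv g x| ≤ K
  flow : IsScalarFlow g Φ
  contDiff_u₀ : ContDiff ℝ 1 u₀
  bound_u₀' : ∃ M, ∀ x, |deriv u₀ x| ≤ M

namespace IsCharSystem

variable {a g : ℝ → ℝ} {Φ : ℝ → ℝ → ℝ} {u₀ : ℝ → ℝ}

theorem continuous_flow (h : IsCharSystem a g Φ u₀) : Continuous (fun p : ℝ × ℝ => Φ p.1 p.2) :=
  h.flow.continuous h.contDiff_g h.bound_g'.choose_spec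

theorem continuous_flowJac (h : IsCharSystem a g Φ u₀) :
    Continuous (fun p : ℝ × ℝ => flowJac g Φ p.1 p.2) := by
  have hc : Continuous (deriv g) := h.contDiff_g.continuous_deriv le_rfl
  refine Real.continuous_exp.comp
    (intervalIntegral.continuous_parametric_intervalIntegral_of_continuous
      (f := fun (p : ℝ × ℝ) s => deriv g (Φ s p.2)) ?_ continuous_fst)
  exact hc.comp (h.continuous_flow.comp₂ continuous_snd (continuous_snd.comp continuous_fst))

theorem continuous_flow_init (h : IsCharSystem a g Φ u₀) :
    Continuous (fun p : ℝ × ℝ => Φ p.1 (u₀ p.2)) :=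
  h.continuous_flow.comp₂ continuous_fst (h.contDiff_u₀.continuous.comp continuous_snd)

theorem continuous_flow_init_left (h : IsCharSystem a g Φ u₀) (y : ℝ) :
    Continuous (fun t => Φ t (u₀ y)) :=
  h.continuous_flow_init.comp₂ continuous_id continuous_const

theorem continuous_flowJac_init (h : IsCharSystem a g Φ u₀) :
    Continuous (fun p : ℝ × ℝ => flowJac g Φ p.1 (u₀ p.2)) :=
  h.continuous_flowJac.comp₂ continuous_fst (h.contDiff_u₀.continuous.comp continuous_snd)

theorem hasDerivAt_flow_init (h : IsCharSystem a g Φ u₀) (t y : ℝ) :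
    HasDerivAt (fun y => Φ t (u₀ y)) (flowJac g Φ t (u₀ y) * deriv u₀ y) y :=
  (h.flow.hasDerivAt_init h.contDiff_g h.bound_g'.choose_spec t (u₀ y)).comp y
    (h.contDiff_u₀.differentiable one_ne_zero y).hasDerivAt

theorem continuous_charJac_integrand (h : IsCharSystem a g Φ u₀) :
    Continuous (fun p : ℝ × ℝ =>
      deriv a (Φ p.1 (u₀ p.2)) * (flowJac g Φ p.1 (u₀ p.2) * deriv u₀ p.2)) :=
  ((h.contDiff_a.continuous_deriv le_rfl).comp h.continuous_flow_init).mul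
    (h.continuous_flowJac_init.mul
      ((h.contDiff_u₀.continuous_deriv le_rfl).comp continuous_snd))

theorem hasDerivAt_charPos_time (h : IsCharSystem a g Φ u₀) (t y : ℝ) :
    HasDerivAt (fun t => charPos a Φ u₀ t y) (a (Φ t (u₀ y))) t :=
  (hasDerivAt_integral_zero
    (h.contDiff_a.continuous.comp (h.continuous_flow_init_left y)) t).const_add y

theorem hasDerivAt_charJac_time (h : IsCharSystem a g Φ u₀) (t y : ℝ) :
    HasDerivAt (fun t => charJac a g Φ u₀ t y)
      (deriv a (Φ t (u₀ y)) * (flowJac g Φ t (u₀ y) * deriv u₀ y)) t :=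
  (hasDerivAt_integral_zero
    (h.continuous_charJac_integrand.comp₂ continuous_id continuous_const) t).const_add 1

theorem hasDerivAt_flowJac_time (h : IsCharSystem a g Φ u₀) (t v : ℝ) :
    HasDerivAt (fun t => flowJac g Φ t v) (deriv g (Φ t v) * flowJac g Φ t v) t := by
  rw [mul_comm]
  exact (hasDerivAt_integral_zero
    ((h.contDiff_g.continuous_deriv le_rfl).comp (h.flow.continuous_time v)) t).exp

theorem hasDerivAt_charPos (h : IsCharSystem a g Φ u₀) (t y : ℝ) :
    HasDerivAt (fun y => charPos a Φ u₀ t y) (charJac a g Φ u₀ t y) y := by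
  refine (hasDerivAt_id y).add (hasDerivAt_intervalIntegral_of_continuous
    (H := fun y s => a (Φ s (u₀ y)))
    (H' := fun y s => deriv a (Φ s (u₀ y)) * (flowJac g Φ s (u₀ y) * deriv u₀ y)) ?_ ?_ ?_ 0 t y)
  · exact fun y => h.contDiff_a.continuous.comp (h.continuous_flow_init_left y)
  · exact h.continuous_charJac_integrand.comp continuous_swap
  · exact fun y s => (h.contDiff_a.differentiable one_ne_zero _).hasDerivAt.comp y
      (h.hasDerivAt_flow_init s y)

theorem continuous_charJac (h : IsCharSystem a g Φ u₀) :
    Continuous (fun p : ℝ × ℝ => charJac a g Φ u₀ p.1 p.2) := by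
  refine continuous_const.add
    (intervalIntegral.continuous_parametric_intervalIntegral_of_continuous
      (f := fun (p : ℝ × ℝ) s =>
        deriv a (Φ s (u₀ p.2)) * (flowJac g Φ s (u₀ p.2) * deriv u₀ p.2)) ?_ continuous_fst)
  exact h.continuous_charJac_integrand.comp₂ continuous_snd (continuous_snd.comp continuous_fst)

theorem contDiff_flow (h : IsCharSystem a g Φ u₀) :
    ContDiff ℝ 1 (fun p : ℝ × ℝ => Φ p.1 p.2) :=
  (contDiff_one_of_partial (h₁ := fun t v => g (Φ t v)) (h₂ := fun t v => flowJac g Φ t v)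
    (fun t v => h.flow.hasDerivAt v t)
    (fun t v => h.flow.hasDerivAt_init h.contDiff_g h.bound_g'.choose_spec t v)
    (h.contDiff_g.continuous.comp h.continuous_flow) h.continuous_flowJac).1

theorem contDiff_hasFDerivAt_charPos (h : IsCharSystem a g Φ u₀) :
    ContDiff ℝ 1 (fun p : ℝ × ℝ => charPos a Φ u₀ p.1 p.2) ∧
    ∀ p : ℝ × ℝ, HasFDerivAt (fun p : ℝ × ℝ => charPos a Φ u₀ p.1 p.2)
      ((ContinuousLinearMap.toSpanSingleton ℝ (a (Φ p.1 (u₀ p.2)))).coprod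
        (ContinuousLinearMap.toSpanSingleton ℝ (charJac a g Φ u₀ p.1 p.2))) p :=
  contDiff_one_of_partial (h₁ := fun t y => a (Φ t (u₀ y))) (h₂ := charJac a g Φ u₀)
    h.hasDerivAt_charPos_time h.hasDerivAt_charPos
    (h.contDiff_a.continuous.comp h.continuous_flow_init) h.continuous_charJac

theorem abs_charPos_sub_le (_h : IsCharSystem a g Φ u₀) {A : ℝ} (hA : ∀ x, |a x| ≤ A) (t y : ℝ) :
    |charPos a Φ u₀ t y - y| ≤ A * |t| := by
  simpa [charPos] using intervalIntegral.norm_integral_le_of_norm_le_const (a := 0) (b := t)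
    (f := fun s => a (Φ s (u₀ y))) (C := A) (fun x _ => hA _)

/-- Strict monotonicity gives injectivity; bounded speed keeps characteristics within `A |t|` of
their foot, so the map tends to `±∞` with `y`. -/
theorem charPos_bijective (h : IsCharSystem a g Φ u₀) {t : ℝ}
    (hJ : ∀ y, 0 < charJac a g Φ u₀ t y) : Function.Bijective (charPos a Φ u₀ t) := by
  obtain ⟨A, hA⟩ := h.bound_a
  have hm : StrictMono (charPos a Φ u₀ t) :=
    strictMono_of_deriv_pos fun y => by rw [(h.hasDerivAt_charPos t y).deriv]; exact hJ y
  have hb := h.abs_charPos_sub_le hA t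
  refine ⟨hm.injective, Continuous.surjective ?_ ?_ ?_⟩
  · exact continuous_iff_continuousAt.2 fun y => (h.hasDerivAt_charPos t y).continuousAt
  · refine tendsto_atTop_mono (fun y => ?_) (tendsto_atTop_add_const_right _ (-(A * |t|)) tendsto_id)
    have := (abs_le.1 (hb y)).1
    simp only [id]; linarith
  · refine tendsto_atBot_mono (fun y => ?_) (tendsto_atBot_add_const_right _ (A * |t|) tendsto_id)
    have := (abs_le.1 (hb y)).2
    simp only [id]; linarith

/-- For small times, backward or forward, characteristics do not cross. -/
theorem exists_half_le_charJac (h : IsCharSystem a g Φ u₀) :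
    ∃ ε > 0, ∀ t, |t| ≤ ε → ∀ y, 1 / 2 ≤ charJac a g Φ u₀ t y := by
  obtain ⟨A, hA⟩ := h.bound_a'
  obtain ⟨K, hK⟩ := h.bound_g'
  obtain ⟨M, hM⟩ := h.bound_u₀'
  have hA0 : 0 ≤ A := (abs_nonneg _).trans (hA 0)
  have hK0 : 0 ≤ K := (abs_nonneg _).trans (hK 0)
  have hM0 : 0 ≤ M := (abs_nonneg _).trans (hM 0)
  have hD : 0 < 2 * (A * (Real.exp K * M) + 1) := by positivity
  -- For `|s| ≤ 1` the flow Jacobian is at most `exp K`, so the integrand in `charJac` is at most `A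
  -- exp(K) M`; the second bound on `|t|` keeps the integral below `1 / 2`.
  refine ⟨min 1 (1 / (2 * (A * (Real.exp K * M) + 1))), by positivity, fun t ht y => ?_⟩
  have ht1 : |t| ≤ 1 := ht.trans (min_le_left _ _)
  have ht2 : |t| * (2 * (A * (Real.exp K * M) + 1)) ≤ 1 := by
    have := ht.trans (min_le_right _ _)
    rwa [le_div_iff₀ hD] at this
  have hJ : ∀ s ∈ uIoc 0 t, |flowJac g Φ s (u₀ y)| ≤ Real.exp K := fun s hs => by
    have hs' : |s| ≤ |t| := by
      have := abs_sub_left_of_mem_uIcc (uIoc_subset_uIcc hs)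
      simpa using this
    rw [flowJac, Real.abs_exp, Real.exp_le_exp]
    refine (le_abs_self _).trans ?_
    have := intervalIntegral.norm_integral_le_of_norm_le_const (a := 0) (b := s)
      (f := fun s => deriv g (Φ s (u₀ y))) (C := K) (fun x _ => hK _)
    simp only [Real.norm_eq_abs, sub_zero] at this
    nlinarith
  have := intervalIntegral.norm_integral_le_of_norm_le_const (a := 0) (b := t)
    (f := fun s => deriv a (Φ s (u₀ y)) * (flowJac g Φ s (u₀ y) * deriv u₀ y))
    (C := A * (Real.exp K * M)) (fun s hs => by
      rw [Real.norm_eq_abs, abs_mul, abs_mul]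
      exact mul_le_mul (hA _) (mul_le_mul (hJ s hs) (hM _) (abs_nonneg _) (by positivity))
        (by positivity) hA0)
  simp only [Real.norm_eq_abs, sub_zero] at this
  have := (abs_le.1 this).1
  unfold charJac
  nlinarith [abs_nonneg t]

/-- The classical solution of the balance law, on a time interval on which characteristics do not
cross. -/
theorem exists_classicalSolution (h : IsCharSystem a g Φ u₀) {ε : ℝ} (hε : 0 < ε)
    (hJ : ∀ t, -ε < t → ∀ y, 0 < charJac a g Φ u₀ t y) :
    ∃ u : ℝ → ℝ → ℝ, u 0 = u₀ ∧
      ContDiffOn ℝ 1 (fun p : ℝ × ℝ => u p.1 p.2) (Ioi (-ε) ×ˢ univ) ∧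
      ∀ t, -ε < t → ∀ x, ∃ y, x = charPos a Φ u₀ t y ∧ u t x = Φ t (u₀ y) ∧
        HasDerivAt (u t) (flowJac g Φ t (u₀ y) * deriv u₀ y / charJac a g Φ u₀ t y) x ∧
        fderiv ℝ (fun p : ℝ × ℝ => u p.1 p.2) (t, x) (1, a (u t x)) = g (u t x) := by
  have hbij : ∀ t, -ε < t → Function.Bijective (charPos a Φ u₀ t) := fun t ht =>
    h.charPos_bijective (hJ t ht)
  have exY : ∀ t x, ∃ y, -ε < t → charPos a Φ u₀ t y = x := fun t x => by
    by_cases ht : -ε < t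
    · obtain ⟨y, hy⟩ := (hbij t ht).2 x
      exact ⟨y, fun _ => hy⟩
    · exact ⟨0, fun h => absurd h ht⟩
  choose Y hY using exY
  obtain ⟨hcd, hfd⟩ := h.contDiff_hasFDerivAt_charPos
  have hYu : ∀ t, -ε < t → ∀ y, Y t (charPos a Φ u₀ t y) = y := fun t ht y =>
    (hbij t ht).1 (hY t _ ht)
  have hopen : IsOpen (Ioi (-ε) ×ˢ (univ : Set ℝ)) := isOpen_Ioi.prod isOpen_univ
  have hYC : ∀ t, -ε < t → ∀ x, ContDiffAt ℝ 1 (fun p : ℝ × ℝ => Y p.1 p.2) (t, x) := by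
    intro t ht x
    obtain ⟨y, rfl⟩ := (hbij t ht).2 x
    set α := a (Φ t (u₀ y))
    set J := charJac a g Φ u₀ t y
    have hJ0 : J ≠ 0 := (hJ t ht y).ne'
    -- The derivative of `(t, y) ↦ (t, X(t, y))` is triangular with diagonal entries `1` and `J ≠
    -- 0`; `f2` is its explicit inverse, as needed for the inverse function theorem.
    let f1 : ℝ × ℝ →L[ℝ] ℝ × ℝ := (ContinuousLinearMap.fst ℝ ℝ ℝ).prod
      ((ContinuousLinearMap.toSpanSingleton ℝ α).coprod (ContinuousLinearMap.toSpanSingleton ℝ J))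
    let f2 : ℝ × ℝ →L[ℝ] ℝ × ℝ := (ContinuousLinearMap.fst ℝ ℝ ℝ).prod
      ((ContinuousLinearMap.toSpanSingleton ℝ (-α / J)).coprod
        (ContinuousLinearMap.toSpanSingleton ℝ (1 / J)))
    let e : (ℝ × ℝ) ≃L[ℝ] ℝ × ℝ := ContinuousLinearEquiv.equivOfInverse f1 f2
      (fun p => by
        ext
        · simp [f1, f2]
        · simp [f1, f2]; field_simp; ring)
      (fun p => by
        ext
        · simp [f1, f2]
        · simp [f1, f2]; field_simp; ring)
    let Ψ : ℝ × ℝ → ℝ × ℝ := fun p => (p.1, charPos a Φ u₀ p.1 p.2)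
    have hΨ : ContDiffAt ℝ 1 Ψ (t, y) := (contDiff_fst.prodMk hcd).contDiffAt
    have hΨ' : HasFDerivAt Ψ (e : ℝ × ℝ →L[ℝ] ℝ × ℝ) (t, y) := hasFDerivAt_fst.prodMk (hfd (t, y))
    have hL := hΨ.to_localInverse hΨ' one_ne_zero
    have hev := (hΨ.hasStrictFDerivAt' hΨ' one_ne_zero).eventually_right_inverse
    refine (contDiff_snd.contDiffAt.comp _ hL).congr_of_eventuallyEq ?_
    filter_upwards [hev, hopen.mem_nhds (show Ψ (t, y) ∈ _ from ⟨ht, trivial⟩)] with p hp hp'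
    replace hp : Ψ (hΨ.localInverse hΨ' one_ne_zero p) = p := hp
    have h1 : (hΨ.localInverse hΨ' one_ne_zero p).1 = p.1 := (congrArg Prod.fst hp :)
    have h2 : charPos a Φ u₀ (hΨ.localInverse hΨ' one_ne_zero p).1
      (hΨ.localInverse hΨ' one_ne_zero p).2 = p.2 := (congrArg Prod.snd hp :)
    rw [h1] at h2
    simp only [Function.comp]
    rw [← h2, hYu _ hp'.1]
  set u : ℝ → ℝ → ℝ := fun t x => Φ t (u₀ (Y t x)) with hu
  have huC : ∀ t, -ε < t → ∀ x, ContDiffAt ℝ 1 (fun p : ℝ × ℝ => u p.1 p.2) (t, x) :=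
    fun t ht x => ContDiffAt.comp (t, x) (g := fun p : ℝ × ℝ => Φ p.1 p.2)
      h.contDiff_flow.contDiffAt
      (contDiff_fst.contDiffAt.prodMk (h.contDiff_u₀.contDiffAt.comp _ (hYC t ht x)))
  refine ⟨u, ?_, fun p hp => (huC p.1 hp.1 p.2).contDiffWithinAt, fun t ht x => ?_⟩
  · funext x
    have : Y 0 x = x := by simpa [charPos] using hY 0 x (by linarith)
    simp [hu, this, h.flow.zero]
  obtain ⟨y, rfl⟩ := (hbij t ht).2 x
  have huy : ∀ s, -ε < s → u s (charPos a Φ u₀ s y) = Φ s (u₀ y) := fun s hs => by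
    simp only [hu]; rw [hYu s hs]
  have hdiff := (huC t ht (charPos a Φ u₀ t y)).differentiableAt one_ne_zero
  refine ⟨y, rfl, huy t ht, ?_, ?_⟩
  · have hJ0 := (hJ t ht y).ne'
    have hxd : DifferentiableAt ℝ (u t) (charPos a Φ u₀ t y) :=
      DifferentiableAt.comp (f := fun x => (t, x)) (charPos a Φ u₀ t y) hdiff (by fun_prop)
    have h1 : HasDerivAt (fun y => u t (charPos a Φ u₀ t y))
        (deriv (u t) (charPos a Φ u₀ t y) * charJac a g Φ u₀ t y) y :=
      hxd.hasDerivAt.comp y (h.hasDerivAt_charPos t y)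
    have h2 : (fun y => u t (charPos a Φ u₀ t y)) = fun y => Φ t (u₀ y) := by
      funext z; simp only [hu]; rw [hYu t ht]
    rw [h2] at h1
    rw [← h1.unique (h.hasDerivAt_flow_init t y), mul_div_cancel_right₀ _ hJ0]
    exact hxd.hasDerivAt
  -- The directional derivative along `(1, a(u))` is the time derivative of `u` along a
  -- characteristic, where `u` is the flow of `g`.
  · have h1 : HasDerivAt (fun s => u s (charPos a Φ u₀ s y))
        (fderiv ℝ (fun p : ℝ × ℝ => u p.1 p.2) (t, charPos a Φ u₀ t y)
          (1, a (Φ t (u₀ y)))) t :=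
      HasFDerivAt.comp_hasDerivAt (l := fun p : ℝ × ℝ => u p.1 p.2)
        (f := fun s => (s, charPos a Φ u₀ s y)) t hdiff.hasFDerivAt
        ((hasDerivAt_id t).prodMk (h.hasDerivAt_charPos_time t y))
    have h2 : (fun s => u s (charPos a Φ u₀ s y)) =ᶠ[𝓝 t] fun s => Φ s (u₀ y) := by
      filter_upwards [isOpen_Ioi.mem_nhds ht] with s hs using huy s hs
    rw [huy t ht]
    exact h1.unique ((h.flow.hasDerivAt (u₀ y) t).congr_of_eventuallyEq h2)

end IsCharSystem

/-! ### The profile of the front -/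

/-- By the mean value theorem on `[x, x + 1]`, the derivative takes values `U(x + 1) - U(x) → 0` at
points tending to `+∞`. -/
theorem eq_zero_of_tendsto_deriv_atTop {U U' : ℝ → ℝ} (hU : ∀ x, HasDerivAt U (U' x) x) {l m : ℝ}
    (hl : Tendsto U atTop (𝓝 l)) (hm : Tendsto U' atTop (𝓝 m)) : m = 0 := by
  have ex : ∀ x : ℝ, ∃ ξ, x ≤ ξ ∧ U' ξ = U (x + 1) - U x := fun x => by
    obtain ⟨ξ, hξ, h⟩ := exists_hasDerivAt_eq_slope U U' (show x < x + 1 by linarith)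
      (fun y _ => (hU y).continuousAt.continuousWithinAt) (fun y _ => hU y)
    exact ⟨ξ, hξ.1.le, by rw [h]; simp⟩
  choose ξ h1 h2 using ex
  have t1 : Tendsto (fun x => U' (ξ x)) atTop (𝓝 m) :=
    hm.comp (tendsto_atTop_mono h1 tendsto_id)
  have t2 : Tendsto (fun x => U' (ξ x)) atTop (𝓝 (l - l)) := by
    simp only [h2]
    exact (hl.comp (tendsto_atTop_add_const_right _ 1 tendsto_id)).sub hl
  simpa using tendsto_nhds_unique t1 t2

theorem eq_zero_of_tendsto_deriv_atBot {U U' : ℝ → ℝ} (hU : ∀ x, HasDerivAt U (U' x) x) {l m : ℝ}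
    (hl : Tendsto U atBot (𝓝 l)) (hm : Tendsto U' atBot (𝓝 m)) : m = 0 := by
  have h := eq_zero_of_tendsto_deriv_atTop (U := fun x => U (-x)) (U' := fun x => -U' (-x))
    (l := l) (m := -m) (fun x => by simpa [Function.comp_def] using (hU (-x)).comp x (hasDerivAt_neg x))
    (hl.comp tendsto_neg_atTop_atBot) (hm.comp tendsto_neg_atTop_atBot).neg
  linarith

/-- A front of the balance law `∂ₜ u + a(u) ∂ₓ u = g(u)`, in its moving frame, with coefficients
normalized outside a neighborhood of its range, and with slope of sign `s`. -/
structure IsFrontSystem (a g U : ℝ → ℝ) (um up s : ℝ) : Prop where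
  contDiff_a : ContDiff ℝ 2 a
  contDiff_g : ContDiff ℝ 2 g
  hasCompactSupport_a : HasCompactSupport (fun v => a v + 1)
  hasCompactSupport_g : HasCompactSupport g
  neg_a : ∃ a₀ > 0, ∀ v, a v ≤ -a₀
  hasDerivAt : ∀ x, HasDerivAt U (g (U x) / a (U x)) x
  tendsto_left : Tendsto U atBot (𝓝 um)
  tendsto_right : Tendsto U atTop (𝓝 up)
  sign : s = 1 ∨ s = -1
  slope_pos : ∀ x, 0 < s * (g (U x) / a (U x))
  deriv_left : deriv g um < 0
  deriv_right : 0 < deriv g up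

/-- Two facts are needed: the slope never vanishes, because it solves a linear equation and `um ≠
up` (the signs of `g'` differ there); and `a` is negative on the closed range, which is forced by
`g'(up) > 0`. A cutoff then makes the coefficients global without altering them near the range. -/
theorem exists_isFrontSystem {f g U : ℝ → ℝ} {σ um up : ℝ} (hf : ContDiff ℝ ∞ f)
    (hg : ContDiff ℝ ∞ g) (hU : IsSmoothNoncharacteristicFront f g U σ um up)
    (hum : deriv g um < 0) (hup : 0 < deriv g up) :
    ∃ a₁ g₁ : ℝ → ℝ, ∃ s ρ : ℝ, 0 < ρ ∧ IsFrontSystem a₁ g₁ U um up s ∧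
      (∀ x v, |v - U x| ≤ ρ → a₁ v = deriv f v - σ ∧ g₁ v = g v) ∧
      a₁ up = deriv f up - σ ∧ deriv g₁ um = deriv g um ∧ deriv g₁ up = deriv g up := by
  set a : ℝ → ℝ := fun v => deriv f v - σ with ha
  have haC : ContDiff ℝ ∞ a := by
    have : ContDiff ℝ ∞ (deriv f) := (contDiff_infty_iff_deriv.1 hf).2
    exact this.sub contDiff_const
  have hac : Continuous a := haC.continuous
  have hgc : Continuous g := hg.continuous
  have hUd : Differentiable ℝ U := hU.smooth.differentiable (by simp)
  have hUc : Continuous U := hUd.continuous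
  have hU'C : ContDiff ℝ ∞ (deriv U) := (contDiff_infty_iff_deriv.1 hU.smooth).2
  have hU'd : Differentiable ℝ (deriv U) := hU'C.differentiable (by simp)
  have hU'c : Continuous (deriv U) := hU'd.continuous
  have hfd : Differentiable ℝ f := hf.differentiable (by simp)
  have had : Differentiable ℝ a := haC.differentiable (by simp)
  have hgd : Differentiable ℝ g := hg.differentiable (by simp)
  have ha'c : Continuous (deriv a) := haC.continuous_deriv (by simp)
  have hg'c : Continuous (deriv g) := hg.continuous_deriv (by simp)
  have ha0 : ∀ x, a (U x) ≠ 0 := fun x => sub_ne_zero.2 (hU.noncharacteristic x)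
  have haum : a um ≠ 0 := sub_ne_zero.2 hU.noncharacteristic_left
  have haup : a up ≠ 0 := sub_ne_zero.2 hU.noncharacteristic_right
  have heq : ∀ x, a (U x) * deriv U x = g (U x) := fun x => by
    have h1 := hU.profile_eq x
    have h2 : deriv (fun y => f (U y)) x = deriv f (U x) * deriv U x :=
      ((hfd (U x)).hasDerivAt.comp x (hUd x).hasDerivAt).deriv
    rw [h2] at h1
    simp only [ha]; linarith
  have heq' : ∀ x, deriv U x = g (U x) / a (U x) := fun x => by
    rw [eq_div_iff (ha0 x), mul_comm, heq]
  have hne : um ≠ up := fun h => by rw [h] at hum; linarith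
  -- the slope tends to `0` at both ends
  have lim_top : Tendsto (deriv U) atTop (𝓝 (g up / a up)) := by
    simp only [funext heq']
    exact ((hgc.tendsto up).comp hU.tendsto_right).div ((hac.tendsto up).comp hU.tendsto_right) haup
  have lim_bot : Tendsto (deriv U) atBot (𝓝 (g um / a um)) := by
    simp only [funext heq']
    exact ((hgc.tendsto um).comp hU.tendsto_left).div ((hac.tendsto um).comp hU.tendsto_left) haum
  have z_top := eq_zero_of_tendsto_deriv_atTop (fun x => (hUd x).hasDerivAt) hU.tendsto_right lim_top
  rw [z_top] at lim_top
  -- the slope solves a linear equation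
  set c : ℝ → ℝ := fun x => (deriv g (U x) - deriv a (U x) * deriv U x) / a (U x) with hc
  have hcc : Continuous c := ((hg'c.comp hUc).sub ((ha'c.comp hUc).mul hU'c)).div (hac.comp hUc) ha0
  have hU'' : ∀ x, HasDerivAt (deriv U) (c x * deriv U x) x := fun x => by
    have h1 : HasDerivAt (fun x => a (U x) * deriv U x)
        (deriv a (U x) * deriv U x * deriv U x + a (U x) * deriv (deriv U) x) x :=
      ((had (U x)).hasDerivAt.comp x (hUd x).hasDerivAt).mul (hU'd x).hasDerivAt
    have h2 : HasDerivAt (fun x => a (U x) * deriv U x) (deriv g (U x) * deriv U x) x := by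
      simp only [heq]
      exact (hgd (U x)).hasDerivAt.comp x (hUd x).hasDerivAt
    have h3 := h1.unique h2
    convert! (hU'd x).hasDerivAt using 1
    simp only [hc]
    rw [div_mul_eq_mul_div, div_eq_iff (ha0 x)]
    linarith
  have hexp := eq_mul_exp_integral hcc hU''
  have hU'0 : ∀ x, deriv U x ≠ 0 := fun x hx => by
    have hz : ∀ y, deriv U y = 0 := fun y => by rw [hexp x y, hx, zero_mul]
    have hcst : ∀ y, U y = U 0 := fun y => is_const_of_deriv_eq_zero hUd hz y 0
    have h1 : um = U 0 := tendsto_nhds_unique hU.tendsto_left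
      (tendsto_const_nhds.congr fun y => (hcst y).symm)
    have h2 : up = U 0 := tendsto_nhds_unique hU.tendsto_right
      (tendsto_const_nhds.congr fun y => (hcst y).symm)
    exact hne (h1.trans h2.symm)
  obtain ⟨s, hs, hs0⟩ : ∃ s : ℝ, (s = 1 ∨ s = -1) ∧ 0 < s * deriv U 0 := by
    rcases lt_or_gt_of_ne (hU'0 0) with h | h
    · exact ⟨-1, Or.inr rfl, by linarith⟩
    · exact ⟨1, Or.inl rfl, by linarith⟩
  have hspos : ∀ x, 0 < s * deriv U x := fun x => by
    rw [hexp 0 x, ← mul_assoc]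
    exact mul_pos hs0 (Real.exp_pos _)
  -- characteristics enter from the right
  have lim_c : Tendsto c atTop (𝓝 (deriv g up / a up)) := by
    have := (((hg'c.tendsto up).comp hU.tendsto_right).sub
      (((ha'c.tendsto up).comp hU.tendsto_right).mul lim_top)).div
      ((hac.tendsto up).comp hU.tendsto_right) haup
    rw [mul_zero, sub_zero] at this
    exact this
  -- Otherwise the linear equation for `U'` has a coefficient with positive limit, and `s U'` is
  -- eventually nondecreasing and positive, contradicting its limit `0`.
  have haup_neg : a up < 0 := by
    by_contra hcon
    have hpos : 0 < a up := lt_of_le_of_ne (not_lt.1 hcon) haup.symm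
    obtain ⟨x₁, hx₁⟩ := eventually_atTop.1 (lim_c.eventually_const_lt (div_pos hup hpos))
    have hmono : MonotoneOn (fun x => s * deriv U x) (Ici x₁) :=
      monotoneOn_of_deriv_nonneg (convex_Ici x₁) (by fun_prop) (by fun_prop) fun x hx => by
        rw [interior_Ici] at hx
        rw [((hU'' x).const_mul s).deriv]
        have := mul_pos (hx₁ x (le_of_lt hx)) (hspos x)
        nlinarith
    have h1 : s * deriv U x₁ ≤ s * 0 :=
      ge_of_tendsto (lim_top.const_mul s) (eventually_atTop.2 ⟨x₁, fun x hx =>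
        hmono self_mem_Ici hx hx⟩)
    have := hspos x₁
    linarith
  have haU : ∀ x, a (U x) < 0 := by
    obtain ⟨x₁, hx₁⟩ := eventually_atTop.1
      (((hac.tendsto up).comp hU.tendsto_right).eventually_lt_const haup_neg)
    intro x
    by_contra hcon
    obtain ⟨z, hz⟩ := mem_range_of_exists_le_of_exists_ge (hac.comp hUc)
      ⟨x₁, (hx₁ x₁ le_rfl).le⟩ ⟨x, not_lt.1 hcon⟩
    exact ha0 z hz
  have haum_neg : a um < 0 :=
    lt_of_le_of_ne (le_of_tendsto ((hac.tendsto um).comp hU.tendsto_left)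
      (Eventually.of_forall fun x => (haU x).le)) haum
  have hmemU : ∀ x, U x ∈ uIcc um up := by
    rcases hs with rfl | rfl
    · have hm : Monotone U := monotone_of_deriv_nonneg hUd fun x => by linarith [hspos x]
      exact fun x => Icc_subset_uIcc ⟨hm.le_of_tendsto hU.tendsto_left x,
        hm.ge_of_tendsto hU.tendsto_right x⟩
    · have hm : Antitone U := antitone_of_deriv_nonpos hUd fun x => by linarith [hspos x]
      exact fun x => Icc_subset_uIcc' ⟨hm.le_of_tendsto hU.tendsto_right x,
        hm.ge_of_tendsto hU.tendsto_left x⟩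
  have haK : ∀ v ∈ uIcc um up, a v < 0 := by
    intro v hv
    by_cases h1 : v = um
    · rwa [h1]
    by_cases h2 : v = up
    · rwa [h2]
    suffices ∃ x, U x = v by obtain ⟨x, rfl⟩ := this; exact haU x
    rcases mem_uIcc.1 hv with h | h
    · have h3 : um < v := lt_of_le_of_ne h.1 (Ne.symm h1)
      have h4 : v < up := lt_of_le_of_ne h.2 h2
      exact mem_range_of_exists_le_of_exists_ge hUc
        ((hU.tendsto_left.eventually_lt_const h3).exists.imp fun _ => le_of_lt)
        ((hU.tendsto_right.eventually_const_lt h4).exists.imp fun _ => le_of_lt)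
    · have h3 : up < v := lt_of_le_of_ne h.1 (Ne.symm h2)
      have h4 : v < um := lt_of_le_of_ne h.2 h1
      exact mem_range_of_exists_le_of_exists_ge hUc
        ((hU.tendsto_right.eventually_lt_const h3).exists.imp fun _ => le_of_lt)
        ((hU.tendsto_left.eventually_const_lt h4).exists.imp fun _ => le_of_lt)
  -- normalization of the coefficients
  obtain ⟨δ, hδ, hδK⟩ := isCompact_uIcc.exists_cthickening_subset_open
    (isOpen_lt hac continuous_const) (fun v hv => haK v hv)
  have hδa : ∀ v, ∀ k ∈ uIcc um up, |v - k| ≤ δ → a v < 0 := fun v k hk hv =>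
    hδK (Metric.mem_cthickening_of_dist_le v k δ _ hk hv)
  set c₀ := (um + up) / 2 with hc₀
  set R := |up - um| / 2 with hR
  have hR0 : 0 ≤ R := by positivity
  have hball : ∀ v, v ∈ Metric.closedBall c₀ R ↔ v ∈ uIcc um up := fun v => by
    rw [Real.closedBall_eq_Icc, uIcc, mem_Icc, mem_Icc, hc₀, hR]
    rcases le_total um up with h | h
    · rw [abs_of_nonneg (by linarith), inf_eq_left.2 h, sup_eq_right.2 h]
      constructor <;> rintro ⟨_, _⟩ <;> constructor <;> linarith
    · rw [abs_of_nonpos (by linarith), inf_eq_right.2 h, sup_eq_left.2 h]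
      constructor <;> rintro ⟨_, _⟩ <;> constructor <;> linarith
  let χ : ContDiffBump c₀ := ⟨R + δ / 2, R + δ, by positivity, by linarith⟩
  have hχ : ∀ {n : ℕ∞}, ContDiff ℝ n χ := χ.contDiff
  have hin : ∀ k ∈ uIcc um up, ∀ v, |v - k| ≤ δ / 2 → χ v = 1 := fun k hk v hv => by
    refine χ.one_of_mem_closedBall (Metric.mem_closedBall.2 ?_)
    have h1 := Metric.mem_closedBall.1 ((hball k).2 hk)
    have h2 := dist_triangle v k c₀
    rw [Real.dist_eq v k] at h2
    change dist v c₀ ≤ R + δ / 2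
    linarith
  have hneg : ∀ v ∈ Metric.closedBall c₀ (R + δ), a v < 0 := fun v hv => by
    rw [Real.closedBall_eq_Icc, mem_Icc] at hv
    by_cases h : v ∈ Metric.closedBall c₀ R
    · exact haK v ((hball v).1 h)
    · rcases le_total v c₀ with hvc | hvc
      · refine hδa v (c₀ - R) ((hball _).1 ?_) ?_
        · simp [Real.closedBall_eq_Icc]; linarith
        · rw [Real.closedBall_eq_Icc, mem_Icc, not_and_or] at h
          rw [abs_le]
          rcases h with h | h <;> constructor <;> linarith
      · refine hδa v (c₀ + R) ((hball _).1 ?_) ?_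
        · simp [Real.closedBall_eq_Icc]; linarith
        · rw [Real.closedBall_eq_Icc, mem_Icc, not_and_or] at h
          rw [abs_le]
          rcases h with h | h <;> constructor <;> linarith
  obtain ⟨v₀, hv₀, hmax⟩ := (isCompact_closedBall c₀ (R + δ)).exists_isMaxOn
    (Metric.nonempty_closedBall.2 (by positivity)) hac.continuousOn
  -- A convex combination of `a`, negative on the support of `χ`, and `-1`, so it is bounded away
  -- from `0`; moreover `a₁ + 1` has compact support.
  set a₁ : ℝ → ℝ := fun v => χ v * (a v + 1) - 1 with ha₁
  set g₁ : ℝ → ℝ := fun v => χ v * g v with hg₁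
  have heqv : ∀ k ∈ uIcc um up, ∀ v, |v - k| ≤ δ / 2 → a₁ v = a v ∧ g₁ v = g v :=
    fun k hk v hv => by simp [ha₁, hg₁, hin k hk v hv]
  have hself : ∀ k ∈ uIcc um up, a₁ k = a k ∧ g₁ k = g k := fun k hk =>
    heqv k hk k (by simp; positivity)
  have hderiv : ∀ k ∈ uIcc um up, deriv g₁ k = deriv g k := fun k hk => by
    refine Filter.EventuallyEq.deriv_eq ?_
    filter_upwards [Metric.closedBall_mem_nhds k (half_pos hδ)] with v hv
    exact (heqv k hk v hv).2
  have hslope : ∀ x, g₁ (U x) / a₁ (U x) = deriv U x := fun x => by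
    rw [(hself _ (hmemU x)).1, (hself _ (hmemU x)).2, heq']
  refine ⟨a₁, g₁, s, δ / 2, half_pos hδ, ?_, fun x v hv => heqv _ (hmemU x) v hv,
    (hself up right_mem_uIcc).1, hderiv um left_mem_uIcc, hderiv up right_mem_uIcc⟩
  have two : (2 : WithTop ℕ∞) ≤ ((⊤ : ℕ∞) : WithTop ℕ∞) := ENat.LEInfty.out
  exact
    { contDiff_a := (hχ.mul ((haC.of_le two).add contDiff_const)).sub contDiff_const
      contDiff_g := hχ.mul (hg.of_le two)
      hasCompactSupport_a := by
        simp only [ha₁, sub_add_cancel]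
        exact χ.hasCompactSupport.mul_right
      hasCompactSupport_g := χ.hasCompactSupport.mul_right
      neg_a := by
        refine ⟨min 1 (-a v₀), lt_min one_pos (neg_pos.2 (hneg v₀ hv₀)), fun v => ?_⟩
        by_cases hv : v ∈ Metric.closedBall c₀ (R + δ)
        · have h1 : a v ≤ a v₀ := hmax hv
          have h2 := χ.nonneg (x := v)
          have h3 := χ.le_one (x := v)
          simp only [ha₁]
          rcases le_total 1 (-a v₀) with h | h
          · rw [min_eq_left h]; nlinarith
          · rw [min_eq_right h]; nlinarith
        · have : χ v = 0 := χ.zero_of_le_dist (by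
            rw [Metric.mem_closedBall, not_le] at hv; exact hv.le)
          simp [ha₁, this]
      hasDerivAt := fun x => by rw [hslope]; exact (hUd x).hasDerivAt
      tendsto_left := hU.tendsto_left
      tendsto_right := hU.tendsto_right
      sign := hs
      slope_pos := fun x => by rw [hslope]; exact hspos x
      deriv_left := by rwa [hderiv um left_mem_uIcc]
      deriv_right := by rwa [hderiv up right_mem_uIcc] }

/-- The scalar field `F = g / a` of which the profile of a front is an integral curve. -/
noncomputable def profileField (a g : ℝ → ℝ) (v : ℝ) : ℝ := g v / a v

/-- Uniform bounds on the coefficients of a balance law and on its profile field. -/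
structure IsCoeffBound (a g : ℝ → ℝ) (M : ℝ) : Prop where
  one_le : 1 ≤ M
  abs_a : ∀ v, |a v| ≤ M
  inv_le : ∀ v, 1 / M ≤ -a v
  abs_deriv_a : ∀ v, |deriv a v| ≤ M
  abs_deriv_g : ∀ v, |deriv g v| ≤ M
  lip_a : ∀ v w, |a v - a w| ≤ M * |v - w|
  lip_F : ∀ v w, |profileField a g v - profileField a g w| ≤ M * |v - w|
  lip_deriv_F : ∀ v w,
    |deriv (profileField a g) v - deriv (profileField a g) w| ≤ M * |v - w|
  taylor_F : ∀ v w, |profileField a g v - profileField a g w -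
    deriv (profileField a g) w * (v - w)| ≤ M * |v - w| ^ 2

theorem abs_sub_le_of_abs_deriv_le {h : ℝ → ℝ} (hh : Differentiable ℝ h) {C : ℝ}
    (hC : ∀ v, |deriv h v| ≤ C) (v w : ℝ) : |h v - h w| ≤ C * |v - w| :=
  convex_univ.norm_image_sub_le_of_norm_deriv_le (fun x _ => hh x) (fun x _ => hC x)
    (mem_univ w) (mem_univ v)

theorem abs_taylor_le {h : ℝ → ℝ} (hh : Differentiable ℝ h) {C : ℝ} (hC0 : 0 ≤ C)
    {w v : ℝ} (hC : ∀ z ∈ uIcc w v, |deriv h z - deriv h w| ≤ C * |z - w|) :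
    |h v - h w - deriv h w * (v - w)| ≤ C * |v - w| ^ 2 := by
  have hd : ∀ z, HasDerivAt (fun z => h z - deriv h w * z) (deriv h z - deriv h w) z := fun z => by
    convert! (hh z).hasDerivAt.sub ((hasDerivAt_id z).const_mul (deriv h w)) using 1
    simp
  have := (convex_uIcc w v).norm_image_sub_le_of_norm_hasDerivWithin_le (C := C * |v - w|)
    (fun z _ => (hd z).hasDerivWithinAt) (fun z hz => by
      refine (hC z hz).trans ?_
      exact mul_le_mul_of_nonneg_left (abs_sub_left_of_mem_uIcc hz) hC0) left_mem_uIcc right_mem_uIcc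
  simp only [Real.norm_eq_abs] at this
  calc _ = |h v - deriv h w * v - (h w - deriv h w * w)| := by ring_nf
    _ ≤ _ := this
    _ = _ := by ring

theorem exists_bound_of_hasCompactSupport {h : ℝ → ℝ} (hc : Continuous h)
    (hs : HasCompactSupport h) : ∃ C, 0 ≤ C ∧ ∀ x, |h x| ≤ C := by
  obtain ⟨C, hC⟩ := hs.exists_bound_of_continuous hc
  exact ⟨C, (abs_nonneg _).trans (hC 0), hC⟩

/-! ### Coefficient bounds and asymptotics of the profile -/

namespace IsFrontSystem

variable {a g U : ℝ → ℝ} {um up s : ℝ}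

theorem a_neg (h : IsFrontSystem a g U um up s) (v : ℝ) : a v < 0 := by
  obtain ⟨a₀, h0, h1⟩ := h.neg_a
  linarith [h1 v]

theorem contDiff_F (h : IsFrontSystem a g U um up s) : ContDiff ℝ 2 (profileField a g) :=
  h.contDiff_g.div h.contDiff_a fun v => (h.a_neg v).ne

/-- The functions `a + 1`, `g` and `F` are `C²` with compact support, so they and the derivatives
involved are bounded; `M` is the sum of all the bounds and `1 / a₀`. -/
theorem exists_isCoeffBound (h : IsFrontSystem a g U um up s) : ∃ M, IsCoeffBound a g M := by
  obtain ⟨a₀, ha0, ha⟩ := h.neg_a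
  have hFs : HasCompactSupport (profileField a g) := by
    have : profileField a g = fun v => g v * (a v)⁻¹ := by
      funext v; rw [profileField, div_eq_mul_inv]
    rw [this]
    exact h.hasCompactSupport_g.mul_right
  have hF := h.contDiff_F
  have hF1 : ContDiff ℝ 1 (deriv (profileField a g)) := hF.deriv'
  have two : (2 : WithTop ℕ∞) ≠ 0 := two_ne_zero
  have hFd : Differentiable ℝ (profileField a g) := hF.differentiable two
  have h1a : deriv a = deriv (fun v => a v + 1) := by funext v; simp
  obtain ⟨C1, p1, b1⟩ := exists_bound_of_hasCompactSupport
    (h.contDiff_a.continuous.add continuous_const) h.hasCompactSupport_a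
  obtain ⟨C2, p2, b2⟩ := exists_bound_of_hasCompactSupport (h := deriv a)
    (h.contDiff_a.continuous_deriv (by norm_num)) (h1a ▸ h.hasCompactSupport_a.deriv)
  obtain ⟨C3, p3, b3⟩ := exists_bound_of_hasCompactSupport
    (h.contDiff_g.continuous_deriv (by norm_num)) h.hasCompactSupport_g.deriv
  obtain ⟨C4, p4, b4⟩ := exists_bound_of_hasCompactSupport
    (hF.continuous_deriv (by norm_num)) hFs.deriv
  obtain ⟨C5, p5, b5⟩ := exists_bound_of_hasCompactSupport
    (hF1.continuous_deriv le_rfl) hFs.deriv.deriv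
  have p6 : 0 < 1 / a₀ := by positivity
  set M := 1 + C1 + C2 + C3 + C4 + C5 + 1 / a₀ with hM
  have lip : ∀ v w, |deriv (profileField a g) v - deriv (profileField a g) w| ≤ M * |v - w| :=
    abs_sub_le_of_abs_deriv_le (hF1.differentiable one_ne_zero) fun v =>
      (b5 v).trans (by linarith)
  refine ⟨M, by linarith, fun v => ?_, fun v => ?_, fun v => (b2 v).trans (by linarith),
    fun v => (b3 v).trans (by linarith),
    abs_sub_le_of_abs_deriv_le (h.contDiff_a.differentiable two) fun v =>
      (b2 v).trans (by linarith),
    abs_sub_le_of_abs_deriv_le hFd fun v => (b4 v).trans (by linarith), lip,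
    fun v w => abs_taylor_le hFd (by linarith) fun z _ => lip z w⟩
  · have : -C1 ≤ a v + 1 ∧ a v + 1 ≤ C1 := abs_le.1 (b1 v)
    rw [abs_le]; constructor <;> linarith
  · refine le_trans ?_ (le_neg.1 (ha v))
    rw [div_le_iff₀ (by linarith), ← div_le_iff₀' ha0]
    linarith

theorem continuous_U (h : IsFrontSystem a g U um up s) : Continuous U :=
  continuous_iff_continuousAt.2 fun x => (h.hasDerivAt x).continuousAt

theorem hasDerivAt_U (h : IsFrontSystem a g U um up s) (x : ℝ) :
    HasDerivAt U (profileField a g (U x)) x := h.hasDerivAt x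

theorem slope_pos' (h : IsFrontSystem a g U um up s) (x : ℝ) : 0 < s * profileField a g (U x) :=
  h.slope_pos x

theorem abs_s (h : IsFrontSystem a g U um up s) : |s| = 1 := by
  rcases h.sign with h | h <;> simp [h]

theorem abs_slope (h : IsFrontSystem a g U um up s) (x : ℝ) :
    |profileField a g (U x)| = s * profileField a g (U x) := by
  rw [← abs_of_pos (h.slope_pos' x), abs_mul, h.abs_s, one_mul]

theorem monotone (h : IsFrontSystem a g U um up s) : Monotone fun x => s * U x :=
  monotone_of_hasDerivAt_nonneg (fun x => (h.hasDerivAt_U x).const_mul s)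
    fun x => (h.slope_pos' x).le

theorem left_le (h : IsFrontSystem a g U um up s) (x : ℝ) : s * um ≤ s * U x :=
  h.monotone.le_of_tendsto (h.tendsto_left.const_mul s) x

theorem le_right (h : IsFrontSystem a g U um up s) (x : ℝ) : s * U x ≤ s * up :=
  h.monotone.ge_of_tendsto (h.tendsto_right.const_mul s) x

theorem F_right (h : IsFrontSystem a g U um up s) : profileField a g up = 0 :=
  eq_zero_of_tendsto_deriv_atTop h.hasDerivAt_U h.tendsto_right
    ((h.contDiff_F.continuous.tendsto up).comp h.tendsto_right)

theorem F_left (h : IsFrontSystem a g U um up s) : profileField a g um = 0 :=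
  eq_zero_of_tendsto_deriv_atBot h.hasDerivAt_U h.tendsto_left
    ((h.contDiff_F.continuous.tendsto um).comp h.tendsto_left)

theorem deriv_F (h : IsFrontSystem a g U um up s) (v : ℝ) :
    deriv (profileField a g) v = (deriv g v - deriv a v * profileField a g v) / a v := by
  have two : (2 : WithTop ℕ∞) ≠ 0 := two_ne_zero
  have h0 := (h.a_neg v).ne
  have := ((h.contDiff_g.differentiable two v).hasDerivAt.div
    (h.contDiff_a.differentiable two v).hasDerivAt h0).deriv
  change deriv (fun v => g v / a v) v = _
  rw [show (fun v => g v / a v) = g / a from rfl, this, profileField]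
  field_simp

theorem deriv_F_right (h : IsFrontSystem a g U um up s) :
    deriv (profileField a g) up = deriv g up / a up := by
  rw [h.deriv_F, h.F_right]; simp

theorem deriv_F_left (h : IsFrontSystem a g U um up s) :
    deriv (profileField a g) um = deriv g um / a um := by
  rw [h.deriv_F, h.F_left]; simp

theorem hasDerivAt_slope (h : IsFrontSystem a g U um up s) (x : ℝ) :
    HasDerivAt (fun x => profileField a g (U x))
      (deriv (profileField a g) (U x) * profileField a g (U x)) x :=
  (h.contDiff_F.differentiable two_ne_zero (U x)).hasDerivAt.comp x (h.hasDerivAt_U x)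

/-- Near a nondegenerate zero, a function controls the distance to that zero. -/
theorem _root_.eventually_abs_sub_le_of_hasDerivAt {F : ℝ → ℝ} {F' p : ℝ} (hF : HasDerivAt F F' p)
    (h0 : F p = 0) (h' : F' ≠ 0) : ∀ᶠ v in 𝓝 p, |v - p| ≤ 2 / |F'| * |F v| := by
  have hpos : 0 < |F'| := abs_pos.2 h'
  filter_upwards [hF.isLittleO.def (half_pos hpos)] with v hv
  rw [h0, sub_zero, smul_eq_mul, Real.norm_eq_abs, Real.norm_eq_abs] at hv
  have h1 : |v - p| * |F'| ≤ |F v| + |F'| / 2 * |v - p| := by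
    rw [← abs_mul]
    have := abs_sub_abs_le_abs_sub ((v - p) * F') (F v)
    rw [abs_sub_comm] at this
    linarith
  rw [div_mul_eq_mul_div, le_div_iff₀ hpos]
  linarith

/-- Near `+∞` this holds because `up` is a nondegenerate zero of `F`; on the remaining compact
interval the ratio is continuous, as the slope does not vanish. -/
theorem exists_abs_sub_right_le (h : IsFrontSystem a g U um up s) :
    ∃ C, 0 ≤ C ∧ ∀ x, 0 ≤ x → |U x - up| ≤ C * (s * profileField a g (U x)) := by
  have hne : deriv (profileField a g) up ≠ 0 := by
    rw [h.deriv_F_right]; exact div_ne_zero h.deriv_right.ne' (h.a_neg _).ne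
  have ev := h.tendsto_right.eventually (eventually_abs_sub_le_of_hasDerivAt
    (h.contDiff_F.differentiable two_ne_zero up).hasDerivAt h.F_right hne)
  obtain ⟨x₁, hx₁⟩ := eventually_atTop.1 ev
  have hcont : Continuous fun x => (U x - up) / (s * profileField a g (U x)) :=
    (h.continuous_U.sub continuous_const).div
      (continuous_const.mul (h.contDiff_F.continuous.comp h.continuous_U))
      fun x => (h.slope_pos' x).ne'
  obtain ⟨C, hC⟩ := (isCompact_Icc (a := 0) (b := x₁)).exists_bound_of_continuousOn
    hcont.continuousOn
  refine ⟨max (max C 0) (2 / |deriv (profileField a g) up|), by positivity, fun x hx => ?_⟩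
  have hp := h.slope_pos' x
  rcases le_total x₁ x with h1 | h1
  · have := hx₁ x h1
    rw [h.abs_slope] at this
    exact this.trans (mul_le_mul_of_nonneg_right (le_max_right _ _) hp.le)
  · have := hC x ⟨hx, h1⟩
    rw [Real.norm_eq_abs, abs_div, abs_of_pos hp, div_le_iff₀ hp] at this
    exact this.trans (mul_le_mul_of_nonneg_right ((le_max_left _ _).trans (le_max_left _ _)) hp.le)

theorem exists_abs_sub_left_le (h : IsFrontSystem a g U um up s) :
    ∃ C, 0 ≤ C ∧ ∀ x, x ≤ 0 → |U x - um| ≤ C * (s * profileField a g (U x)) := by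
  have hne : deriv (profileField a g) um ≠ 0 := by
    rw [h.deriv_F_left]; exact div_ne_zero h.deriv_left.ne (h.a_neg _).ne
  have ev := h.tendsto_left.eventually (eventually_abs_sub_le_of_hasDerivAt
    (h.contDiff_F.differentiable two_ne_zero um).hasDerivAt h.F_left hne)
  obtain ⟨x₁, hx₁⟩ := eventually_atBot.1 ev
  have hcont : Continuous fun x => (U x - um) / (s * profileField a g (U x)) :=
    (h.continuous_U.sub continuous_const).div
      (continuous_const.mul (h.contDiff_F.continuous.comp h.continuous_U))
      fun x => (h.slope_pos' x).ne'
  obtain ⟨C, hC⟩ := (isCompact_Icc (a := x₁) (b := 0)).exists_bound_of_continuousOn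
    hcont.continuousOn
  refine ⟨max (max C 0) (2 / |deriv (profileField a g) um|), by positivity, fun x hx => ?_⟩
  have hp := h.slope_pos' x
  rcases le_total x x₁ with h1 | h1
  · have := hx₁ x h1
    rw [h.abs_slope] at this
    exact this.trans (mul_le_mul_of_nonneg_right (le_max_right _ _) hp.le)
  · have := hC x ⟨h1, hx⟩
    rw [Real.norm_eq_abs, abs_div, abs_of_pos hp, div_le_iff₀ hp] at this
    exact this.trans (mul_le_mul_of_nonneg_right ((le_max_left _ _).trans (le_max_left _ _)) hp.le)

/-- A function whose derivative is dominated by that of a second function grows at most as much. -/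
theorem _root_.abs_sub_le_of_abs_deriv_le_deriv {k k' B B' : ℝ → ℝ} {x y : ℝ} (hxy : x ≤ y)
    (hk : ∀ t ∈ Icc x y, HasDerivAt k (k' t) t) (hB : ∀ t ∈ Icc x y, HasDerivAt B (B' t) t)
    (hle : ∀ t ∈ Icc x y, |k' t| ≤ B' t) : |k y - k x| ≤ B y - B x := by
  have m1 : MonotoneOn (fun t => B t - k t) (Icc x y) :=
    monotoneOn_of_hasDerivWithinAt_nonneg (f' := fun t => B' t - k' t) (convex_Icc x y)
      (fun t ht => ((hB t ht).sub (hk t ht)).continuousAt.continuousWithinAt)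
      (fun t ht => ((hB t (interior_subset ht)).sub (hk t (interior_subset ht))).hasDerivWithinAt)
      (fun t ht => by have := abs_le.1 (hle t (interior_subset ht)); linarith)
  have m2 : MonotoneOn (fun t => B t + k t) (Icc x y) :=
    monotoneOn_of_hasDerivWithinAt_nonneg (f' := fun t => B' t + k' t) (convex_Icc x y)
      (fun t ht => ((hB t ht).add (hk t ht)).continuousAt.continuousWithinAt)
      (fun t ht => ((hB t (interior_subset ht)).add (hk t (interior_subset ht))).hasDerivWithinAt)
      (fun t ht => by have := abs_le.1 (hle t (interior_subset ht)); linarith)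
  have e1 := m1 (left_mem_Icc.2 hxy) (right_mem_Icc.2 hxy) hxy
  have e2 := m2 (left_mem_Icc.2 hxy) (right_mem_Icc.2 hxy) hxy
  rw [abs_le]; constructor <;> simp only at e1 e2 <;> linarith

/-- The primitive along the profile of a Lipschitz function is asymptotically piecewise linear. -/
theorem exists_abs_integral_sub_le (h : IsFrontSystem a g U um up s) {k : ℝ → ℝ} {L : ℝ}
    (hk : Continuous k) (hL : ∀ v w, |k v - k w| ≤ L * |v - w|) :
    ∃ C, 0 ≤ C ∧
      ∀ x, |(∫ z in (0 : ℝ)..x, k (U z)) - (k up * max x 0 + k um * min x 0)| ≤ C := by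
  obtain ⟨C1, p1, b1⟩ := h.exists_abs_sub_right_le
  obtain ⟨C2, p2, b2⟩ := h.exists_abs_sub_left_le
  have hL0 : 0 ≤ L := by
    have := (abs_nonneg _).trans (hL 1 0)
    simpa using this
  have hI : ∀ c x, HasDerivAt (fun x => (∫ z in (0 : ℝ)..x, k (U z)) - c * x) (k (U x) - c) x :=
    fun c x => by
      convert! (hasDerivAt_integral_zero (hk.comp h.continuous_U) x).sub
        ((hasDerivAt_id x).const_mul c) using 1
      simp
  -- The error `k(U) - k(u±)` is at most `L |U - u±|`, hence at most a constant times `s U'`; its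
  -- primitive is then bounded by the total variation of `U`.
  have hB : ∀ C x, HasDerivAt (fun x => L * (C * (s * U x)))
      (L * (C * (s * profileField a g (U x)))) x := fun C x =>
    (((h.hasDerivAt_U x).const_mul s).const_mul C).const_mul L
  have hm : 0 ≤ s * up - s * um := by linarith [h.left_le 0, h.le_right 0]
  refine ⟨L * (C1 * (s * up - s * um)) + L * (C2 * (s * up - s * um)), by positivity, fun x => ?_⟩
  rcases le_total 0 x with hx | hx
  · rw [max_eq_left hx, min_eq_right hx, mul_zero, add_zero]
    have := abs_sub_le_of_abs_deriv_le_deriv hx (fun t _ => hI (k up) t) (fun t _ => hB C1 t)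
      (fun t ht => (hL _ _).trans (mul_le_mul_of_nonneg_left (b1 t ht.1) hL0))
    simp only [intervalIntegral.integral_same, mul_zero, sub_zero] at this
    refine this.trans ?_
    have h1 : L * (C1 * (s * U x - s * U 0)) ≤ L * (C1 * (s * up - s * um)) :=
      mul_le_mul_of_nonneg_left
        (mul_le_mul_of_nonneg_left (by linarith [h.le_right x, h.left_le 0]) p1) hL0
    have h2 : 0 ≤ L * (C2 * (s * up - s * um)) := by positivity
    linarith
  · rw [max_eq_right hx, min_eq_left hx, mul_zero, zero_add]
    have := abs_sub_le_of_abs_deriv_le_deriv hx (fun t _ => hI (k um) t) (fun t _ => hB C2 t)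
      (fun t ht => (hL _ _).trans (mul_le_mul_of_nonneg_left (b2 t ht.2) hL0))
    simp only [intervalIntegral.integral_same, mul_zero, sub_zero] at this
    rw [zero_sub, abs_neg] at this
    refine this.trans ?_
    have h1 : L * (C2 * (s * U 0 - s * U x)) ≤ L * (C2 * (s * up - s * um)) :=
      mul_le_mul_of_nonneg_left
        (mul_le_mul_of_nonneg_left (by linarith [h.le_right 0, h.left_le x]) p2) hL0
    have h2 : 0 ≤ L * (C1 * (s * up - s * um)) := by positivity
    linarith

/-- Since `W' = F'(U) W`, the logarithm of the slope is a primitive of the Lipschitz function `F'`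
along the profile. -/
theorem exists_abs_log_slope_sub_le (h : IsFrontSystem a g U um up s) :
    ∃ C, 0 ≤ C ∧ ∀ x, |Real.log (s * profileField a g (U x)) -
      (deriv g up / a up * max x 0 + deriv g um / a um * min x 0)| ≤ C := by
  obtain ⟨M, hM⟩ := h.exists_isCoeffBound
  have hc : Continuous (deriv (profileField a g)) := h.contDiff_F.continuous_deriv (by norm_num)
  obtain ⟨C, p, b⟩ := h.exists_abs_integral_sub_le hc hM.lip_deriv_F
  refine ⟨C + |Real.log (s * profileField a g (U 0))|, by positivity, fun x => ?_⟩
  have e := eq_mul_exp_integral (hc.comp h.continuous_U) h.hasDerivAt_slope 0 x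
  have h1 : Real.log (s * profileField a g (U x)) = Real.log (s * profileField a g (U 0)) +
      ∫ z in (0 : ℝ)..x, deriv (profileField a g) (U z) := by
    rw [e, ← mul_assoc, Real.log_mul (h.slope_pos' 0).ne' (Real.exp_ne_zero _), Real.log_exp]
    rfl
  have := b x
  rw [h.deriv_F_left, h.deriv_F_right] at this
  rw [h1, add_comm, add_sub_right_comm]
  exact (abs_add_le _ _).trans (by linarith)

/-- The time needed by the characteristics of the unperturbed front to go from `x` to `0`. -/
noncomputable def _root_.travelTime (a U : ℝ → ℝ) (x : ℝ) : ℝ := ∫ z in (0 : ℝ)..x, -(a (U z))⁻¹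

theorem hasDerivAt_travelTime (h : IsFrontSystem a g U um up s) (x : ℝ) :
    HasDerivAt (travelTime a U) (-(a (U x))⁻¹) x :=
  hasDerivAt_integral_zero (k := fun z => -(a (U z))⁻¹)
    ((h.contDiff_a.continuous.comp h.continuous_U).inv₀ fun _ => (h.a_neg _).ne).neg x

theorem exists_abs_travelTime_sub_le (h : IsFrontSystem a g U um up s) :
    ∃ C, 0 ≤ C ∧ ∀ x, |travelTime a U x - (-(a up)⁻¹ * max x 0 + -(a um)⁻¹ * min x 0)| ≤ C := by
  obtain ⟨M, hM⟩ := h.exists_isCoeffBound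
  have h0 : ∀ v, a v ≠ 0 := fun v => (h.a_neg v).ne
  have hM0 : 0 < M := by linarith [hM.one_le]
  have hinv : ∀ v, |(a v)⁻¹| ≤ M := fun v => by
    rw [abs_inv, abs_of_neg (h.a_neg v)]
    have := hM.inv_le v
    exact inv_le_of_inv_le₀ hM0 (by rwa [← one_div])
  refine h.exists_abs_integral_sub_le (k := fun v => -(a v)⁻¹) (L := M * M * M)
    (h.contDiff_a.continuous.inv₀ h0).neg fun v w => ?_
  have e : -(a v)⁻¹ - -(a w)⁻¹ = (a v)⁻¹ * (a w)⁻¹ * (a v - a w) := by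
    field_simp [h0 v, h0 w]; ring
  rw [e, abs_mul, abs_mul, mul_assoc (M * M)]
  exact mul_le_mul (mul_le_mul (hinv v) (hinv w) (abs_nonneg _) hM0.le) (hM.lip_a v w)
    (abs_nonneg _) (by positivity)

end IsFrontSystem

/-! ### Estimates along one characteristic -/

namespace IsCoeffBound

variable {a g : ℝ → ℝ} {M : ℝ}

theorem pos (h : IsCoeffBound a g M) : 0 < M := by linarith [h.one_le]

theorem one_le_mul (h : IsCoeffBound a g M) (v : ℝ) : 1 ≤ M * -a v := by
  have := h.inv_le v
  rwa [div_le_iff₀' h.pos] at this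

theorem abs_inv_le (h : IsCoeffBound a g M) (v : ℝ) : |(a v)⁻¹| ≤ M := by
  have h1 := h.inv_le v
  have h2 : 0 < 1 / M := by have := h.pos; positivity
  rw [abs_inv, abs_of_neg (show a v < 0 by linarith)]
  exact inv_le_of_inv_le₀ h.pos (by rwa [← one_div])

end IsCoeffBound

/-- The perturbation of a front at the foot `y` of a characteristic, together with its derivative,
is at most `η` times the slope of the front, with `η` small compared to the inverse of the
variation of the front on the left of `y`. -/
structure IsSmallAt (a g U : ℝ → ℝ) (um s M : ℝ) (u₀ : ℝ → ℝ) (y η : ℝ) : Prop where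
  pos : 0 < η
  le : |u₀ y - U y| ≤ η * (s * profileField a g (U y))
  deriv_le : |deriv u₀ y - profileField a g (U y)| ≤ η * (s * profileField a g (U y))
  -- The exponent and the factor are those required by `le_charJac`, the most demanding estimate;
  -- the others that use smallness directly need only `M ^ 3`.
  small : 12 * M ^ 9 * (η * (s * U y - s * um)) ≤ 1

namespace IsSmallAt

variable {a g U : ℝ → ℝ} {um up s M : ℝ} {Φ : ℝ → ℝ → ℝ} {u₀ : ℝ → ℝ} {y η : ℝ}

theorem mass_nonneg (hs : IsSmallAt a g U um s M u₀ y η) (hF : IsFrontSystem a g U um up s) :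
    0 ≤ η * (s * U y - s * um) :=
  mul_nonneg hs.pos.le (by linarith [hF.left_le y])

theorem pow_mul_le (hs : IsSmallAt a g U um s M u₀ y η) (hF : IsFrontSystem a g U um up s)
    (hM : IsCoeffBound a g M) {n : ℕ} (hn : n ≤ 9) :
    12 * (M ^ n * (η * (s * U y - s * um))) ≤ 1 := by
  have h1 : M ^ n ≤ M ^ 9 := pow_le_pow_right₀ hM.one_le hn
  have := mul_le_mul_of_nonneg_right h1 (hs.mass_nonneg hF)
  linarith [hs.small]

/-- Quantities whose rate of change along a characteristic is dominated by the slope of the front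
vary little. -/
theorem abs_sub_le_mass (h : IsCharSystem a g Φ u₀) (hF : IsFrontSystem a g U um up s)
    (hM : IsCoeffBound a g M) {k k' : ℝ → ℝ} {B : ℝ} (hB : 0 ≤ B)
    (hk : ∀ t, 0 ≤ t → HasDerivAt k (k' t) t)
    (hle : ∀ t, 0 ≤ t → |k' t| ≤ B * (s * profileField a g (U (charPos a Φ u₀ t y))))
    {t : ℝ} (ht : 0 ≤ t) : |k t - k 0| ≤ B * M * (s * U y - s * um) := by
  have hBM : 0 ≤ B * M := mul_nonneg hB hM.pos.le
  -- Since `M (-a) ≥ 1`, the decrease of `B M s U(X)` dominates `B W(X)`, so integrating the slope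
  -- in time costs only the variation of `U` on the left of `y`.
  have hd : ∀ t, HasDerivAt (fun t => -(B * M * (s * U (charPos a Φ u₀ t y))))
      (-(B * M * (s * (profileField a g (U (charPos a Φ u₀ t y)) * a (Φ t (u₀ y)))))) t := fun t =>
    ((((hF.hasDerivAt_U _).comp t (h.hasDerivAt_charPos_time t y)).const_mul s).const_mul _).neg
  have := abs_sub_le_of_abs_deriv_le_deriv ht (fun t ht => hk t ht.1) (fun t _ => hd t)
    (fun t ht => (hle t ht.1).trans (by
      have h1 := hM.one_le_mul (Φ t (u₀ y))
      have h2 := mul_nonneg hB (hF.slope_pos' (charPos a Φ u₀ t y)).le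
      calc _ = B * (s * profileField a g (U (charPos a Φ u₀ t y))) * 1 := by ring
        _ ≤ B * (s * profileField a g (U (charPos a Φ u₀ t y))) * (M * -a (Φ t (u₀ y))) := by
          gcongr
        _ = _ := by ring))
  refine this.trans ?_
  have h0 : charPos a Φ u₀ 0 y = y := by simp [charPos]
  rw [h0]
  have := mul_le_mul_of_nonneg_left (hF.left_le (charPos a Φ u₀ t y)) hBM
  linarith

/-- Along a characteristic the slope `W` solves the linearization of the equation for the
perturbation `v = u - U(X)`. In the derivative of the quotient `W / v` the linear terms cancel,
leaving a Taylor remainder over `v²`, bounded by `M² W`. Thus `|W / v|`, initially at least `1 / η`,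
stays above `1 / (2 η)`. -/
theorem abs_perturbation_le (hs : IsSmallAt a g U um s M u₀ y η) (h : IsCharSystem a g Φ u₀)
    (hF : IsFrontSystem a g U um up s) (hM : IsCoeffBound a g M) {t : ℝ} (ht : 0 ≤ t) :
    |Φ t (u₀ y) - U (charPos a Φ u₀ t y)| ≤
      2 * η * (s * profileField a g (U (charPos a Φ u₀ t y))) := by
  set F := profileField a g with hFdef
  set X : ℝ → ℝ := fun t => charPos a Φ u₀ t y with hX
  set u : ℝ → ℝ := fun t => Φ t (u₀ y) with hu
  change |u t - U (X t)| ≤ 2 * η * (s * F (U (X t)))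
  have hX0 : X 0 = y := by simp [hX, charPos]
  have hu0 : u 0 = u₀ y := h.flow.zero _
  have hXd : ∀ t, HasDerivAt X (a (u t)) t := fun t => h.hasDerivAt_charPos_time t y
  have hud : ∀ t, HasDerivAt u (g (u t)) t := fun t => h.flow.hasDerivAt _ t
  have hXc : Continuous X := continuous_iff_continuousAt.2 fun t => (hXd t).continuousAt
  have huc : Continuous u := continuous_iff_continuousAt.2 fun t => (hud t).continuousAt
  have hg : ∀ v, g v = a v * F v := fun v => by
    rw [hFdef, profileField, mul_div_cancel₀ _ (hF.a_neg v).ne]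
  have hUd : ∀ t, HasDerivAt (fun t => U (X t)) (F (U (X t)) * a (u t)) t := fun t =>
    (hF.hasDerivAt_U _).comp t (hXd t)
  have hvd : ∀ t, HasDerivAt (fun t => u t - U (X t)) (a (u t) * (F (u t) - F (U (X t)))) t :=
    fun t => by
      convert! (hud t).sub (hUd t) using 1
      rw [hg]; ring
  have hF1 : ContDiff ℝ 1 F := hF.contDiff_F.of_le (by norm_num)
  have hexp := eq_mul_exp_integral (x := fun t => u t - U (X t))
    (k := fun t => a (u t) * dividedDiff F (U (X t)) (u t))
    ((hF.contDiff_a.continuous.comp huc).mul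
      ((continuous_dividedDiff hF1).comp₂ (hF.continuous_U.comp hXc) huc))
    (fun t => by
      convert! hvd t using 1
      rw [sub_eq_mul_dividedDiff hF1]; ring)
  have hWt := hF.slope_pos' (X t)
  -- By the exponential formula the perturbation vanishes identically or never, so division by it is
  -- legitimate in the second case.
  by_cases h0 : u 0 - U (X 0) = 0
  · have := hexp 0 t
    simp only [h0, zero_mul] at this
    rw [this, abs_zero]
    exact mul_nonneg (mul_nonneg zero_le_two hs.pos.le) hWt.le
  have hne : ∀ t, u t - U (X t) ≠ 0 := fun t ht => by
    have := hexp t 0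
    simp only [ht, zero_mul] at this
    exact h0 this
  set w : ℝ → ℝ := fun t => F (U (X t)) / (u t - U (X t)) with hw
  have hwd : ∀ t, HasDerivAt w (-(a (u t) * F (U (X t)) *
      (F (u t) - F (U (X t)) - deriv F (U (X t)) * (u t - U (X t)))) / (u t - U (X t)) ^ 2) t :=
    fun t => by
      convert! ((hF.hasDerivAt_slope (X t)).comp t (hXd t)).div (hvd t) (hne t) using 1
      simp only [Function.comp, ← hFdef]
      ring
  have hbound : ∀ t, 0 ≤ t → |-(a (u t) * F (U (X t)) *
      (F (u t) - F (U (X t)) - deriv F (U (X t)) * (u t - U (X t)))) / (u t - U (X t)) ^ 2| ≤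
      M ^ 2 * (s * F (U (X t))) := fun t _ => by
    have hv2 : 0 < |u t - U (X t)| ^ 2 := pow_pos (abs_pos.2 (hne t)) 2
    rw [abs_div, abs_neg, abs_mul, abs_mul, abs_pow, div_le_iff₀ hv2, hF.abs_slope]
    have h1 := hM.abs_a (u t)
    have h2 := hM.taylor_F (u t) (U (X t))
    have h3 := (hF.slope_pos' (X t)).le
    calc _ ≤ M * (s * F (U (X t))) * (M * |u t - U (X t)| ^ 2) := by
          refine mul_le_mul (mul_le_mul_of_nonneg_right h1 h3) h2 (abs_nonneg _) ?_
          exact mul_nonneg hM.pos.le h3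
      _ = _ := by ring
  have key := abs_sub_le_mass h hF hM (sq_nonneg M) (fun t _ => hwd t) hbound ht
  have hv0 : 0 < |u 0 - U (X 0)| := abs_pos.2 h0
  have hw0 : 1 / η ≤ |w 0| := by
    simp only [hw]
    rw [abs_div, hF.abs_slope, le_div_iff₀ hv0, one_div, inv_mul_le_iff₀ hs.pos, hX0, hu0]
    exact hs.le
  have hsm : M ^ 2 * M * (s * U y - s * um) ≤ 1 / (2 * η) := by
    have := hs.pow_mul_le hF hM (n := 3) (by norm_num)
    have hη := hs.pos
    rw [le_div_iff₀ (by positivity)]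
    have e : M ^ 2 * M * (s * U y - s * um) * (2 * η) =
        2 * (M ^ 3 * (η * (s * U y - s * um))) := by ring
    rw [e]; linarith [mul_nonneg (pow_nonneg hM.pos.le 3) (hs.mass_nonneg hF)]
  have hwt : 1 / (2 * η) ≤ |w t| := by
    have h1 := abs_sub_abs_le_abs_sub (w 0) (w t)
    rw [abs_sub_comm] at h1
    have h2 : 1 / η = 1 / (2 * η) + 1 / (2 * η) := by
      have := hs.pos.ne'; field_simp; norm_num
    linarith
  simp only [hw] at hwt
  have h2η : 0 < 2 * η := by linarith [hs.pos]
  rw [abs_div, hF.abs_slope, le_div_iff₀ (abs_pos.2 (hne t)), one_div,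
    inv_mul_le_iff₀ h2η] at hwt
  exact hwt

/-- The quantity `∫ g'(u) - log(-a(u)) - log W(X)` has derivative `a(u) (F'(u) - F'(U(X)))`, which
is `O(η W)`. It would be constant along the unperturbed front, and here it varies by at most `1`;
the factor `3` bounds `exp 1`. -/
theorem flowJac_le (hs : IsSmallAt a g U um s M u₀ y η) (h : IsCharSystem a g Φ u₀)
    (hF : IsFrontSystem a g U um up s) (hM : IsCoeffBound a g M) {t : ℝ} (ht : 0 ≤ t) :
    flowJac g Φ t (u₀ y) * (s * profileField a g (U y)) ≤
      3 * M ^ 2 * (s * profileField a g (U (charPos a Φ u₀ t y))) := by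
  have two : (2 : WithTop ℕ∞) ≠ 0 := two_ne_zero
  have hpert := fun t ht => hs.abs_perturbation_le h hF hM (t := t) ht
  set F := profileField a g with hFdef
  set X : ℝ → ℝ := fun t => charPos a Φ u₀ t y with hX
  set u : ℝ → ℝ := fun t => Φ t (u₀ y) with hu
  have hX0 : X 0 = y := by simp [hX, charPos]
  have hu0 : u 0 = u₀ y := h.flow.zero _
  have hXd : ∀ t, HasDerivAt X (a (u t)) t := fun t => h.hasDerivAt_charPos_time t y
  have hud : ∀ t, HasDerivAt u (g (u t)) t := fun t => h.flow.hasDerivAt _ t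
  set I : ℝ → ℝ := fun t => ∫ r in (0 : ℝ)..t, deriv g (u r) with hI
  have hId : ∀ t, HasDerivAt I (deriv g (u t)) t := fun t => hasDerivAt_integral_zero
    ((h.contDiff_g.continuous_deriv le_rfl).comp (h.flow.continuous_time _)) t
  have hla : ∀ t, HasDerivAt (fun t => Real.log (-a (u t)))
      (deriv a (u t) * g (u t) / a (u t)) t := fun t => by
    have h1 := (((hF.contDiff_a.differentiable two (u t)).hasDerivAt.comp t (hud t)).neg).log
      (by simpa using (hF.a_neg (u t)).ne)
    convert! h1 using 1
    simp [neg_div_neg_eq]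
  have hls : ∀ t, HasDerivAt (fun t => Real.log (s * F (U (X t))))
      (deriv F (U (X t)) * a (u t)) t := fun t => by
    have h1 := (((hF.hasDerivAt_slope (X t)).comp t (hXd t)).const_mul s).log
      (hF.slope_pos' (X t)).ne'
    convert! h1 using 1
    have := (hF.slope_pos' (X t)).ne'
    rw [← hFdef] at this ⊢
    simp only [Function.comp]
    rw [eq_div_iff this]
    ring
  have key := abs_sub_le_mass h hF hM (y := y)
    (k := fun t => I t - Real.log (-a (u t)) - Real.log (s * F (U (X t))))
    (k' := fun t => a (u t) * (deriv F (u t) - deriv F (U (X t)))) (B := 2 * M ^ 2 * η)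
    (by have := hs.pos; positivity)
    (fun t _ => by
      convert! ((hId t).sub (hla t)).sub (hls t) using 1
      have h0 := (hF.a_neg (u t)).ne
      have h1 : deriv F (u t) = _ := hF.deriv_F (u t)
      rw [h1, profileField]
      field_simp)
    (fun t ht => by
      rw [abs_mul]
      calc _ ≤ M * (M * |u t - U (X t)|) :=
            mul_le_mul (hM.abs_a _) (hM.lip_deriv_F _ _) (abs_nonneg _) hM.pos.le
        _ ≤ M * (M * (2 * η * (s * F (U (X t))))) := by
            have := hM.pos.le
            gcongr
            exact hpert t ht
        _ = _ := by ring) ht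
  have hsm : 2 * M ^ 2 * η * M * (s * U y - s * um) ≤ 1 := by
    have := hs.pow_mul_le hF hM (n := 3) (by norm_num)
    have h2 := mul_nonneg (pow_nonneg hM.pos.le 3) (hs.mass_nonneg hF)
    have e : 2 * M ^ 2 * η * M * (s * U y - s * um) =
        2 * (M ^ 3 * (η * (s * U y - s * um))) := by ring
    rw [e]; linarith
  have hup := (abs_le.1 (key.trans hsm)).2
  have hI0 : I 0 = 0 := by simp [hI]
  simp only [hI0, hX0, hu0] at hup
  have hWy := hF.slope_pos' y
  have hWt := hF.slope_pos' (X t)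
  have hat : 0 < -a (u t) := neg_pos.2 (hF.a_neg _)
  have ha0 : 0 < -a (u₀ y) := neg_pos.2 (hF.a_neg _)
  have hI1 : I t ≤ 1 + Real.log (-a (u t)) + Real.log (s * F (U (X t))) - Real.log (-a (u₀ y)) -
      Real.log (s * F (U y)) := by linarith
  have hexp := Real.exp_le_exp.2 hI1
  rw [Real.exp_sub, Real.exp_sub, Real.exp_add, Real.exp_add, Real.exp_log hat, Real.exp_log hWt,
    Real.exp_log ha0, Real.exp_log hWy, le_div_iff₀ hWy] at hexp
  refine (show flowJac g Φ t (u₀ y) * (s * F (U y)) ≤ _ from hexp).trans ?_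
  rw [div_le_iff₀ ha0]
  have e3 : Real.exp 1 ≤ 3 := by linarith [Real.exp_one_lt_d9]
  have hA : -a (u t) ≤ M := (neg_le_abs _).trans (hM.abs_a _)
  have hone := hM.one_le_mul (u₀ y)
  have hM0 := hM.pos
  calc Real.exp 1 * -a (u t) * (s * F (U (X t))) ≤ 3 * M * (s * F (U (X t))) := by gcongr
    _ = 3 * M * (s * F (U (X t))) * 1 := by ring
    _ ≤ 3 * M * (s * F (U (X t))) * (M * -a (u₀ y)) := by gcongr
    _ = _ := by ring

/-- The derivative of `travelTime + t` along the characteristic is `1 - a(u) / a(U(X))`, controlled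
by the perturbation and hence by `η W`. -/
theorem abs_travelTime_sub_le (hs : IsSmallAt a g U um s M u₀ y η) (h : IsCharSystem a g Φ u₀)
    (hF : IsFrontSystem a g U um up s) (hM : IsCoeffBound a g M) {t : ℝ} (ht : 0 ≤ t) :
    |travelTime a U (charPos a Φ u₀ t y) + t - travelTime a U y| ≤ 1 := by
  have hpert := fun t ht => hs.abs_perturbation_le h hF hM (t := t) ht
  have key := abs_sub_le_mass h hF hM (y := y)
    (k := fun t => travelTime a U (charPos a Φ u₀ t y) + t)
    (k' := fun t => -(a (U (charPos a Φ u₀ t y)))⁻¹ * a (Φ t (u₀ y)) + 1) (B := 2 * M ^ 2 * η)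
    (by have := hs.pos; positivity)
    (fun t _ => ((hF.hasDerivAt_travelTime _).comp t (h.hasDerivAt_charPos_time t y)).add
      (hasDerivAt_id t))
    (fun t ht => by
      have h0 := (hF.a_neg (U (charPos a Φ u₀ t y))).ne
      have e : -(a (U (charPos a Φ u₀ t y)))⁻¹ * a (Φ t (u₀ y)) + 1 =
          -((a (U (charPos a Φ u₀ t y)))⁻¹ *
            (a (Φ t (u₀ y)) - a (U (charPos a Φ u₀ t y)))) := by
        field_simp; ring
      simp only [e]
      rw [abs_neg, abs_mul]
      calc _ ≤ M * (M * |Φ t (u₀ y) - U (charPos a Φ u₀ t y)|) :=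
            mul_le_mul (hM.abs_inv_le _) (hM.lip_a _ _) (abs_nonneg _) hM.pos.le
        _ ≤ M * (M * (2 * η * (s * profileField a g (U (charPos a Φ u₀ t y))))) := by
            have := hM.pos.le
            gcongr
            exact hpert t ht
        _ = _ := by ring) ht
  have hsm : 2 * M ^ 2 * η * M * (s * U y - s * um) ≤ 1 := by
    have := hs.pow_mul_le hF hM (n := 3) (by norm_num)
    have h2 := mul_nonneg (pow_nonneg hM.pos.le 3) (hs.mass_nonneg hF)
    have e : 2 * M ^ 2 * η * M * (s * U y - s * um) =
        2 * (M ^ 3 * (η * (s * U y - s * um))) := by ring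
    rw [e]; linarith
  have h0 : charPos a Φ u₀ 0 y = y := by simp [charPos]
  simp only [h0, add_zero] at key
  exact key.trans hsm

/-- The front itself has `g(U) = a(U) U'`, so `g(u₀) - a(u₀) u₀'` is Lipschitz in the perturbation
and its derivative. -/
theorem abs_defect_le (hs : IsSmallAt a g U um s M u₀ y η) (hF : IsFrontSystem a g U um up s)
    (hM : IsCoeffBound a g M) :
    |g (u₀ y) - a (u₀ y) * deriv u₀ y| ≤ 2 * M ^ 2 * η * (s * profileField a g (U y)) := by
  have hM0 := hM.pos
  have h1M := hM.one_le
  have hW := hF.slope_pos' y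
  have e : g (u₀ y) - a (u₀ y) * deriv u₀ y =
      a (u₀ y) * ((profileField a g (u₀ y) - profileField a g (U y)) -
        (deriv u₀ y - profileField a g (U y))) := by
    have : g (u₀ y) = a (u₀ y) * profileField a g (u₀ y) := by
      rw [profileField, mul_div_cancel₀ _ (hF.a_neg _).ne]
    rw [this]; ring
  rw [e, abs_mul]
  have hη := hs.pos
  have h3 : |(profileField a g (u₀ y) - profileField a g (U y)) -
      (deriv u₀ y - profileField a g (U y))| ≤
      M * (η * (s * profileField a g (U y))) + M * (η * (s * profileField a g (U y))) := by
    refine (abs_sub _ _).trans (add_le_add ?_ ?_)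
    · refine (hM.lip_F _ _).trans ?_
      gcongr
      exact hs.le
    · refine hs.deriv_le.trans ?_
      have : 0 ≤ η * (s * profileField a g (U y)) := by positivity
      nlinarith
  calc _ ≤ M * (M * (η * (s * profileField a g (U y))) + M * (η * (s * profileField a g (U y)))) :=
        mul_le_mul (hM.abs_a _) h3 (abs_nonneg _) hM0.le
    _ = _ := by ring

/-- The quantity `g(u) J - a(u) R`, with `J` and `R` the derivatives of the position and of the
solution with respect to the foot of the characteristic, solves the same equation as the derivative
of the flow of the source. -/
theorem defect_eq (h : IsCharSystem a g Φ u₀) (t : ℝ) :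
    g (Φ t (u₀ y)) * charJac a g Φ u₀ t y -
      a (Φ t (u₀ y)) * (flowJac g Φ t (u₀ y) * deriv u₀ y) =
      (g (u₀ y) - a (u₀ y) * deriv u₀ y) * flowJac g Φ t (u₀ y) := by
  have hud : ∀ t, HasDerivAt (fun t => Φ t (u₀ y)) (g (Φ t (u₀ y))) t :=
    fun t => h.flow.hasDerivAt _ t
  have ha : ∀ t, HasDerivAt (fun t => a (Φ t (u₀ y))) (deriv a (Φ t (u₀ y)) * g (Φ t (u₀ y))) t :=
    fun t => (h.contDiff_a.differentiable one_ne_zero _).hasDerivAt.comp t (hud t)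
  have hg : ∀ t, HasDerivAt (fun t => g (Φ t (u₀ y))) (deriv g (Φ t (u₀ y)) * g (Φ t (u₀ y))) t :=
    fun t => (h.contDiff_g.differentiable one_ne_zero _).hasDerivAt.comp t (hud t)
  have := eq_mul_exp_integral
    (x := fun t => g (Φ t (u₀ y)) * charJac a g Φ u₀ t y -
      a (Φ t (u₀ y)) * (flowJac g Φ t (u₀ y) * deriv u₀ y))
    (k := fun t => deriv g (Φ t (u₀ y)))
    ((h.contDiff_g.continuous_deriv le_rfl).comp (h.flow.continuous_time _))
    (fun t => by
      convert! ((hg t).mul (h.hasDerivAt_charJac_time t y)).sub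
        ((ha t).mul ((h.hasDerivAt_flowJac_time t (u₀ y)).mul_const (deriv u₀ y))) using 1
      ring) 0 t
  rw [this]
  simp [h.flow.zero, charJac, flowJac]

/-- The quotient `J / a(u)` has derivative `-a'(u) (g(u) J - a(u) R) / a(u)²`, with `R` as in
`defect_eq`. That lemma reduces the parenthesis to the initial defect times the flow Jacobian, which
is `O(η W(X))`. So the quotient remains close to its initial value `1 / a(u₀)`. -/
theorem le_charJac (hs : IsSmallAt a g U um s M u₀ y η) (h : IsCharSystem a g Φ u₀)
    (hF : IsFrontSystem a g U um up s) (hM : IsCoeffBound a g M) {t : ℝ} (ht : 0 ≤ t) :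
    1 / (2 * M ^ 2) ≤ charJac a g Φ u₀ t y := by
  have hM0 := hM.pos
  have hη := hs.pos
  have hWy := hF.slope_pos' y
  have ha0 : ∀ t, a (Φ t (u₀ y)) ≠ 0 := fun t => (hF.a_neg _).ne
  have hd : ∀ t, HasDerivAt (fun t => charJac a g Φ u₀ t y / a (Φ t (u₀ y)))
      (-(deriv a (Φ t (u₀ y)) * ((g (u₀ y) - a (u₀ y) * deriv u₀ y) * flowJac g Φ t (u₀ y)) *
        ((a (Φ t (u₀ y)))⁻¹ * (a (Φ t (u₀ y)))⁻¹))) t := fun t => by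
    have ha : HasDerivAt (fun t => a (Φ t (u₀ y))) (deriv a (Φ t (u₀ y)) * g (Φ t (u₀ y))) t :=
      (h.contDiff_a.differentiable one_ne_zero _).hasDerivAt.comp t (h.flow.hasDerivAt _ t)
    convert! (h.hasDerivAt_charJac_time t y).div ha (ha0 t) using 1
    rw [← defect_eq h]
    have := ha0 t
    field_simp
    ring
  have key := abs_sub_le_mass h hF hM (y := y) (B := 6 * M ^ 7 * η) (by positivity)
    (fun t _ => hd t) (fun t ht => by
      have h1 := hs.abs_defect_le hF hM
      have h2 := hs.flowJac_le h hF hM ht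
      have hP : 0 < flowJac g Φ t (u₀ y) := Real.exp_pos _
      rw [abs_neg, abs_mul, abs_mul, abs_mul, abs_mul, abs_of_pos hP]
      have h3 : |g (u₀ y) - a (u₀ y) * deriv u₀ y| * flowJac g Φ t (u₀ y) ≤
          6 * M ^ 4 * η * (s * profileField a g (U (charPos a Φ u₀ t y))) := by
        calc _ ≤ 2 * M ^ 2 * η * (s * profileField a g (U y)) * flowJac g Φ t (u₀ y) := by gcongr
          _ = 2 * M ^ 2 * η * (flowJac g Φ t (u₀ y) * (s * profileField a g (U y))) := by ring
          _ ≤ 2 * M ^ 2 * η *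
              (3 * M ^ 2 * (s * profileField a g (U (charPos a Φ u₀ t y)))) := by gcongr
          _ = _ := by ring
      have hWt := hF.slope_pos' (charPos a Φ u₀ t y)
      have h5 : |deriv a (Φ t (u₀ y))| *
          (|g (u₀ y) - a (u₀ y) * deriv u₀ y| * flowJac g Φ t (u₀ y)) ≤
          M * (6 * M ^ 4 * η * (s * profileField a g (U (charPos a Φ u₀ t y)))) :=
        mul_le_mul (hM.abs_deriv_a _) h3 (by positivity) hM0.le
      have h6 : |(a (Φ t (u₀ y)))⁻¹| * |(a (Φ t (u₀ y)))⁻¹| ≤ M * M :=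
        mul_le_mul (hM.abs_inv_le _) (hM.abs_inv_le _) (abs_nonneg _) hM0.le
      calc _ ≤ M * (6 * M ^ 4 * η * (s * profileField a g (U (charPos a Φ u₀ t y)))) * (M * M) :=
            mul_le_mul h5 h6 (by positivity) (by positivity)
        _ = _ := by ring) ht
  have hJ0 : charJac a g Φ u₀ 0 y = 1 := by simp [charJac]
  simp only [hJ0, h.flow.zero] at key
  have hsm : 6 * M ^ 7 * η * M * (s * U y - s * um) ≤ 1 / (2 * M) := by
    rw [le_div_iff₀ (by positivity)]
    have := hs.pow_mul_le hF hM (n := 9) le_rfl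
    have e : 6 * M ^ 7 * η * M * (s * U y - s * um) * (2 * M) =
        12 * (M ^ 9 * (η * (s * U y - s * um))) := by ring
    rw [e]; exact this
  have h2 := (abs_le.1 (key.trans hsm)).2
  have hinv : 1 / M ≤ -(1 / a (u₀ y)) := by
    have hneg := neg_pos.2 (hF.a_neg (u₀ y))
    rw [← one_div_neg_eq_neg_one_div]
    exact one_div_le_one_div_of_le hneg ((neg_le_abs _).trans (hM.abs_a _))
  -- The quotient starts below `-1 / M` and moves by at most `1 / (2 M)`.
  have e2 : 1 / M = 1 / (2 * M) + 1 / (2 * M) := by field_simp; norm_num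
  have h3 : charJac a g Φ u₀ t y / a (Φ t (u₀ y)) ≤ -(1 / (2 * M)) := by linarith
  rw [div_le_iff_of_neg (hF.a_neg _)] at h3
  refine le_trans ?_ h3
  have := hM.inv_le (Φ t (u₀ y))
  calc 1 / (2 * M ^ 2) = 1 / (2 * M) * (1 / M) := by field_simp
    _ ≤ 1 / (2 * M) * -a (Φ t (u₀ y)) := by gcongr
    _ = _ := by ring

/-- Here `∂ₓ u = R / J`, and `defect_eq` gives `R / J = F(u) - q P / (a(u) J)`, with `q` the initial
defect and `P` the flow Jacobian. Both `F(u) - F(U(X))` and the correction are `O(η W(X))`; the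
constant `14` is `2 + 12`. -/
theorem abs_slope_sub_le (hs : IsSmallAt a g U um s M u₀ y η) (h : IsCharSystem a g Φ u₀)
    (hF : IsFrontSystem a g U um up s) (hM : IsCoeffBound a g M) {t : ℝ} (ht : 0 ≤ t) :
    |flowJac g Φ t (u₀ y) * deriv u₀ y / charJac a g Φ u₀ t y -
      profileField a g (U (charPos a Φ u₀ t y))| ≤
      14 * M ^ 7 * η * (s * profileField a g (U (charPos a Φ u₀ t y))) := by
  have hM0 := hM.pos
  have hη := hs.pos
  have hP : 0 < flowJac g Φ t (u₀ y) := Real.exp_pos _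
  have hJle := hs.le_charJac h hF hM ht
  have hJ : 0 < charJac a g Φ u₀ t y := lt_of_lt_of_le (by positivity) hJle
  have hWt := hF.slope_pos' (charPos a Φ u₀ t y)
  have ha := (hF.a_neg (Φ t (u₀ y))).ne
  set q := g (u₀ y) - a (u₀ y) * deriv u₀ y with hq
  have e : flowJac g Φ t (u₀ y) * deriv u₀ y / charJac a g Φ u₀ t y -
      profileField a g (U (charPos a Φ u₀ t y)) =
      (profileField a g (Φ t (u₀ y)) - profileField a g (U (charPos a Φ u₀ t y))) -
        q * flowJac g Φ t (u₀ y) * (a (Φ t (u₀ y)))⁻¹ * (charJac a g Φ u₀ t y)⁻¹ := by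
    have hΦ : profileField a g (Φ t (u₀ y)) = g (Φ t (u₀ y)) / a (Φ t (u₀ y)) := rfl
    rw [hq, ← defect_eq h t, hΦ]
    field_simp
    ring
  have hJinv : |(charJac a g Φ u₀ t y)⁻¹| ≤ 2 * M ^ 2 := by
    rw [abs_inv, abs_of_pos hJ]
    refine inv_le_of_inv_le₀ (by positivity) ?_
    rwa [← one_div]
  have h3 : |q * flowJac g Φ t (u₀ y)| ≤
      6 * M ^ 4 * η * (s * profileField a g (U (charPos a Φ u₀ t y))) := by
    rw [abs_mul, abs_of_pos hP]
    calc _ ≤ 2 * M ^ 2 * η * (s * profileField a g (U y)) * flowJac g Φ t (u₀ y) := by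
          gcongr
          exact hs.abs_defect_le hF hM
      _ = 2 * M ^ 2 * η * (flowJac g Φ t (u₀ y) * (s * profileField a g (U y))) := by ring
      _ ≤ 2 * M ^ 2 * η *
          (3 * M ^ 2 * (s * profileField a g (U (charPos a Φ u₀ t y)))) :=
          mul_le_mul_of_nonneg_left (hs.flowJac_le h hF hM ht) (by positivity)
      _ = _ := by ring
  have hpert := hs.abs_perturbation_le h hF hM ht
  rw [e]
  refine (abs_sub _ _).trans ?_
  have t1 : |profileField a g (Φ t (u₀ y)) - profileField a g (U (charPos a Φ u₀ t y))| ≤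
      2 * M ^ 7 * η * (s * profileField a g (U (charPos a Φ u₀ t y))) := by
    have hM7 : M ≤ M ^ 7 := le_self_pow₀ hM.one_le (by norm_num)
    calc _ ≤ M * |Φ t (u₀ y) - U (charPos a Φ u₀ t y)| := hM.lip_F _ _
      _ ≤ M ^ 7 * (2 * η * (s * profileField a g (U (charPos a Φ u₀ t y)))) := by gcongr
      _ = _ := by ring
  have t2 : |q * flowJac g Φ t (u₀ y) * (a (Φ t (u₀ y)))⁻¹ * (charJac a g Φ u₀ t y)⁻¹| ≤
      12 * M ^ 7 * η * (s * profileField a g (U (charPos a Φ u₀ t y))) := by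
    rw [abs_mul, abs_mul]
    calc _ ≤ 6 * M ^ 4 * η * (s * profileField a g (U (charPos a Φ u₀ t y))) * M * (2 * M ^ 2) := by
          gcongr
          exact hM.abs_inv_le _
      _ = _ := by ring
  linarith

end IsSmallAt

theorem expWeight_pos (κ x : ℝ) : 0 < expWeight κ x := Real.exp_pos _

/-! ### Weighted estimates in the moving frame -/

namespace IsFrontSystem

variable {a g U : ℝ → ℝ} {um up s : ℝ}

/-- In the weighted norm, the smallness of a perturbation compares to the slope of the front. -/
theorem exists_mass_mul_weight_le (h : IsFrontSystem a g U um up s) {κ : ℝ}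
    (hκ : deriv g up / |a up| ≤ κ) : ∃ C, 0 ≤ C ∧
      ∀ y, expWeight κ y * (s * U y - s * um) ≤ C * (s * profileField a g (U y)) := by
  obtain ⟨C1, p1, b1⟩ := h.exists_abs_sub_left_le
  obtain ⟨C2, p2, b2⟩ := h.exists_abs_log_slope_sub_le
  have hm : 0 ≤ s * up - s * um := by linarith [h.left_le 0, h.le_right 0]
  refine ⟨C1 + Real.exp C2 * (s * up - s * um), by positivity, fun y => ?_⟩
  have hW := h.slope_pos' y
  rcases le_total y 0 with hy | hy
  · have e : expWeight κ y = 1 := by simp [expWeight, max_eq_right hy]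
    rw [e, one_mul]
    have h1 : s * U y - s * um ≤ |U y - um| := by
      rw [← mul_sub]
      refine (le_abs_self _).trans ?_
      rw [abs_mul, h.abs_s, one_mul]
    have h2 : 0 ≤ Real.exp C2 * (s * up - s * um) * (s * profileField a g (U y)) := by positivity
    linarith [b1 y hy]
  · have h1 : s * U y - s * um ≤ s * up - s * um := by linarith [h.le_right y]
    -- This is where `κ ≥ κ⁺` enters: at `+∞` the slope behaves like `exp(-κ⁺ y)`.
    have h2 : expWeight κ y ≤ Real.exp C2 * (s * profileField a g (U y)) := by
      rw [← Real.exp_log hW, ← Real.exp_add, expWeight, Real.exp_le_exp, max_eq_left hy]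
      have := (abs_le.1 (b2 y)).1
      rw [max_eq_left hy, min_eq_right hy, mul_zero, add_zero] at this
      have e : deriv g up / a up = -(deriv g up / |a up|) := by
        rw [abs_of_neg (h.a_neg up), div_neg, neg_neg]
      rw [e] at this
      nlinarith
    have h3 := mul_le_mul h2 h1 (by linarith [h.left_le y]) (by positivity)
    have h4 : 0 ≤ C1 * (s * profileField a g (U y)) := by positivity
    linarith

/-- The decay of the slope of the front along the characteristics, in terms of the weight. -/
theorem exists_slope_mul_weight_le (h : IsFrontSystem a g U um up s) {κ rate : ℝ} (hrate : 0 ≤ rate)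
    (hrate1 : rate ≤ |deriv g um|) (hrate2 : rate ≤ (κ - deriv g up / |a up|) * |a up|) :
    ∃ C, 0 < C ∧ ∀ t X y, X ≤ y → travelTime a U X + t - travelTime a U y ≤ 1 →
      expWeight κ y * (s * profileField a g (U X)) ≤
        C * (Real.exp (-t * rate) * expWeight κ X * (s * profileField a g (U y))) := by
  obtain ⟨C1, p1, b1⟩ := h.exists_abs_log_slope_sub_le
  obtain ⟨C2, p2, b2⟩ := h.exists_abs_travelTime_sub_le
  refine ⟨Real.exp (2 * C1 + rate * (2 * C2 + 1)), Real.exp_pos _, fun t X y hXy ht => ?_⟩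
  have hWX := h.slope_pos' X
  have hWy := h.slope_pos' y
  rw [← Real.exp_log hWX, ← Real.exp_log hWy, expWeight, expWeight, ← Real.exp_add,
    ← Real.exp_add, ← Real.exp_add, ← Real.exp_add, Real.exp_le_exp]
  have hap := h.a_neg up
  have ham := h.a_neg um
  set ip := -(a up)⁻¹ with hip
  set im := -(a um)⁻¹ with him
  have hip0 : 0 < ip := neg_pos.2 (inv_lt_zero.2 hap)
  have him0 : 0 < im := neg_pos.2 (inv_lt_zero.2 ham)
  have e1 : deriv g up / a up = -(deriv g up * ip) := by rw [hip]; ring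
  have e2 : deriv g um / a um = -(deriv g um * im) := by rw [him]; ring
  have hP : max X 0 ≤ max y 0 := max_le_max_right 0 hXy
  have hQ : min X 0 ≤ min y 0 := min_le_min_right 0 hXy
  have l1 := (abs_le.1 (b1 X)).2
  have l2 := (abs_le.1 (b1 y)).1
  have l3 := (abs_le.1 (b2 X)).1
  have l4 := (abs_le.1 (b2 y)).2
  rw [e1, e2] at l1 l2
  rw [abs_of_neg h.deriv_left] at hrate1
  have r1 : rate * ip ≤ κ - deriv g up * ip := by
    have e3 : deriv g up / |a up| = deriv g up * ip := by
      rw [abs_of_neg hap, hip, div_eq_mul_inv, inv_neg]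
    rw [e3, abs_of_neg hap] at hrate2
    have := mul_le_mul_of_nonneg_right hrate2 hip0.le
    have e4 : -a up * ip = 1 := by rw [hip, neg_mul_neg, mul_inv_cancel₀ hap.ne]
    calc rate * ip ≤ (κ - deriv g up * ip) * -a up * ip := this
      _ = (κ - deriv g up * ip) * (-a up * ip) := by ring
      _ = _ := by rw [e4, mul_one]
  have r2 : rate * im ≤ -deriv g um * im := mul_le_mul_of_nonneg_right hrate1 him0.le
  -- In logarithms all terms are linear in the distances crossed on each half-line. On the right, a
  -- gain of `κ - κ⁺` per unit length pays for `rate` times the crossing time; on the left the decay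
  -- of the slope towards `um` pays. The travel time then bounds `t` by the sum of the crossing
  -- times.
  have s1 := mul_le_mul_of_nonneg_right r1 (sub_nonneg.2 hP)
  have s2 := mul_le_mul_of_nonneg_right r2 (sub_nonneg.2 hQ)
  have s3 : rate * t ≤ rate * (ip * (max y 0 - max X 0) + im * (min y 0 - min X 0) + 2 * C2 + 1) :=
    mul_le_mul_of_nonneg_left (by linarith) hrate
  linarith

/-- Global classical solutions near a front, in the moving frame. -/
theorem exists_solution (h : IsFrontSystem a g U um up s) {κ rate : ℝ}
    (hκ : deriv g up / |a up| ≤ κ) (hrate : 0 ≤ rate)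
    (hrate1 : rate ≤ |deriv g um|) (hrate2 : rate ≤ (κ - deriv g up / |a up|) * |a up|) :
    ∃ C, 0 < C ∧ ∃ δ, 0 < δ ∧ ∀ u₀ : ℝ → ℝ, ContDiff ℝ 1 u₀ → (∃ B, ∀ y, |deriv u₀ y| ≤ B) →
      (∀ y, |u₀ y - U y| ≤ δ * expWeight κ y) →
      (∀ y, |deriv u₀ y - deriv U y| ≤ δ * expWeight κ y) →
      ∃ u : ℝ → ℝ → ℝ, ∃ ε, 0 < ε ∧ u 0 = u₀ ∧
        ContDiffOn ℝ 1 (fun p : ℝ × ℝ => u p.1 p.2) (Ioi (-ε) ×ˢ univ) ∧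
        (∀ t, 0 ≤ t → ∀ x,
          fderiv ℝ (fun p : ℝ × ℝ => u p.1 p.2) (t, x) (1, a (u t x)) = g (u t x)) ∧
        ∀ E, 0 ≤ E → E ≤ δ → (∀ y, |u₀ y - U y| ≤ E * expWeight κ y) →
          (∀ y, |deriv u₀ y - deriv U y| ≤ E * expWeight κ y) → ∀ t, 0 ≤ t → ∀ x,
            |u t x - U x| ≤ C * E * Real.exp (-t * rate) * expWeight κ x ∧
            |deriv (u t) x - deriv U x| ≤ C * E * Real.exp (-t * rate) * expWeight κ x := by
  obtain ⟨M, hM⟩ := h.exists_isCoeffBound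
  obtain ⟨C1, p1, b1⟩ := h.exists_mass_mul_weight_le hκ
  obtain ⟨C2, p2, b2⟩ := h.exists_slope_mul_weight_le hrate hrate1 hrate2
  have hM0 := hM.pos
  have hU' : ∀ y, deriv U y = profileField a g (U y) := fun y => (h.hasDerivAt_U y).deriv
  have hD : 0 < 12 * M ^ 9 * C1 + 1 := by positivity
  -- The factor `14 M⁷` comes from `abs_slope_sub_le`, and `C2` from the decay of the slope; the
  -- bound on `E` makes `12 M⁹ E C1 ≤ 1`, the `+ 1` covering `C1 = 0`.
  refine ⟨14 * M ^ 7 * C2, by positivity, 1 / (12 * M ^ 9 * C1 + 1), by positivity,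
    fun u₀ hu₀ hb hδ hδ' => ?_⟩
  obtain ⟨Mg, -, hMg⟩ := exists_bound_of_hasCompactSupport h.contDiff_g.continuous
    h.hasCompactSupport_g
  have hgL : LipschitzWith M.toNNReal g := lipschitzWith_of_nnnorm_deriv_le
    (h.contDiff_g.differentiable two_ne_zero) fun v => by
      rw [← NNReal.coe_le_coe, coe_nnnorm, Real.coe_toNNReal _ hM0.le]
      exact hM.abs_deriv_g v
  obtain ⟨Φ, hΦ⟩ := exists_isScalarFlow hgL hMg
  have hS : IsCharSystem a g Φ u₀ := ⟨h.contDiff_a.of_le (by norm_num),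
    h.contDiff_g.of_le (by norm_num), ⟨M, hM.abs_a⟩, ⟨M, hM.abs_deriv_a⟩, ⟨M, hM.abs_deriv_g⟩,
    hΦ, hu₀, hb⟩
  have small : ∀ E, 0 < E → E ≤ 1 / (12 * M ^ 9 * C1 + 1) →
      (∀ y, |u₀ y - U y| ≤ E * expWeight κ y) →
      (∀ y, |deriv u₀ y - deriv U y| ≤ E * expWeight κ y) → ∀ y,
      IsSmallAt a g U um s M u₀ y (E * expWeight κ y / (s * profileField a g (U y))) := by
    intro E hE hEδ h1 h2 y
    have hW := h.slope_pos' y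
    have hw := expWeight_pos κ y
    refine ⟨by positivity, ?_, ?_, ?_⟩
    · rw [div_mul_cancel₀ _ hW.ne']; exact h1 y
    · rw [div_mul_cancel₀ _ hW.ne', ← hU']; exact h2 y
    · have h3 : E * expWeight κ y / (s * profileField a g (U y)) * (s * U y - s * um) ≤ E * C1 := by
        rw [div_mul_eq_mul_div, div_le_iff₀ hW, mul_assoc, mul_assoc]
        exact mul_le_mul_of_nonneg_left (b1 y) hE.le
      rw [le_div_iff₀ hD] at hEδ
      have h4 : 12 * M ^ 9 * (E * expWeight κ y / (s * profileField a g (U y)) *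
          (s * U y - s * um)) ≤ 12 * M ^ 9 * (E * C1) := by gcongr
      linarith
  -- Small negative times are included because the solution later multiplies test functions that
  -- must be `C¹` across `t = 0`.
  obtain ⟨ε, hε, hJ⟩ := hS.exists_half_le_charJac
  have hJpos : ∀ t, -ε < t → ∀ y, 0 < charJac a g Φ u₀ t y := fun t ht y => by
    rcases le_total 0 t with h0 | h0
    · exact lt_of_lt_of_le (by positivity)
        ((small _ (by positivity) le_rfl hδ hδ' y).le_charJac hS h hM h0)
    · exact lt_of_lt_of_le (by norm_num)
        (hJ t (by rw [abs_of_nonpos h0]; linarith) y)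
  obtain ⟨u, hu0, huC, hu⟩ := hS.exists_classicalSolution hε hJpos
  refine ⟨u, ε, hε, hu0, huC, fun t ht x => ?_, ?_⟩
  · obtain ⟨y, -, -, -, h4⟩ := hu t (by linarith) x
    exact h4
  have pos : ∀ E, 0 < E → E ≤ 1 / (12 * M ^ 9 * C1 + 1) →
      (∀ y, |u₀ y - U y| ≤ E * expWeight κ y) →
      (∀ y, |deriv u₀ y - deriv U y| ≤ E * expWeight κ y) → ∀ t, 0 ≤ t → ∀ x,
      |u t x - U x| ≤ 14 * M ^ 7 * C2 * E * Real.exp (-t * rate) * expWeight κ x ∧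
      |deriv (u t) x - deriv U x| ≤ 14 * M ^ 7 * C2 * E * Real.exp (-t * rate) * expWeight κ x := by
    intro E hE hEδ h1 h2 t ht x
    obtain ⟨y, rfl, h4, h5, -⟩ := hu t (by linarith) x
    have sm := small E hE hEδ h1 h2 y
    set X := charPos a Φ u₀ t y with hX
    have hXy : X ≤ y := by
      have : 0 ≤ ∫ r in (0 : ℝ)..t, -a (Φ r (u₀ y)) :=
        intervalIntegral.integral_nonneg ht fun r _ => (neg_pos.2 (h.a_neg _)).le
      rw [intervalIntegral.integral_neg] at this
      rw [hX, charPos]; linarith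
    have hW := h.slope_pos' y
    have key : E * expWeight κ y / (s * profileField a g (U y)) * (s * profileField a g (U X)) ≤
        C2 * E * Real.exp (-t * rate) * expWeight κ X := by
      rw [div_mul_eq_mul_div, div_le_iff₀ hW]
      have := mul_le_mul_of_nonneg_left (b2 t X y hXy
        (abs_le.1 (sm.abs_travelTime_sub_le hS h hM ht)).2) hE.le
      linarith
    have hM7 : 1 ≤ M ^ 7 := one_le_pow₀ hM.one_le
    have hWX := h.slope_pos' X
    have hη := sm.pos
    have key2 := mul_le_mul_of_nonneg_left key (show 0 ≤ 14 * M ^ 7 by positivity)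
    constructor
    · rw [h4]
      refine (sm.abs_perturbation_le hS h hM ht).trans (le_trans ?_ (key2.trans (le_of_eq (by ring))))
      rw [mul_assoc]
      gcongr
      linarith
    · rw [h5.deriv, hU']
      refine (sm.abs_slope_sub_le hS h hM ht).trans (le_of_eq_of_le (by ring)
        (key2.trans (le_of_eq (by ring))))
  intro E hE hEδ h1 h2 t ht x
  rcases hE.eq_or_lt with rfl | hE'
  -- `IsSmallAt` requires a positive `η`, so `E = 0` is reached as a limit of positive values.
  · have hall : ∀ E' : ℝ, E' ∈ Ioc 0 (1 / (12 * M ^ 9 * C1 + 1)) →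
        |u t x - U x| ≤ 14 * M ^ 7 * C2 * E' * Real.exp (-t * rate) * expWeight κ x ∧
        |deriv (u t) x - deriv U x| ≤ 14 * M ^ 7 * C2 * E' * Real.exp (-t * rate) * expWeight κ x :=
      fun E' hE' => by
        have hle : ∀ y, 0 * expWeight κ y ≤ E' * expWeight κ y := fun y =>
          mul_le_mul_of_nonneg_right hE'.1.le (expWeight_pos κ y).le
        exact pos E' hE'.1 hE'.2 (fun y => (h1 y).trans (hle y)) (fun y => (h2 y).trans (hle y)) t ht x
    have hlim : Tendsto (fun E' : ℝ => 14 * M ^ 7 * C2 * E' * Real.exp (-t * rate) * expWeight κ x)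
        (𝓝[>] 0) (𝓝 (14 * M ^ 7 * C2 * 0 * Real.exp (-t * rate) * expWeight κ x)) :=
      (Continuous.tendsto (by fun_prop) 0).mono_left nhdsWithin_le_nhds
    have hev := Ioc_mem_nhdsGT (show (0 : ℝ) < 1 / (12 * M ^ 9 * C1 + 1) by positivity)
    exact ⟨ge_of_tendsto hlim (mem_of_superset hev fun E' hE' => (hall E' hE').1),
      ge_of_tendsto hlim (mem_of_superset hev fun E' hE' => (hall E' hE').2)⟩
  · exact pos E hE' hEδ h1 h2 t ht x

end IsFrontSystem

/-! ### Weak-strong uniqueness for scalar balance laws -/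

/-- The divergence theorem on a half-strip, for fields that vanish at the final time and far away. -/
theorem integral_divergence_strip {ε T R : ℝ} (hε : 0 < ε) (hT : 0 < T) {Ψ₁ Ψ₂ : ℝ × ℝ → ℝ}
    (h₁ : ContDiffOn ℝ 1 Ψ₁ (Ioi (-ε) ×ˢ univ)) (h₂ : ContDiffOn ℝ 1 Ψ₂ (Ioi (-ε) ×ˢ univ))
    (v₁ : ∀ p : ℝ × ℝ, (T ≤ p.1 ∨ R ≤ |p.2|) → Ψ₁ p = 0)
    (v₂ : ∀ p : ℝ × ℝ, (T ≤ p.1 ∨ R ≤ |p.2|) → Ψ₂ p = 0) :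
    ∫ p in Ioo 0 T ×ˢ univ, (fderiv ℝ Ψ₁ p (1, 0) + fderiv ℝ Ψ₂ p (0, 1)) =
      -∫ x, Ψ₁ (0, x) := by
  set R' := max R 0 with hR'
  have hR0 : 0 ≤ R' := le_max_right _ _
  have hRR : R ≤ R' := le_max_left _ _
  have hopen : IsOpen (Ioi (-ε) ×ˢ (univ : Set ℝ)) := isOpen_Ioi.prod isOpen_univ
  have hsub : Icc 0 T ×ˢ Icc (-R') R' ⊆ Ioi (-ε) ×ˢ (univ : Set ℝ) := fun p hp =>
    ⟨lt_of_lt_of_le (neg_lt_zero.2 hε) hp.1.1, trivial⟩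
  have hc : ContinuousOn (fun p => fderiv ℝ Ψ₁ p (1, 0) + fderiv ℝ Ψ₂ p (0, 1))
      (Icc 0 T ×ˢ Icc (-R') R') :=
    (((h₁.continuousOn_fderiv_of_isOpen hopen le_rfl).clm_apply continuousOn_const).add
      ((h₂.continuousOn_fderiv_of_isOpen hopen le_rfl).clm_apply continuousOn_const)).mono hsub
  have hint : IntegrableOn (fun p => fderiv ℝ Ψ₁ p (1, 0) + fderiv ℝ Ψ₂ p (0, 1))
      (Icc 0 T ×ˢ Icc (-R') R') := hc.integrableOn_compact (isCompact_Icc.prod isCompact_Icc)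
  have far : ∀ Ψ : ℝ × ℝ → ℝ, (∀ p : ℝ × ℝ, (T ≤ p.1 ∨ R ≤ |p.2|) → Ψ p = 0) →
      ∀ p : ℝ × ℝ, p.2 ∉ Icc (-R') R' → fderiv ℝ Ψ p = 0 := fun Ψ hΨ p hp => by
    have hp' : R < |p.2| := by
      rw [mem_Icc, ← abs_le, not_le] at hp
      exact lt_of_le_of_lt hRR hp
    have : Ψ =ᶠ[𝓝 p] fun _ => 0 := by
      filter_upwards [(isOpen_lt continuous_const continuous_snd.abs).mem_nhds hp'] with z hz
      exact hΨ z (Or.inr (le_of_lt hz))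
    rw [this.fderiv_eq]
    simp
  have e1 : ∫ p in Ioo 0 T ×ˢ univ, (fderiv ℝ Ψ₁ p (1, 0) + fderiv ℝ Ψ₂ p (0, 1)) =
      ∫ p in Ioo 0 T ×ˢ Icc (-R') R', (fderiv ℝ Ψ₁ p (1, 0) + fderiv ℝ Ψ₂ p (0, 1)) := by
    refine setIntegral_eq_of_subset_of_forall_sdiff_eq_zero
      (measurableSet_Ioo.prod MeasurableSet.univ) (prod_mono_right (subset_univ _)) fun p hp => ?_
    have hp2 : p.2 ∉ Icc (-R') R' := fun hh => hp.2 ⟨hp.1.1, hh⟩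
    rw [far Ψ₁ v₁ p hp2, far Ψ₂ v₂ p hp2]
    simp
  rw [e1, Measure.volume_eq_prod, setIntegral_prod _
    (by rw [← Measure.volume_eq_prod]; exact hint.mono_set (prod_mono_left Ioo_subset_Icc_self))]
  have e2 : ∀ k : ℝ → ℝ, ∫ t in Ioo 0 T, k t = ∫ t in (0 : ℝ)..T, k t := fun k => by
    rw [intervalIntegral.integral_of_le hT.le, integral_Ioc_eq_integral_Ioo]
  have e3 : ∀ k : ℝ → ℝ, ∫ x in Icc (-R') R', k x = ∫ x in (-R')..R', k x := fun k => by
    rw [intervalIntegral.integral_of_le (by linarith), integral_Icc_eq_integral_Ioc]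
  simp only [e2, e3]
  have hd : ∀ Ψ : ℝ × ℝ → ℝ, ContDiffOn ℝ 1 Ψ (Ioi (-ε) ×ˢ univ) →
      ∀ p ∈ Icc 0 T ×ˢ Icc (-R') R', HasFDerivAt Ψ (fderiv ℝ Ψ p) p := fun Ψ hΨ p hp =>
    ((hΨ.contDiffAt (hopen.mem_nhds (hsub hp))).differentiableAt one_ne_zero).hasFDerivAt
  have hR2 : -R' ≤ R' := by linarith
  have hoo : Ioo (min 0 T) (max 0 T) ×ˢ Ioo (min (-R') R') (max (-R') R') ⊆
      Icc 0 T ×ˢ Icc (-R') R' := by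
    rw [min_eq_left hT.le, max_eq_right hT.le, min_eq_left hR2, max_eq_right hR2]
    exact prod_mono Ioo_subset_Icc_self Ioo_subset_Icc_self
  rw [integral2_divergence_prod_of_hasFDerivAt Ψ₁ Ψ₂ (fderiv ℝ Ψ₁) (fderiv ℝ Ψ₂) 0 (-R') T R'
    (by rw [uIcc_of_le hT.le, uIcc_of_le hR2]; exact h₁.continuousOn.mono hsub)
    (by rw [uIcc_of_le hT.le, uIcc_of_le hR2]; exact h₂.continuousOn.mono hsub)
    (fun p hp => hd Ψ₁ h₁ p (hoo hp)) (fun p hp => hd Ψ₂ h₂ p (hoo hp))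
    (by rw [uIcc_of_le hT.le, uIcc_of_le hR2]; exact hint)]
  have z1 : ∀ t, Ψ₂ (t, R') = 0 := fun t => v₂ _ (Or.inr (hRR.trans (le_abs_self _)))
  have z2 : ∀ t, Ψ₂ (t, -R') = 0 := fun t => v₂ _ (Or.inr (by
    change R ≤ |-R'|; rw [abs_neg]; exact hRR.trans (le_abs_self _)))
  have z3 : ∀ x, Ψ₁ (T, x) = 0 := fun x => v₁ _ (Or.inl le_rfl)
  simp only [z1, z2, z3, intervalIntegral.integral_zero, sub_self, zero_add, zero_sub, neg_inj]
  rw [← e3]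
  refine setIntegral_eq_integral_of_forall_compl_eq_zero fun x hx => v₁ _ (Or.inr ?_)
  rw [mem_Icc, ← abs_le, not_le] at hx
  exact (lt_of_le_of_lt hRR hx).le

/-- The integrand in the weak form of the entropy inequality. -/
noncomputable def entropyIntegrand (g η q : ℝ → ℝ) (v φ : ℝ × ℝ → ℝ) (p : ℝ × ℝ) : ℝ :=
  η (v p) * fderiv ℝ φ p (1, 0) + q (v p) * fderiv ℝ φ p (0, 1) +
    deriv η (v p) * g (v p) * φ p

/-- Classical solutions of `∂ₜ u + ∂ₓ (f u) = g u`, bounded with their slope on time strips. -/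
structure IsClassicalSolution (f g : ℝ → ℝ) (ε : ℝ) (u : ℝ → ℝ → ℝ) : Prop where
  pos : 0 < ε
  contDiffOn : ContDiffOn ℝ 1 (fun p : ℝ × ℝ => u p.1 p.2) (Ioi (-ε) ×ˢ univ)
  eq : ∀ t, 0 ≤ t → ∀ x,
    fderiv ℝ (fun p : ℝ × ℝ => u p.1 p.2) (t, x) (1, deriv f (u t x)) = g (u t x)
  bounded : ∀ T, ∃ N, ∀ t ∈ Icc 0 T, ∀ x, |u t x| ≤ N
  bounded_deriv : ∀ T, ∃ N, ∀ t ∈ Icc 0 T, ∀ x,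
    |fderiv ℝ (fun p : ℝ × ℝ => u p.1 p.2) (t, x) (0, 1)| ≤ N

theorem exists_vanishing_of_test {φ : ℝ × ℝ → ℝ} (hφc : HasCompactSupport φ) {T : ℝ}
    (hφT : tsupport φ ⊆ Iio T ×ˢ univ) :
    ∃ R : ℝ, ∀ p : ℝ × ℝ, (T ≤ p.1 ∨ R ≤ |p.2|) → φ p = 0 := by
  obtain ⟨R, hR⟩ := hφc.isBounded.subset_closedBall (0 : ℝ × ℝ)
  refine ⟨R + 1, fun p hp => image_eq_zero_of_notMem_tsupport fun hmem => ?_⟩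
  rcases hp with h | h
  · exact absurd (hφT hmem).1 (not_lt.2 h)
  · have h1 := hR hmem
    rw [mem_closedBall_zero_iff] at h1
    have h2 := norm_snd_le p
    rw [Real.norm_eq_abs] at h2
    linarith

theorem integrable_comp_mul_of_test {μ : Measure (ℝ × ℝ)} [IsFiniteMeasureOnCompacts μ]
    {v ψ : ℝ × ℝ → ℝ} {k : ℝ → ℝ}
    (hk : Continuous k) (hv : AEStronglyMeasurable v μ) {M : ℝ} (hM : ∀ᵐ p ∂μ, |v p| ≤ M)
    (hψ : Continuous ψ) (hψc : HasCompactSupport ψ) : Integrable (fun p => k (v p) * ψ p) μ := by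
  obtain ⟨C, hC⟩ := (isCompact_Icc (a := -M) (b := M)).exists_bound_of_continuousOn hk.continuousOn
  refine (hψ.integrable_of_hasCompactSupport hψc).bdd_mul (c := C)
    (hk.comp_aestronglyMeasurable hv) ?_
  filter_upwards [hM] with p hp using hC _ (abs_le.1 hp)

theorem continuous_fderiv_apply {φ : ℝ × ℝ → ℝ} (hφ : ContDiff ℝ 1 φ) (w : ℝ × ℝ) :
    Continuous fun p => fderiv ℝ φ p w :=
  (hφ.continuous_fderiv one_ne_zero).clm_apply continuous_const

theorem hasCompactSupport_fderiv_apply {φ : ℝ × ℝ → ℝ} (hφ : HasCompactSupport φ) (w : ℝ × ℝ) :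
    HasCompactSupport fun p => fderiv ℝ φ p w :=
  hφ.fderiv_apply ℝ w

theorem integrable_entropyIntegrand {μ : Measure (ℝ × ℝ)} [IsFiniteMeasureOnCompacts μ]
    {g η q : ℝ → ℝ} {v φ : ℝ × ℝ → ℝ}
    (hg : Continuous g) (hη : ContDiff ℝ 1 η) (hq : Continuous q)
    (hv : AEStronglyMeasurable v μ) {M : ℝ} (hM : ∀ᵐ p ∂μ, |v p| ≤ M)
    (hφ : ContDiff ℝ 1 φ) (hφc : HasCompactSupport φ) :
    Integrable (entropyIntegrand g η q v φ) μ :=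
  ((integrable_comp_mul_of_test hη.continuous hv hM (continuous_fderiv_apply hφ _)
      (hasCompactSupport_fderiv_apply hφc _)).add
    (integrable_comp_mul_of_test hq hv hM (continuous_fderiv_apply hφ _)
      (hasCompactSupport_fderiv_apply hφc _))).add
    (integrable_comp_mul_of_test (k := fun s => deriv η s * g s)
      ((hη.continuous_deriv le_rfl).mul hg) hv hM hφ.continuous hφc)

/-! ### Entropy identity for classical solutions -/

namespace IsClassicalSolution

variable {f g : ℝ → ℝ} {ε : ℝ} {u : ℝ → ℝ → ℝ}

theorem isOpen_domain (ε : ℝ) : IsOpen (Ioi (-ε) ×ˢ (univ : Set ℝ)) := isOpen_Ioi.prod isOpen_univ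

theorem differentiableAt (h : IsClassicalSolution f g ε u) {p : ℝ × ℝ} (hp : -ε < p.1) :
    DifferentiableAt ℝ (fun p : ℝ × ℝ => u p.1 p.2) p :=
  (h.contDiffOn.contDiffAt ((isOpen_domain ε).mem_nhds ⟨hp, trivial⟩)).differentiableAt one_ne_zero

theorem aestronglyMeasurable (h : IsClassicalSolution f g ε u) (T : ℝ) :
    AEStronglyMeasurable (fun p : ℝ × ℝ => u p.1 p.2) (volume.restrict (Ioo 0 T ×ˢ univ)) :=
  (h.contDiffOn.continuousOn.mono fun _ hp =>
    ⟨lt_trans (neg_lt_zero.2 h.pos) hp.1.1, trivial⟩).aestronglyMeasurable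
    (measurableSet_Ioo.prod MeasurableSet.univ)

theorem ae_bounded (h : IsClassicalSolution f g ε u) (T : ℝ) :
    ∃ M, ∀ᵐ p : ℝ × ℝ ∂(volume.restrict (Ioo 0 T ×ˢ univ)), |u p.1 p.2| ≤ M := by
  obtain ⟨N, hN⟩ := h.bounded T
  exact ⟨N, ae_restrict_of_forall_mem (measurableSet_Ioo.prod MeasurableSet.univ)
    fun p hp => hN _ (Ioo_subset_Icc_self hp.1) _⟩

/-- By the chain rule and the equation, the integrand is the space-time divergence of `(η(u) φ, q(u)
φ)`, which vanishes at time `T` and far away. -/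
theorem entropy_eq (h : IsClassicalSolution f g ε u) (hf : Continuous (deriv f)) {T : ℝ}
    (hT : 0 < T) {η q : ℝ → ℝ} (hη : ContDiff ℝ 1 η)
    (hq : ∀ v, HasDerivAt q (deriv η v * deriv f v) v) {φ : ℝ × ℝ → ℝ} (hφ : ContDiff ℝ 1 φ)
    (hφc : HasCompactSupport φ) (hφT : tsupport φ ⊆ Iio T ×ˢ univ) :
    (∫ p in Ioo 0 T ×ˢ univ, entropyIntegrand g η q (fun p => u p.1 p.2) φ p) +
      ∫ x, η (u 0 x) * φ (0, x) = 0 := by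
  obtain ⟨R, hR⟩ := exists_vanishing_of_test hφc hφT
  have hqC : ContDiff ℝ 1 q := contDiff_one_iff_deriv.2
    ⟨fun v => (hq v).differentiableAt, by
      rw [show deriv q = fun v => deriv η v * deriv f v from funext fun v => (hq v).deriv]
      exact (hη.continuous_deriv le_rfl).mul hf⟩
  have key := integral_divergence_strip h.pos hT (R := R)
    (Ψ₁ := fun p => η (u p.1 p.2) * φ p) (Ψ₂ := fun p => q (u p.1 p.2) * φ p)
    ((hη.comp_contDiffOn h.contDiffOn).mul hφ.contDiffOn)
    ((hqC.comp_contDiffOn h.contDiffOn).mul hφ.contDiffOn)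
    (fun p hp => by rw [hR p hp, mul_zero]) (fun p hp => by rw [hR p hp, mul_zero])
  rw [← neg_eq_iff_eq_neg] at key
  rw [← key, ← sub_eq_add_neg, sub_eq_zero]
  refine setIntegral_congr_fun (measurableSet_Ioo.prod MeasurableSet.univ) fun p hp => ?_
  have hp1 : -ε < p.1 := lt_trans (neg_lt_zero.2 h.pos) hp.1.1
  have hu := (h.differentiableAt hp1).hasFDerivAt
  have hφd := (hφ.differentiable one_ne_zero p).hasFDerivAt
  have d1 := (((hη.differentiable one_ne_zero _).hasDerivAt.comp_hasFDerivAt p hu).mul hφd).fderiv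
  have d2 := (((hq (u p.1 p.2)).comp_hasFDerivAt p hu).mul hφd).fderiv
  have he := h.eq p.1 hp.1.1.le p.2
  have hsplit : ((1 : ℝ), deriv f (u p.1 p.2)) = (1, 0) + deriv f (u p.1 p.2) • ((0 : ℝ), (1 : ℝ)) := by
    simp
  rw [hsplit, map_add, map_smul, smul_eq_mul] at he
  simp only [entropyIntegrand]
  erw [d1, d2]
  simp only [add_apply, smul_apply, smul_eq_mul,
    Function.comp]
  linear_combination (-(φ p) * deriv η (u p.1 p.2)) * he

theorem isEntropySolution (h : IsClassicalSolution f g ε u) (hf : Continuous (deriv f)) {T : ℝ}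
    (hT : 0 < T) : IsEntropySolution f g (u 0) T u where
  aestronglyMeasurable := h.aestronglyMeasurable T
  bounded := h.ae_bounded T
  entropy_ineq η q hη _ hq φ hφ hφc hφT _ :=
    (h.entropy_eq hf hT (hη.of_le (by norm_num)) hq hφ hφc hφT).ge

/-- Comparison of an entropy solution and a classical solution with the same initial datum. -/
theorem integral_sub_nonneg (h : IsClassicalSolution f g ε u) (hf : Continuous (deriv f))
    (hg : Continuous g) {T : ℝ} (hT : 0 < T) {w : ℝ → ℝ → ℝ} (hw : IsEntropySolution f g (u 0) T w)
    {η q : ℝ → ℝ} (hη : ContDiff ℝ 2 η) (hηc : ConvexOn ℝ univ η)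
    (hq : ∀ v, HasDerivAt q (deriv η v * deriv f v) v) {φ : ℝ × ℝ → ℝ} (hφ : ContDiff ℝ 1 φ)
    (hφc : HasCompactSupport φ) (hφT : tsupport φ ⊆ Iio T ×ˢ univ) (hφ0 : ∀ p, 0 ≤ φ p) :
    Integrable (fun p => entropyIntegrand g η q (fun p => w p.1 p.2) φ p -
        entropyIntegrand g η q (fun p => u p.1 p.2) φ p) (volume.restrict (Ioo 0 T ×ˢ univ)) ∧
    0 ≤ ∫ p in Ioo 0 T ×ˢ univ, (entropyIntegrand g η q (fun p => w p.1 p.2) φ p -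
        entropyIntegrand g η q (fun p => u p.1 p.2) φ p) := by
  have hη1 : ContDiff ℝ 1 η := hη.of_le (by norm_num)
  have hqc : Continuous q := continuous_iff_continuousAt.2 fun v => (hq v).continuousAt
  obtain ⟨M, hM⟩ := hw.bounded
  obtain ⟨N, hN⟩ := h.ae_bounded T
  have i1 := integrable_entropyIntegrand hg hη1 hqc hw.aestronglyMeasurable hM hφ hφc
  have i2 := integrable_entropyIntegrand hg hη1 hqc (h.aestronglyMeasurable T) hN hφ hφc
  refine ⟨i1.sub i2, ?_⟩
  rw [integral_sub i1 i2]
  have e1 := hw.entropy_ineq η q hη hηc hq φ hφ hφc hφT hφ0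
  have e2 := h.entropy_eq hf hT hη1 hq hφ hφc hφT
  change 0 ≤ (∫ p in Ioo 0 T ×ˢ univ, entropyIntegrand g η q (fun p => w p.1 p.2) φ p) + _ at e1
  linarith

end IsClassicalSolution

/-- A nonnegative test function on a time strip that is strictly dissipated by transport at speed at
most `1 / δ`. -/
noncomputable def dissipatedTest (ε T δ K : ℝ) (p : ℝ × ℝ) : ℝ :=
  Real.smoothTransition (1 + 2 * p.1 / ε) *
    (Real.exp (-K * p.1) * expNegInvGlue (T - p.1 - δ * √(1 + p.2 ^ 2)))

/-! ### Regularity, support and dissipation of the test function -/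

section dissipatedTest

variable {ε T δ K : ℝ}

theorem contDiff_dissipatedTest_core :
    ContDiff ℝ 1 fun p : ℝ × ℝ =>
      Real.exp (-K * p.1) * expNegInvGlue (T - p.1 - δ * √(1 + p.2 ^ 2)) := by
  have h1 : ContDiff ℝ 1 fun p : ℝ × ℝ => √(1 + p.2 ^ 2) :=
    ContDiff.sqrt (contDiff_const.add (contDiff_snd.pow 2)) fun p => by positivity
  have h2 : ContDiff ℝ 1 fun p : ℝ × ℝ => T - p.1 - δ * √(1 + p.2 ^ 2) :=
    (contDiff_const.sub contDiff_fst).sub (contDiff_const.mul h1)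
  have h3 : ContDiff ℝ 1 fun p : ℝ × ℝ => -K * p.1 := contDiff_const.mul contDiff_fst
  have h4 : ContDiff ℝ 1 expNegInvGlue := expNegInvGlue.contDiff (n := 1)
  exact h3.exp.mul (h4.comp h2)

theorem contDiff_dissipatedTest : ContDiff ℝ 1 (dissipatedTest ε T δ K) := by
  have h1 : ContDiff ℝ 1 Real.smoothTransition := Real.smoothTransition.contDiff (n := 1)
  have h2 : ContDiff ℝ 1 fun p : ℝ × ℝ => 1 + 2 * p.1 / ε :=
    contDiff_const.add ((contDiff_const.mul contDiff_fst).div_const ε)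
  exact (h1.comp h2).mul contDiff_dissipatedTest_core

theorem dissipatedTest_nonneg (p : ℝ × ℝ) : 0 ≤ dissipatedTest ε T δ K p :=
  mul_nonneg (Real.smoothTransition.nonneg _) (mul_nonneg (Real.exp_pos _).le
    (expNegInvGlue.nonneg _))

theorem dissipatedTest_of_nonneg (hε : 0 < ε) {p : ℝ × ℝ} (hp : 0 ≤ p.1) :
    dissipatedTest ε T δ K p =
      Real.exp (-K * p.1) * expNegInvGlue (T - p.1 - δ * √(1 + p.2 ^ 2)) := by
  have : 0 ≤ 2 * p.1 / ε := by positivity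
  rw [dissipatedTest, Real.smoothTransition.one_of_one_le (by linarith), one_mul]

theorem tsupport_dissipatedTest_subset (hε : 0 < ε) (hδ : 0 < δ) :
    tsupport (dissipatedTest ε T δ K) ⊆
      Icc (-(ε / 2)) (T - δ) ×ˢ Icc (-((T + ε) / δ)) ((T + ε) / δ) := by
  refine closure_minimal (fun p hp => ?_) (isClosed_Icc.prod isClosed_Icc)
  have h1 : Real.smoothTransition (1 + 2 * p.1 / ε) ≠ 0 := left_ne_zero_of_mul hp
  have h2 : expNegInvGlue (T - p.1 - δ * √(1 + p.2 ^ 2)) ≠ 0 :=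
    right_ne_zero_of_mul (right_ne_zero_of_mul hp)
  rw [Ne, Real.smoothTransition.zero_iff_nonpos, not_le] at h1
  rw [Ne, expNegInvGlue.zero_iff_nonpos, not_le] at h2
  have h3 : -(ε / 2) ≤ p.1 := by
    have : -1 < 2 * p.1 / ε := by linarith
    rw [lt_div_iff₀ hε] at this
    linarith
  have h4 : 1 ≤ √(1 + p.2 ^ 2) := Real.one_le_sqrt.2 (by nlinarith [sq_nonneg p.2])
  have h5 : |p.2| ≤ √(1 + p.2 ^ 2) := Real.abs_le_sqrt (by linarith)
  have h6 : |p.2| ≤ (T + ε) / δ := by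
    rw [le_div_iff₀ hδ]
    nlinarith
  exact ⟨⟨h3, by nlinarith⟩, abs_le.1 h6⟩

theorem hasCompactSupport_dissipatedTest (hε : 0 < ε) (hδ : 0 < δ) :
    HasCompactSupport (dissipatedTest ε T δ K) :=
  (isCompact_Icc.prod isCompact_Icc).of_isClosed_subset (isClosed_tsupport _)
    (tsupport_dissipatedTest_subset hε hδ)

/-- The factor `exp(-(C + 1) t)` produces the zeroth order terms. As `√(1 + x²)` has slope at most
`1` and `L δ ≤ 1`, the time derivative of the cutoff absorbs `L |∂ₓ φ|`. -/
theorem dissipatedTest_ineq (hε : 0 < ε) (hδ : 0 < δ) {L C : ℝ} (hL : 0 ≤ L) (hLδ : L * δ ≤ 1)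
    {p : ℝ × ℝ} (hp : 0 < p.1) :
    fderiv ℝ (dissipatedTest ε T δ (C + 1)) p (1, 0) +
      L * |fderiv ℝ (dissipatedTest ε T δ (C + 1)) p (0, 1)| + C * dissipatedTest ε T δ (C + 1) p ≤
      -dissipatedTest ε T δ (C + 1) p := by
  set K := C + 1 with hK
  set G : ℝ × ℝ → ℝ := fun p =>
    Real.exp (-K * p.1) * expNegInvGlue (T - p.1 - δ * √(1 + p.2 ^ 2)) with hG
  have heq : dissipatedTest ε T δ K =ᶠ[𝓝 p] G := by
    filter_upwards [(isOpen_lt continuous_const continuous_fst).mem_nhds hp] with z hz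
    exact dissipatedTest_of_nonneg hε (le_of_lt hz)
  rw [heq.fderiv_eq, dissipatedTest_of_nonneg hε hp.le]
  have hGd : HasFDerivAt G (fderiv ℝ G p) p :=
    (contDiff_dissipatedTest_core.differentiable one_ne_zero p).hasFDerivAt
  set r := T - p.1 - δ * √(1 + p.2 ^ 2) with hr
  have he : HasDerivAt expNegInvGlue (deriv expNegInvGlue r) r :=
    ((expNegInvGlue.contDiff (n := 1)).differentiable one_ne_zero r).hasDerivAt
  have he0 : 0 ≤ deriv expNegInvGlue r := expNegInvGlue.monotone.deriv_nonneg
  have hsq : 0 < 1 + p.2 ^ 2 := by positivity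
  have d1 : fderiv ℝ G p (1, 0) = Real.exp (-K * p.1) * (-K) * expNegInvGlue r +
      Real.exp (-K * p.1) * (deriv expNegInvGlue r * (-1)) := by
    have h1 : HasDerivAt (fun t => G (t, p.2)) (fderiv ℝ G p (1, 0)) p.1 :=
      HasFDerivAt.comp_hasDerivAt (f := fun t => (t, p.2)) p.1 hGd
        ((hasDerivAt_id p.1).prodMk (hasDerivAt_const p.1 p.2))
    have h2 : HasDerivAt (fun t => -K * t) (-K) p.1 := by
      simpa using (hasDerivAt_id p.1).const_mul (-K)
    have h3 : HasDerivAt (fun t => T - t - δ * √(1 + p.2 ^ 2)) (-1) p.1 :=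
      ((hasDerivAt_id p.1).const_sub T).sub_const _
    have h4 : HasDerivAt (fun t => expNegInvGlue (T - t - δ * √(1 + p.2 ^ 2)))
        (deriv expNegInvGlue r * (-1)) p.1 :=
      HasDerivAt.comp (h₂ := expNegInvGlue) (h := fun t => T - t - δ * √(1 + p.2 ^ 2)) p.1 he h3
    exact h1.unique (h2.exp.mul h4)
  have d2 : fderiv ℝ G p (0, 1) = Real.exp (-K * p.1) *
      (deriv expNegInvGlue r * (-(δ * (2 * p.2 / (2 * √(1 + p.2 ^ 2)))))) := by
    have h1 : HasDerivAt (fun x => G (p.1, x)) (fderiv ℝ G p (0, 1)) p.2 :=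
      HasFDerivAt.comp_hasDerivAt (f := fun x => (p.1, x)) p.2 hGd
        ((hasDerivAt_const p.2 p.1).prodMk (hasDerivAt_id p.2))
    have h2 : HasDerivAt (fun x : ℝ => 1 + x ^ 2) (2 * p.2) p.2 := by
      simpa using (hasDerivAt_pow 2 p.2).const_add 1
    have h3 : HasDerivAt (fun x => T - p.1 - δ * √(1 + x ^ 2))
        (-(δ * (2 * p.2 / (2 * √(1 + p.2 ^ 2))))) p.2 :=
      ((h2.sqrt hsq.ne').const_mul δ).const_sub _
    have h4 : HasDerivAt (fun x => expNegInvGlue (T - p.1 - δ * √(1 + x ^ 2)))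
        (deriv expNegInvGlue r * (-(δ * (2 * p.2 / (2 * √(1 + p.2 ^ 2)))))) p.2 :=
      HasDerivAt.comp (h₂ := expNegInvGlue) (h := fun x => T - p.1 - δ * √(1 + x ^ 2)) p.2 he h3
    exact h1.unique (h4.const_mul (Real.exp (-K * p.1)))
  have hx : |2 * p.2 / (2 * √(1 + p.2 ^ 2))| ≤ 1 := by
    rw [mul_div_mul_left _ _ (two_ne_zero), abs_div, abs_of_nonneg (Real.sqrt_nonneg _),
      div_le_one (Real.sqrt_pos.2 hsq)]
    exact Real.abs_le_sqrt (by linarith)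
  have hE := Real.exp_pos (-K * p.1)
  have b2 : |fderiv ℝ G p (0, 1)| ≤ Real.exp (-K * p.1) * (deriv expNegInvGlue r * δ) := by
    rw [d2, abs_mul, abs_mul, abs_neg, abs_mul, abs_of_pos hE, abs_of_nonneg he0, abs_of_pos hδ]
    have : δ * |2 * p.2 / (2 * √(1 + p.2 ^ 2))| ≤ δ * 1 := by gcongr
    rw [mul_one] at this
    gcongr
  have b3 : L * |fderiv ℝ G p (0, 1)| ≤ Real.exp (-K * p.1) * deriv expNegInvGlue r := by
    calc _ ≤ L * (Real.exp (-K * p.1) * (deriv expNegInvGlue r * δ)) := by gcongr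
      _ = Real.exp (-K * p.1) * deriv expNegInvGlue r * (L * δ) := by ring
      _ ≤ Real.exp (-K * p.1) * deriv expNegInvGlue r * 1 := by gcongr
      _ = _ := mul_one _
  rw [d1]
  have hKe : Real.exp (-K * p.1) * (-K) * expNegInvGlue r =
      -(C * (Real.exp (-K * p.1) * expNegInvGlue r)) - Real.exp (-K * p.1) * expNegInvGlue r := by
    rw [hK]; ring
  linarith

end dissipatedTest

theorem abs_sub_le_mul_sq {k k' : ℝ → ℝ} (hk : ∀ z, HasDerivAt k (k' z) z) {C : ℝ} (hC0 : 0 ≤ C)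
    {u w : ℝ} (hC : ∀ z ∈ uIcc u w, |k' z| ≤ C * |z - u|) : |k w - k u| ≤ C * |w - u| ^ 2 := by
  have := (convex_uIcc u w).norm_image_sub_le_of_norm_hasDerivWithin_le (C := C * |w - u|)
    (fun z _ => (hk z).hasDerivWithinAt) (fun z hz => (hC z hz).trans
      (mul_le_mul_of_nonneg_left (abs_sub_left_of_mem_uIcc hz) hC0))
    left_mem_uIcc right_mem_uIcc
  rw [sq, ← mul_assoc]
  exact this

/-! ### Relative entropy -/

namespace IsClassicalSolution

variable {f g : ℝ → ℝ} {ε : ℝ} {u : ℝ → ℝ → ℝ}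

/-- The relative entropy inequality, against a test function supported where the classical
solution is smooth. -/
theorem integral_relativeEntropy_nonneg (h : IsClassicalSolution f g ε u) (hf : ContDiff ℝ 1 f)
    (hg : Continuous g) {T : ℝ} (hT : 0 < T) {w : ℝ → ℝ → ℝ} (hw : IsEntropySolution f g (u 0) T w)
    {q : ℝ → ℝ} (hq : ∀ v, HasDerivAt q (v * deriv f v) v)
    {φ : ℝ × ℝ → ℝ} (hφ : ContDiff ℝ 1 φ)
    (hφc : HasCompactSupport φ) (hφT : tsupport φ ⊆ Iio T ×ˢ univ)
    (hφε : tsupport φ ⊆ Ioi (-ε) ×ˢ univ) (hφ0 : ∀ p, 0 ≤ φ p) :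
    ∃ Z : ℝ × ℝ → ℝ, Integrable Z (volume.restrict (Ioo 0 T ×ˢ univ)) ∧
      0 ≤ ∫ p in Ioo 0 T ×ˢ univ, Z p ∧ ∀ p ∈ Ioo 0 T ×ˢ (univ : Set ℝ), Z p =
        (w p.1 p.2 - u p.1 p.2) ^ 2 / 2 * fderiv ℝ φ p (1, 0) +
        (q (w p.1 p.2) - q (u p.1 p.2) - u p.1 p.2 * (f (w p.1 p.2) - f (u p.1 p.2))) *
          fderiv ℝ φ p (0, 1) +
        ((w p.1 p.2 - u p.1 p.2) * (g (w p.1 p.2) - g (u p.1 p.2)) -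
          (f (w p.1 p.2) - f (u p.1 p.2) - deriv f (u p.1 p.2) * (w p.1 p.2 - u p.1 p.2)) *
            fderiv ℝ (fun p : ℝ × ℝ => u p.1 p.2) p (0, 1)) * φ p := by
  have hf' : Continuous (deriv f) := hf.continuous_deriv le_rfl
  have hfd : ∀ v, HasDerivAt f (deriv f v) v := fun v =>
    (hf.differentiable one_ne_zero v).hasDerivAt
  obtain ⟨N, hN⟩ := hφc.isCompact.exists_bound_of_continuousOn (f := fun p : ℝ × ℝ => u p.1 p.2)
    (h.contDiffOn.continuousOn.mono hφε)
  set N' := max N 0 with hN'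
  have hN0 : 0 ≤ N' := le_max_right _ _
  -- the three entropies and test functions
  have d2 : ∀ v : ℝ, HasDerivAt (fun v : ℝ => v ^ 2 / 2) v v := fun v => by
    have := (hasDerivAt_pow 2 v).div_const 2
    simpa using this
  have e2 : deriv (fun v : ℝ => v ^ 2 / 2) = fun v => v := funext fun v => (d2 v).deriv
  have conv2 : ConvexOn ℝ univ (fun v : ℝ => v ^ 2 / 2) := by
    have := (even_two.convexOn_pow (𝕜 := ℝ)).smul (c := (1 / 2 : ℝ)) (by norm_num)
    convert! this using 2
    simp only [smul_eq_mul]; ring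
  have q2 : ∀ v, HasDerivAt q (deriv (fun v : ℝ => v ^ 2 / 2) v * deriv f v) v := fun v => by
    rw [e2]; exact hq v
  obtain ⟨i1, n1⟩ := h.integral_sub_nonneg hf' hg hT hw (η := fun v => v ^ 2 / 2)
    ((contDiff_id.pow 2).div_const 2) conv2 q2 hφ hφc hφT hφ0
  have eid : deriv (fun v : ℝ => v) = fun _ => 1 := funext fun v => (hasDerivAt_id v).deriv
  have eneg : deriv (fun v : ℝ => -v) = fun _ => -1 := funext fun v => (hasDerivAt_neg v).deriv
  -- The relative entropy `w²/2 - u²/2 - u (w - u)` calls for the entropy `v` tested with `-u φ`,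
  -- which has no sign. It is split into `v` tested with `(N' - u) φ` and `-v` tested with `N' φ`,
  -- both nonnegative as `N'` bounds `u` on the support of `φ`.
  set ψ : ℝ × ℝ → ℝ := fun p => (N' - u p.1 p.2) * φ p with hψ
  have hψC : ContDiff ℝ 1 ψ := by
    refine contDiff_iff_contDiffAt.2 fun p => ?_
    by_cases hp : p ∈ tsupport φ
    · exact (contDiffAt_const.sub
        (h.contDiffOn.contDiffAt ((isOpen_domain ε).mem_nhds (hφε hp)))).mul hφ.contDiffAt
    · refine (contDiffAt_const (c := (0 : ℝ))).congr_of_eventuallyEq ?_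
      filter_upwards [notMem_tsupport_iff_eventuallyEq.1 hp] with z hz
      simp [hψ, hz]
  have hψT : tsupport ψ ⊆ Iio T ×ˢ univ :=
    (closure_mono (Function.support_mul_subset_right _ _)).trans hφT
  have hψ0 : ∀ p, 0 ≤ ψ p := fun p => by
    by_cases hp : p ∈ tsupport φ
    · refine mul_nonneg ?_ (hφ0 p)
      have := (le_abs_self _).trans (hN p hp)
      linarith [le_max_left N 0]
    · simp only [hψ]
      rw [image_eq_zero_of_notMem_tsupport hp, mul_zero]
  obtain ⟨i2, n2⟩ := h.integral_sub_nonneg hf' hg hT hw (η := fun v => v) (q := f)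
    contDiff_id (convexOn_id convex_univ) (fun v => by rw [eid, one_mul]; exact hfd v)
    hψC hφc.mul_left hψT hψ0
  obtain ⟨i3, n3⟩ := h.integral_sub_nonneg hf' hg hT hw (η := fun v => -v) (q := fun v => -f v)
    contDiff_neg (concaveOn_id convex_univ).neg
    (fun v => by rw [eneg, neg_one_mul]; exact (hfd v).neg)
    (φ := fun p => N' * φ p) (contDiff_const.mul hφ) hφc.mul_left
    ((closure_mono (Function.support_mul_subset_right _ _)).trans hφT)
    (fun p => mul_nonneg hN0 (hφ0 p))
  refine ⟨_, (i1.add i2).add i3, ?_, fun p hp => ?_⟩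
  · have e : ∀ a b c : ℝ × ℝ → ℝ, Integrable a (volume.restrict (Ioo 0 T ×ˢ univ)) →
        Integrable b (volume.restrict (Ioo 0 T ×ˢ univ)) →
        Integrable c (volume.restrict (Ioo 0 T ×ˢ univ)) →
        ∫ p in Ioo 0 T ×ˢ univ, (a + b + c) p = (∫ p in Ioo 0 T ×ˢ univ, a p) +
          (∫ p in Ioo 0 T ×ˢ univ, b p) + ∫ p in Ioo 0 T ×ˢ univ, c p := fun a b c ha hb hc => by
      rw [← integral_add' ha hb, ← integral_add' (ha.add hb) hc]
    rw [e _ _ _ i1 i2 i3]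
    linarith
  · have hp1 : -ε < p.1 := lt_trans (neg_lt_zero.2 h.pos) hp.1.1
    have hu := (h.differentiableAt hp1).hasFDerivAt
    have hφd := (hφ.differentiable one_ne_zero p).hasFDerivAt
    have f2 : fderiv ℝ ψ p = _ := ((hu.const_sub N').mul hφd).fderiv
    have f3 : fderiv ℝ (fun p => N' * φ p) p = _ := (hφd.const_mul N').fderiv
    have he := h.eq p.1 hp.1.1.le p.2
    have hsplit : ((1 : ℝ), deriv f (u p.1 p.2)) =
        (1, 0) + deriv f (u p.1 p.2) • ((0 : ℝ), (1 : ℝ)) := by simp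
    rw [hsplit, map_add, map_smul, smul_eq_mul] at he
    simp only [Pi.add_apply, entropyIntegrand, e2, eid, eneg, f2, f3]
    simp only [add_apply, smul_apply, neg_apply, smul_eq_mul, hψ]
    linear_combination (-(φ p) * (w p.1 p.2 - u p.1 p.2)) * he

end IsClassicalSolution

namespace IsClassicalSolution

variable {f g : ℝ → ℝ} {ε : ℝ} {u : ℝ → ℝ → ℝ}

/-- Weak-strong uniqueness: a classical solution is the only entropy solution with its datum. -/
theorem ae_eq_of_isEntropySolution (h : IsClassicalSolution f g ε u) (hf : ContDiff ℝ 2 f)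
    (hg : ContDiff ℝ 1 g) {T : ℝ} (hT : 0 < T) {w : ℝ → ℝ → ℝ}
    (hw : IsEntropySolution f g (u 0) T w) :
    ∀ᵐ p : ℝ × ℝ ∂(volume.restrict (Ioo 0 T ×ˢ univ)), w p.1 p.2 = u p.1 p.2 := by
  have hf1 : ContDiff ℝ 1 f := hf.of_le (by norm_num)
  have hf' : ContDiff ℝ 1 (deriv f) := hf.deriv'
  have hfd : ∀ v, HasDerivAt f (deriv f v) v := fun v =>
    (hf1.differentiable one_ne_zero v).hasDerivAt
  obtain ⟨M₁, hM₁⟩ := hw.bounded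
  obtain ⟨M₂, hM₂⟩ := h.bounded T
  obtain ⟨B, hB⟩ := h.bounded_deriv T
  set M := max M₁ M₂ with hM
  have bnd : ∀ k : ℝ → ℝ, Continuous k → ∃ C, 0 ≤ C ∧ ∀ v ∈ Icc (-M) M, |k v| ≤ C := fun k hk => by
    obtain ⟨C, hC⟩ := (isCompact_Icc (a := -M) (b := M)).exists_bound_of_continuousOn
      hk.continuousOn
    exact ⟨max C 0, le_max_right _ _, fun v hv => (hC v hv).trans (le_max_left _ _)⟩
  obtain ⟨Lf, pLf, hLf⟩ := bnd _ (hf1.continuous_deriv le_rfl)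
  obtain ⟨L2, pL2, hL2⟩ := bnd _ (hf'.continuous_deriv le_rfl)
  obtain ⟨Lg, pLg, hLg⟩ := bnd _ (hg.continuous_deriv le_rfl)
  set B' := max B 0 with hB'
  have hB0 : 0 ≤ B' := le_max_right _ _
  have hqd : ∀ v, HasDerivAt (fun v => ∫ s in (0 : ℝ)..v, s * deriv f s) (v * deriv f v) v :=
    hasDerivAt_integral_zero (k := fun s => s * deriv f s)
      (continuous_id.mul (hf1.continuous_deriv le_rfl))
  set q : ℝ → ℝ := fun v => ∫ s in (0 : ℝ)..v, s * deriv f s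
  -- The factor `2`, here and in `2 * Lf` below, compensates the `1 / 2` of the quadratic entropy.
  set C := 2 * (Lg + L2 * B') with hC
  -- pointwise control of the relative entropy production
  have pw : ∀ a b φ φt φx ux : ℝ, a ∈ Icc (-M) M → b ∈ Icc (-M) M → |ux| ≤ B' → 0 ≤ φ →
      φt + 2 * Lf * |φx| + C * φ ≤ -φ →
      (a - b) ^ 2 / 2 * φt + (q a - q b - b * (f a - f b)) * φx +
        ((a - b) * (g a - g b) - (f a - f b - deriv f b * (a - b)) * ux) * φ ≤
      -((a - b) ^ 2 / 2 * φ) := by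
    intro a b φ φt φx ux ha hb hux hφ hin
    have hseg : uIcc b a ⊆ Icc (-M) M := uIcc_subset_Icc hb ha
    -- The left side is `∫ (z - b) f'(z) dz` from `b` to `a`, hence quadratic in `a - b`.
    have r1 : |q a - q b - b * (f a - f b)| ≤ Lf * |a - b| ^ 2 := by
      have := abs_sub_le_mul_sq (k := fun z => q z - b * f z) (k' := fun z => (z - b) * deriv f z)
        (fun z => by
          convert! (hqd z).sub ((hfd z).const_mul b) using 1
          ring) pLf (u := b) (w := a) (fun z hz => by
            rw [abs_mul, mul_comm]
            exact mul_le_mul_of_nonneg_right (hLf z (hseg hz)) (abs_nonneg _))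
      convert! this using 2
      ring
    have r2 : |f a - f b - deriv f b * (a - b)| ≤ L2 * |a - b| ^ 2 :=
      abs_taylor_le (hf1.differentiable one_ne_zero) pL2 fun z hz =>
        (convex_uIcc b a).norm_image_sub_le_of_norm_deriv_le
          (fun y _ => hf'.differentiable one_ne_zero y) (fun y hy => hL2 y (hseg hy))
          left_mem_uIcc hz
    have r3 : |g a - g b| ≤ Lg * |a - b| :=
      (convex_uIcc b a).norm_image_sub_le_of_norm_deriv_le
        (fun y _ => hg.differentiable one_ne_zero y) (fun y hy => hLg y (hseg hy))
        left_mem_uIcc right_mem_uIcc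
    rw [sq_abs] at r1 r2
    have t1 : (q a - q b - b * (f a - f b)) * φx ≤ Lf * (a - b) ^ 2 * |φx| := by
      refine (le_abs_self _).trans ?_
      rw [abs_mul]
      exact mul_le_mul_of_nonneg_right r1 (abs_nonneg _)
    have t2 : (a - b) * (g a - g b) ≤ Lg * (a - b) ^ 2 := by
      refine (le_abs_self _).trans ?_
      rw [abs_mul, ← sq_abs (a - b)]
      nlinarith [abs_nonneg (a - b)]
    have t3 : -((f a - f b - deriv f b * (a - b)) * ux) ≤ L2 * (a - b) ^ 2 * B' := by
      refine (neg_le_abs _).trans ?_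
      rw [abs_mul]
      exact mul_le_mul r2 hux (abs_nonneg _) (mul_nonneg pL2 (sq_nonneg _))
    have t4 : ((a - b) * (g a - g b) - (f a - f b - deriv f b * (a - b)) * ux) * φ ≤
        (Lg * (a - b) ^ 2 + L2 * (a - b) ^ 2 * B') * φ :=
      mul_le_mul_of_nonneg_right (by linarith) hφ
    have t5 := mul_le_mul_of_nonneg_left hin (show 0 ≤ (a - b) ^ 2 / 2 by positivity)
    rw [hC] at t5
    linarith
  have hae : ∀ᵐ p : ℝ × ℝ ∂(volume.restrict (Ioo 0 T ×ˢ univ)),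
      p ∈ Ioo 0 T ×ˢ (univ : Set ℝ) ∧ w p.1 p.2 ∈ Icc (-M) M := by
    filter_upwards [hM₁, ae_restrict_mem (measurableSet_Ioo.prod MeasurableSet.univ)] with p h1 h2
    exact ⟨h2, abs_le.1 (h1.trans (le_max_left _ _))⟩
  have step : ∀ δ, 0 < δ → 2 * Lf * δ ≤ 1 →
      ∀ᵐ p : ℝ × ℝ ∂(volume.restrict (Ioo 0 T ×ˢ univ)),
        0 < T - p.1 - δ * √(1 + p.2 ^ 2) → w p.1 p.2 = u p.1 p.2 := by
    intro δ hδ hLδ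
    have hsupp := tsupport_dissipatedTest_subset (T := T) (K := C + 1) h.pos hδ
    obtain ⟨Z, hZi, hZ0, hZ⟩ := h.integral_relativeEntropy_nonneg hf1 hg.continuous hT hw hqd
      (contDiff_dissipatedTest (ε := ε) (T := T) (δ := δ) (K := C + 1))
      (hasCompactSupport_dissipatedTest h.pos hδ)
      (fun p hp => ⟨lt_of_le_of_lt (hsupp hp).1.2 (by linarith), trivial⟩)
      (fun p hp => ⟨lt_of_lt_of_le (by linarith [h.pos]) (hsupp hp).1.1, trivial⟩)
      dissipatedTest_nonneg
    have hle : ∀ᵐ p : ℝ × ℝ ∂(volume.restrict (Ioo 0 T ×ˢ univ)), Z p ≤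
        -((w p.1 p.2 - u p.1 p.2) ^ 2 / 2 * dissipatedTest ε T δ (C + 1) p) := by
      filter_upwards [hae] with p hp
      rw [hZ p hp.1]
      have ht := Ioo_subset_Icc_self hp.1.1
      exact pw _ _ _ _ _ _ hp.2 (abs_le.1 ((hM₂ _ ht _).trans (le_max_right _ _)))
        ((hB _ ht _).trans (le_max_left _ _)) (dissipatedTest_nonneg p)
        (dissipatedTest_ineq h.pos hδ (by positivity) hLδ hp.1.1.1)
    have hneg : 0 ≤ᵐ[volume.restrict (Ioo 0 T ×ˢ univ)] -Z := by
      filter_upwards [hle] with p hp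
      have := mul_nonneg (show 0 ≤ (w p.1 p.2 - u p.1 p.2) ^ 2 / 2 by positivity)
        (dissipatedTest_nonneg (ε := ε) (T := T) (δ := δ) (K := C + 1) p)
      simp only [Pi.zero_apply, Pi.neg_apply]
      linarith
    -- `Z` is nonpositive by the pointwise control, while its integral is nonnegative by the entropy
    -- inequalities: it vanishes almost everywhere.
    have hint : ∫ p in Ioo 0 T ×ˢ univ, (-Z) p = 0 := by
      refine le_antisymm ?_ (integral_nonneg_of_ae hneg)
      rw [integral_neg']
      linarith
    have hzero := (integral_eq_zero_iff_of_nonneg_ae hneg hZi.neg).1 hint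
    filter_upwards [hle, hzero, hae] with p h1 h2 h3 hpos
    have h4 : Z p = 0 := by simpa using h2
    have h5 : 0 < dissipatedTest ε T δ (C + 1) p := by
      rw [dissipatedTest_of_nonneg h.pos h3.1.1.1.le]
      exact mul_pos (Real.exp_pos _) (expNegInvGlue.pos_of_pos hpos)
    rw [h4] at h1
    have h6 : (w p.1 p.2 - u p.1 p.2) ^ 2 ≤ 0 := by
      by_contra hcon
      have := mul_pos (not_le.1 hcon) h5
      linarith
    exact sub_eq_zero.1 (pow_eq_zero_iff two_ne_zero |>.1 (le_antisymm h6 (sq_nonneg _)))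
  -- As `δ → 0` the regions where the test function is positive exhaust the strip; a sequence of `δ`
  -- suffices.
  have hseq : ∀ᵐ p : ℝ × ℝ ∂(volume.restrict (Ioo 0 T ×ˢ univ)), ∀ n : ℕ,
      0 < T - p.1 - 1 / (2 * Lf + 1 + n) * √(1 + p.2 ^ 2) → w p.1 p.2 = u p.1 p.2 :=
    ae_all_iff.2 fun n => step _ (by positivity) (by
      rw [mul_one_div, div_le_one (by positivity)]
      linarith [n.cast_nonneg (α := ℝ)])
  filter_upwards [hseq, hae] with p h1 h2
  have hTp : 0 < T - p.1 := sub_pos.2 h2.1.1.2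
  obtain ⟨n, hn⟩ := exists_nat_gt (√(1 + p.2 ^ 2) / (T - p.1))
  refine h1 n ?_
  rw [div_lt_iff₀ hTp] at hn
  rw [sub_pos, one_div, inv_mul_lt_iff₀ (by positivity)]
  nlinarith

end IsClassicalSolution

/-! ### The weighted norm as a pointwise bound -/

theorem norm_weighted_le_iff {κ E x : ℝ} {v : ℝ → ℝ} :
    ‖(expWeight κ x)⁻¹ • (v x, deriv v x)‖ ≤ E ↔
      |v x| ≤ E * expWeight κ x ∧ |deriv v x| ≤ E * expWeight κ x := by
  have hw := expWeight_pos κ x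
  rw [norm_smul, norm_inv, Real.norm_eq_abs, abs_of_pos hw, inv_mul_le_iff₀ hw, mul_comm, Prod.norm_def,
    max_le_iff]
  rfl

theorem weightedNorm_le {κ E : ℝ} {v : ℝ → ℝ}
    (h : ∀ x, |v x| ≤ E * expWeight κ x ∧ |deriv v x| ≤ E * expWeight κ x) :
    weightedNorm κ v ≤ ENNReal.ofReal E := by
  have := eLpNorm_le_of_ae_bound (p := ⊤) (μ := volume)
    (Eventually.of_forall fun x => norm_weighted_le_iff.2 (h x))
  simpa [weightedNorm] using this

/-- The essential supremum gives the bound almost everywhere, hence on a dense set; by continuity it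
holds everywhere. -/
theorem le_of_weightedNorm_le {κ E : ℝ} (hE : 0 ≤ E) {v : ℝ → ℝ} (hv : Continuous v)
    (hv' : Continuous (deriv v)) (h : weightedNorm κ v ≤ ENNReal.ofReal E) (x : ℝ) :
    |v x| ≤ E * expWeight κ x ∧ |deriv v x| ≤ E * expWeight κ x := by
  rw [← norm_weighted_le_iff]
  have hwc : Continuous fun x => (expWeight κ x)⁻¹ := by
    have : Continuous (expWeight κ) := by unfold expWeight; fun_prop
    exact this.inv₀ fun x => (expWeight_pos κ x).ne'
  have hc : Continuous fun x => ‖(expWeight κ x)⁻¹ • (v x, deriv v x)‖ :=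
    (hwc.smul (hv.prodMk hv')).norm
  have hae : ∀ᵐ x : ℝ, ‖(expWeight κ x)⁻¹ • (v x, deriv v x)‖ ≤ E := by
    rw [weightedNorm, eLpNorm_exponent_top] at h
    filter_upwards [ae_le_eLpNormEssSup (f := fun x => (expWeight κ x)⁻¹ • (v x, deriv v x))
      (μ := volume)] with x hx
    have := hx.trans h
    rw [← ofReal_norm, ENNReal.ofReal_le_ofReal_iff hE] at this
    exact this
  have hd : Dense {x | ‖(expWeight κ x)⁻¹ • (v x, deriv v x)‖ ≤ E} :=
    Measure.dense_of_ae hae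
  exact (isClosed_le hc continuous_const).closure_subset (hd x)

theorem expWeight_le_one {κ : ℝ} (hκ : 0 ≤ κ) (x : ℝ) : expWeight κ x ≤ 1 := by
  rw [expWeight, Real.exp_le_one_iff]
  nlinarith [le_max_right x 0]

namespace IsFrontSystem

variable {a g U : ℝ → ℝ} {um up s : ℝ}

theorem abs_profile_le (h : IsFrontSystem a g U um up s) (x : ℝ) : |U x| ≤ |um| + |up| := by
  have e : ∀ z : ℝ, |s * z| = |z| := fun z => by rw [abs_mul, h.abs_s, one_mul]
  rw [← e (U x), ← e um, ← e up]
  rw [abs_le]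
  constructor
  · linarith [h.left_le x, neg_abs_le (s * um), abs_nonneg (s * up)]
  · linarith [h.le_right x, le_abs_self (s * up), abs_nonneg (s * um)]

theorem exists_abs_deriv_profile_le (h : IsFrontSystem a g U um up s) :
    ∃ B, ∀ x, |deriv U x| ≤ B := by
  obtain ⟨C, hC⟩ := (isCompact_Icc (a := -(|um| + |up|)) (b := |um| + |up|)).exists_bound_of_continuousOn
    h.contDiff_F.continuous.continuousOn
  exact ⟨C, fun x => by rw [(h.hasDerivAt_U x).deriv]; exact hC _ (abs_le.1 (h.abs_profile_le x))⟩

end IsFrontSystem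

/-! ### Return to the laboratory frame -/

theorem hasDerivAt_slice {u : ℝ → ℝ → ℝ} {t x : ℝ}
    (h : DifferentiableAt ℝ (fun p : ℝ × ℝ => u p.1 p.2) (t, x)) :
    HasDerivAt (u t) (fderiv ℝ (fun p : ℝ × ℝ => u p.1 p.2) (t, x) (0, 1)) x :=
  HasFDerivAt.comp_hasDerivAt (l := fun p : ℝ × ℝ => u p.1 p.2) (f := fun x => (t, x)) x
    h.hasFDerivAt ((hasDerivAt_const x t).prodMk (hasDerivAt_id x))

/-- The differential, in the laboratory frame, of a function given in a moving frame. -/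
theorem fderiv_movingFrame {u : ℝ → ℝ → ℝ} {σ t x : ℝ}
    (h : DifferentiableAt ℝ (fun p : ℝ × ℝ => u p.1 p.2) (t, x - σ * t)) (w : ℝ × ℝ) :
    fderiv ℝ (fun p : ℝ × ℝ => u p.1 (p.2 - σ * p.1)) (t, x) w =
      fderiv ℝ (fun p : ℝ × ℝ => u p.1 p.2) (t, x - σ * t) (w.1, w.2 - σ * w.1) := by
  have h2 : HasFDerivAt (fun p : ℝ × ℝ => (p.1, p.2 - σ * p.1))
      ((ContinuousLinearMap.fst ℝ ℝ ℝ).prod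
        (ContinuousLinearMap.snd ℝ ℝ ℝ - σ • ContinuousLinearMap.fst ℝ ℝ ℝ)) (t, x) :=
    hasFDerivAt_fst.prodMk (hasFDerivAt_snd.sub (hasFDerivAt_fst.const_mul σ))
  have h3 := HasFDerivAt.comp (g := fun p : ℝ × ℝ => u p.1 p.2)
    (f := fun p : ℝ × ℝ => (p.1, p.2 - σ * p.1)) (t, x) h.hasFDerivAt h2
  have h4 := h3.fderiv
  rw [show (fun p : ℝ × ℝ => u p.1 (p.2 - σ * p.1)) =
    (fun p : ℝ × ℝ => u p.1 p.2) ∘ fun p : ℝ × ℝ => (p.1, p.2 - σ * p.1) from rfl, h4]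
  simp

theorem theorem2p1
    (f g : ℝ → ℝ) (hf : ContDiff ℝ ∞ f) (hg : ContDiff ℝ ∞ g)
    (U : ℝ → ℝ) (σ um up : ℝ)
    (hU : IsSmoothNoncharacteristicFront f g U σ um up)
    (hum : deriv g um < 0) (hup : 0 < deriv g up)
    (κ : ℝ) (hκ : criticalExponent f g σ up ≤ κ) :
    ∃ C > (0 : ℝ), ∃ δ₀ > (0 : ℝ), ∀ u₀ : ℝ → ℝ,
      IsBUC1 u₀ →
      IsBUC (fun x => (u₀ x - U x) / expWeight κ x) →
      IsBUC (fun x => deriv (fun y => u₀ y - U y) x / expWeight κ x) →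
      weightedNorm κ (fun x => u₀ x - U x) ≤ ENNReal.ofReal δ₀ →
      ∃ u : ℝ → ℝ → ℝ,
        -- `u` is a global entropy solution with initial datum `u₀`, and it is of class `C¹`
        u 0 = u₀ ∧
        ContDiffOn ℝ 1 (fun p : ℝ × ℝ => u p.1 p.2) (Ici 0 ×ˢ univ) ∧
        (∀ T > 0, IsEntropySolution f g u₀ T u) ∧
        -- it is the only entropy solution with initial datum `u₀`, on any time interval
        (∀ T > 0, ∀ w : ℝ → ℝ → ℝ, IsEntropySolution f g u₀ T w →
          ∀ᵐ p : ℝ × ℝ ∂(volume.restrict (Ioo 0 T ×ˢ univ)), w p.1 p.2 = u p.1 p.2) ∧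
        -- the stability estimate
        ∀ t : ℝ, 0 ≤ t →
          weightedNorm κ (fun x => u t (x + σ * t) - U x) ≤
            ENNReal.ofReal C * weightedNorm κ (fun x => u₀ x - U x) *
              ENNReal.ofReal (Real.exp (-t * decayRate f g σ um up κ)) := by
  obtain ⟨a₁, g₁, s, ρ, hρ, hF, hloc, haup, hgum, hgup⟩ := exists_isFrontSystem hf hg hU hum hup
  have hκ' : deriv g₁ up / |a₁ up| ≤ κ := by rw [hgup, haup]; exact hκ
  have hapos : 0 < |a₁ up| := abs_pos.2 (hF.a_neg up).ne
  have hκ0 : 0 ≤ κ := le_trans (div_nonneg hF.deriv_right.le hapos.le) hκ'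
  have hrate : 0 ≤ decayRate f g σ um up κ :=
    le_min (abs_nonneg _) (mul_nonneg (sub_nonneg.2 hκ) (abs_nonneg _))
  obtain ⟨C, hC, δ, hδ, H⟩ := hF.exists_solution hκ' hrate
    (by rw [hgum]; exact min_le_left _ _) (by rw [hgup, haup]; exact min_le_right _ _)
  have hUd : Differentiable ℝ U := hU.smooth.differentiable (by simp)
  have hU'c : Continuous (deriv U) := hU.smooth.continuous_deriv (by simp)
  have hf2 : ContDiff ℝ 2 f := hf.of_le ENat.LEInfty.out
  have hf1 : ContDiff ℝ 1 f := hf.of_le ENat.LEInfty.out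
  have hg1 : ContDiff ℝ 1 g := hg.of_le ENat.LEInfty.out
  -- The bound `ρ / C` forces `C E ≤ ρ`, so the solution stays within `ρ` of the profile, where the
  -- truncated coefficients are the original ones.
  have hδ₀ : 0 < min δ (ρ / C) := by positivity
  refine ⟨C, hC, min δ (ρ / C), hδ₀, fun u₀ hu₀ _ _ hsmall => ?_⟩
  have hu₀d : Differentiable ℝ u₀ := hu₀.1.differentiable one_ne_zero
  have hdsub : deriv (fun x => u₀ x - U x) = fun x => deriv u₀ x - deriv U x :=
    funext fun x => deriv_fun_sub (hu₀d x) (hUd x)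
  have hv₀c : Continuous fun x => u₀ x - U x := hu₀.1.continuous.sub hUd.continuous
  have hv₀'c : Continuous (deriv fun x => u₀ x - U x) := by
    rw [hdsub]; exact (hu₀.1.continuous_deriv le_rfl).sub hU'c
  have htop : weightedNorm κ (fun x => u₀ x - U x) ≠ ⊤ := ne_top_of_le_ne_top ENNReal.ofReal_ne_top hsmall
  set E := (weightedNorm κ (fun x => u₀ x - U x)).toReal with hEdef
  have hE0 : 0 ≤ E := ENNReal.toReal_nonneg
  have hEeq : weightedNorm κ (fun x => u₀ x - U x) = ENNReal.ofReal E :=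
    (ENNReal.ofReal_toReal htop).symm
  have hEle : E ≤ min δ (ρ / C) := by
    rwa [hEeq, ENNReal.ofReal_le_ofReal_iff hδ₀.le] at hsmall
  have hEδ : E ≤ δ := hEle.trans (min_le_left _ _)
  have hEρ : C * E ≤ ρ := by
    have := hEle.trans (min_le_right _ _)
    rwa [le_div_iff₀' hC] at this
  have hinit := le_of_weightedNorm_le hE0 hv₀c hv₀'c hEeq.le
  rw [hdsub] at hinit
  have hmono : ∀ y, E * expWeight κ y ≤ δ * expWeight κ y := fun y =>
    mul_le_mul_of_nonneg_right hEδ (expWeight_pos κ y).le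
  obtain ⟨v, ε, hε, hv0, hvC, hveq, hvest⟩ := H u₀ hu₀.1 hu₀.2.2.2
    (fun y => (hinit y).1.trans (hmono y)) (fun y => (hinit y).2.trans (hmono y))
  replace hvest := hvest E hE0 hEδ (fun y => (hinit y).1) (fun y => (hinit y).2)
  have hle1 : ∀ t, 0 ≤ t → ∀ x,
      C * E * Real.exp (-t * decayRate f g σ um up κ) * expWeight κ x ≤ ρ := fun t ht x => by
    have h1 : Real.exp (-t * decayRate f g σ um up κ) ≤ 1 := by
      rw [Real.exp_le_one_iff]; nlinarith
    calc _ ≤ C * E * 1 * 1 :=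
          mul_le_mul (mul_le_mul_of_nonneg_left h1 (by positivity)) (expWeight_le_one hκ0 x)
            (expWeight_pos κ x).le (by positivity)
      _ ≤ ρ := by linarith
  have hopen : IsOpen (Ioi (-ε) ×ˢ (univ : Set ℝ)) := isOpen_Ioi.prod isOpen_univ
  have hvd : ∀ t, 0 ≤ t → ∀ x, DifferentiableAt ℝ (fun p : ℝ × ℝ => v p.1 p.2) (t, x) :=
    fun t ht x => (hvC.contDiffAt (hopen.mem_nhds ⟨lt_of_lt_of_le (neg_lt_zero.2 hε) ht,
      trivial⟩)).differentiableAt one_ne_zero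
  set u : ℝ → ℝ → ℝ := fun t x => v t (x - σ * t) with hu
  have hu0 : u 0 = u₀ := by funext x; simp [hu, hv0]
  obtain ⟨B, hB⟩ := hF.exists_abs_deriv_profile_le
  have hcl : IsClassicalSolution f g ε u :=
    { pos := hε
      contDiffOn := by
        have hS : ContDiff ℝ 1 fun p : ℝ × ℝ => (p.1, p.2 - σ * p.1) := by fun_prop
        exact hvC.comp hS.contDiffOn fun p hp => ⟨hp.1, trivial⟩
      eq := fun t ht x => by
        have hnear := (hvest t ht (x - σ * t)).1.trans (hle1 t ht _)
        obtain ⟨ha, hgv⟩ := hloc _ _ hnear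
        rw [fderiv_movingFrame (hvd t ht _)]
        have := hveq t ht (x - σ * t)
        rw [ha, hgv] at this
        simpa [hu] using this
      bounded := fun T => ⟨ρ + (|um| + |up|), fun t ht x => by
        have h1 := (hvest t ht.1 (x - σ * t)).1.trans (hle1 t ht.1 _)
        have h2 := hF.abs_profile_le (x - σ * t)
        have h3 := abs_sub_abs_le_abs_sub (v t (x - σ * t)) (U (x - σ * t))
        simp only [hu]; linarith⟩
      bounded_deriv := fun T => ⟨ρ + B, fun t ht x => by
        rw [fderiv_movingFrame (hvd t ht.1 _)]
        simp only [mul_zero, sub_zero]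
        rw [← (hasDerivAt_slice (hvd t ht.1 (x - σ * t))).deriv]
        have h1 := (hvest t ht.1 (x - σ * t)).2.trans (hle1 t ht.1 _)
        have h2 := hB (x - σ * t)
        have h3 := abs_sub_abs_le_abs_sub (deriv (v t) (x - σ * t)) (deriv U (x - σ * t))
        linarith⟩ }
  refine ⟨u, hu0, hcl.contDiffOn.mono fun p hp => ⟨lt_of_lt_of_le (neg_lt_zero.2 hε) hp.1, trivial⟩,
    fun T hT => hu0 ▸ hcl.isEntropySolution (hf1.continuous_deriv le_rfl) hT,
    fun T hT w hw => hcl.ae_eq_of_isEntropySolution hf2 hg1 hT (hu0.symm ▸ hw), fun t ht => ?_⟩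
  rw [hEeq, ← ENNReal.ofReal_mul hC.le, ← ENNReal.ofReal_mul (by positivity)]
  have hshift : (fun x => u t (x + σ * t) - U x) = fun x => v t x - U x := by
    funext x; simp [hu]
  rw [hshift]
  refine weightedNorm_le fun x => ?_
  rw [deriv_fun_sub (hasDerivAt_slice (hvd t ht x)).differentiableAt (hUd x)]
  exact hvest t ht x
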